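/- **Theorem 4.3.** Let $n\ge 2$, $\mu_1,\dots,\mu_n>0$, $\epsilon\in\{0,1\}^n$, $N\in\mathbb N$ and $a=2N+\sum_i\epsilon_i$. Let $r_i$ be the reflection $y_i\mapsto -y_i$, $T_i=\partial_{y_i}+\frac{\mu_i}{y_i}(1-r_i)$ the Dunkl operators on $\mathbb C[y_1,\dots,y_n]$, $\Delta=\sum_iT_i^2$, and let $\mathcal H=\mathcal H_a^{\epsilon}$ be the irreducible space of Dunkl-harmonics consisting of all homogeneous polynomials $f$ of degree $a$ with $\Delta f=0$ and $r_if=(-1)^{\epsilon_i}f$ for all $i$. Equip polynomials with the Dunkl (Fischer) inner product $\langle f|g\rangle=(\overline f(T_1,\dots,T_n)g)(0)$. For $A\subset\{1,\dots,n\}$ put $$C_A=A_0^2-A_0-J_+J_-,\quad J_+=\sum_{i\in A}\tfrac{y_i^2}{2},\quad J_-=\sum_{i\in A}\tfrac{T_i^2}{2},\quad A_0=\sum_{i\in A}\tfrac12\left(y_i\partial_{y_i}+\tfrac12+\mu_i\right),$$ and write $[t]=\{1,\dots,t\}$, $[2\ldots t]=\{2,\dots,t\}$. Put $p=n-2$,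 $\beta_m=\sum_{i=1}^{m+1}(\mu_i+\frac12+\epsilon_i)-1$ for $0\le m\le n-1$, $\kappa(x,\beta)=(x+\frac{\beta+1}2)(x+\frac{\beta-1}2)$, $|\ell|_m=\ell_1+\dots+\ell_m$ and $V=\{\ell\in\mathbb N^{p}:|\ell|_{p}\le N\}$. Let $\psi$ be a basis of $\mathcal H$ consisting of eigenvectors of all $C_{[t]}$, $2\le t\le n-1$, and $\varphi$ a basis of $\mathcal H$ consisting of eigenvectors of all $C_{[2\ldots t]}$, $3\le t\le n$. Then each of the two bases is indexed, in exactly one way, by $V$ such that for $2\le m\le n-1$ $$C_{[m]}\psi_\ell=\kappa(|\ell|_{m-1},\beta_{m-1})\psi_\ell,\qquad C_{[2\ldots m+1]}\varphi_k=\kappa(|k|_{m-1},\beta_m-\beta_0-1)\varphi_k .$$ With this indexing there are complex numbers $u_\ell,v_k\neq0$ with $|u_\ell|^2=\langle\psi_\ell|\psi_\ell\rangle$, $|v_k|^2=\langle\varphi_k|\varphi_k\rangle$ (so they are phases if the bases are normalized) such that for all $k,\ell\in V$ $$\langle\varphi_k|\psi_\ell\rangle=u_\ell\,v_k\,\sqrt{\omega_p(x)\mu_p(k)}\;R_p(k;x;\beta;N),\qquad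 x_m=|\ell|_m\ (1\le m\le p),$$ where $\omega_p(x),\mu_p(k)>0$. Here, with $x_0=0$ and $x_{p+1}=N$, $R_p$ is the multivariate Racah polynomial $$R_p(k;x;\beta;N)=\prod_{j=1}^p r_{k_j}\big(2|k|_{j-1}+\beta_j-\beta_0-1,\ \beta_{j+1}-\beta_j-1,\ |k|_{j-1}-x_{j+1}-1,\ |k|_{j-1}+\beta_j+x_{j+1};\ x_j-|k|_{j-1}\big),$$ $$r_m(\alpha,\beta,\gamma,\delta;x)=(\alpha+1)_m(\beta+\delta+1)_m(\gamma+1)_m\;{}_4F_3\!\left[{-m,\;m+\alpha+\beta+1,\;-x,\;x+\gamma+\delta+1\atop \alpha+1,\;\beta+\delta+1,\;\gamma+1};1\right],$$ read as a polynomial, i.e. the prefactor is multiplied into the terminating series, and $$\omega_p(x)=\prod_{j=0}^p\frac{\Gamma(\beta_{j+1}+x_{j+1}+x_j)\,\Gamma(\beta_{j+1}-\beta_j+x_{j+1}-x_j)}{\Gamma(\beta_j+x_{j+1}+x_j+1)\,(x_{j+1}-x_j)!}\prod_{j=1}^p(\beta_j+2x_j),$$ $$\mu_p(k)=\prod_{j=1}^p\frac{\Gamma(2|k|_{j-1}+k_j+\beta_{j+1}-\beta_0-1)\,(2|k|_j+\beta_{j+1}-\beta_0-1)}{\Gamma(k_j+\beta_{j+1}-\beta_j)\,\Gamma(2|k|_{j-1}+k_j+\beta_j-\beta_0)\,k_j!}\cdot\frac{\Gamma(\beta_0+N+1-|k|_p)\,(N-|k|_p)!}{\Gamma(\beta_{p+1}-\beta_0+N+|k|_p)\,\Gamma(\beta_{p+1}+N+|k|_p)}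 .$$ -/

import Mathlib

noncomputable section

namespace DunklRacah

/-! ### The `ℤ₂ⁿ` Dunkl model -/

/-- The reflection `r_i`: substitute `y_i ↦ -y_i` in a polynomial. -/
def reflection {n : ℕ} (i : Fin n) :
    MvPolynomial (Fin n) ℂ →ₐ[ℂ] MvPolynomial (Fin n) ℂ :=
  MvPolynomial.aeval (Function.update MvPolynomial.X i (-MvPolynomial.X i))

/-- Division by `y_i`, discarding the monomials not divisible by `y_i`. -/
def divByVar {n : ℕ} (i : Fin n) : Module.End ℂ (MvPolynomial (Fin n) ℂ) where
  toFun f := MvPolynomial.divMonomial f (Finsupp.single i 1)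
  map_add' f g := MvPolynomial.add_divMonomial f g _
  map_smul' c f := by
    ext s
    simp [MvPolynomial.coeff_divMonomial]

/-- The Dunkl operator `T_i = ∂_{y_i} + (μ_i / y_i) (1 - r_i)` on polynomials; the polynomial
`f - r_i f` is always divisible by `y_i`, see `X_mul_divByVar_sub_reflection`. -/
def dunkl {n : ℕ} (μ : Fin n → ℝ) (i : Fin n) : Module.End ℂ (MvPolynomial (Fin n) ℂ) :=
  (MvPolynomial.pderiv i).toLinearMap +
    (μ i : ℂ) • (divByVar i ∘ₗ (LinearMap.id - (reflection i).toLinearMap))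

/-- The Dunkl Laplacian `Δ = ∑ T_i²`. -/
def laplacian {n : ℕ} (μ : Fin n → ℝ) : Module.End ℂ (MvPolynomial (Fin n) ℂ) :=
  ∑ i, dunkl μ i ^ 2

/-- Multiplication by `y_i`. -/
def mulVar {n : ℕ} (i : Fin n) : Module.End ℂ (MvPolynomial (Fin n) ℂ) :=
  LinearMap.mulLeft ℂ (MvPolynomial.X i)

/-- The `su(1,1)` generator `J₊ = y²/2` in the tensor factors in `A`, i.e. `∑_{i ∈ A} y_i² / 2`. -/
def raising {n : ℕ} (A : Finset (Fin n)) : Module.End ℂ (MvPolynomial (Fin n) ℂ) :=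
  ∑ i ∈ A, (1 / 2 : ℂ) • mulVar i ^ 2

/-- The `su(1,1)` generator `J₋ = T²/2` in the tensor factors in `A`, i.e. `∑_{i ∈ A} T_i² / 2`. -/
def lowering {n : ℕ} (μ : Fin n → ℝ) (A : Finset (Fin n)) :
    Module.End ℂ (MvPolynomial (Fin n) ℂ) :=
  ∑ i ∈ A, (1 / 2 : ℂ) • dunkl μ i ^ 2

/-- The `su(1,1)` generator `A₀ = (y ∂_y + γ)/2`, `γ = 1/2 + μ`, in the tensor factors in `A`,
i.e. `∑_{i ∈ A} (y_i ∂_{y_i} + 1/2 + μ_i) / 2`. -/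
def weightOp {n : ℕ} (μ : Fin n → ℝ) (A : Finset (Fin n)) :
    Module.End ℂ (MvPolynomial (Fin n) ℂ) :=
  ∑ i ∈ A, (1 / 2 : ℂ) • (mulVar i * (MvPolynomial.pderiv i).toLinearMap +
    ((1 / 2 + μ i : ℝ) : ℂ) • (1 : Module.End ℂ (MvPolynomial (Fin n) ℂ)))

/-- The generator `C_A` of the higher rank Racah algebra in the Dunkl model: the Casimir element
`C = A₀² - A₀ - J₊ J₋` of `su(1,1)`, lifted to the tensor factors in `A` by the iterated
comultiplication (each generator `X` goes to the sum over `i ∈ A` of `X` acting in factor `i`). -/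
def casimir {n : ℕ} (μ : Fin n → ℝ) (A : Finset (Fin n)) :
    Module.End ℂ (MvPolynomial (Fin n) ℂ) :=
  weightOp μ A ^ 2 - weightOp μ A - raising A * lowering μ A

/-- The set `[m] = {1, …, m}`; the index `i : Fin n` stands for the integer `i + 1`. -/
def initialSet (n m : ℕ) : Finset (Fin n) := Finset.univ.filter fun i => (i : ℕ) + 1 ≤ m

/-- The set `[2…m] = {2, …, m}`; the index `i : Fin n` stands for the integer `i + 1`. -/
def tailSet (n m : ℕ) : Finset (Fin n) :=
  Finset.univ.filter fun i => 2 ≤ (i : ℕ) + 1 ∧ (i : ℕ) + 1 ≤ m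

/-- The irreducible space `H_a^ε` of Dunkl harmonics: the homogeneous polynomials `f` of degree
`a` with `Δ f = 0` and `r_i f = (-1)^{ε_i} f` for all `i`. -/
def harmonics {n : ℕ} (μ : Fin n → ℝ) (a : ℕ) (ε : Fin n → Fin 2) :
    Submodule ℂ (MvPolynomial (Fin n) ℂ) :=
  MvPolynomial.homogeneousSubmodule (Fin n) ℂ a ⊓ LinearMap.ker (laplacian μ) ⊓
    ⨅ i, LinearMap.ker ((reflection i).toLinearMap - ((-1 : ℂ) ^ (ε i : ℕ)) • LinearMap.id)

/-- The Dunkl factorial `∏_{s=1}^{m} (s + μ (1 - (-1)^s))`, so that `T^m y^m` is this number. -/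
def dunklFactorial (μ : ℝ) (m : ℕ) : ℝ :=
  ∏ s ∈ Finset.Icc 1 m, ((s : ℝ) + μ * (1 - (-1) ^ s))

/-- The Dunkl (Fischer) inner product `⟨f | g⟩ = (f̄(T₁, …, T_n) g)(0)`, conjugate linear in the
first argument, written in coefficients: the monomials `y^c` are orthogonal, with square norm
`∏_i dunklFactorial (μ_i) (c_i)`.  Multiplication by `y_i` and `T_i` are adjoint to each other,
see `fischer_X_mul`. -/
def fischer {n : ℕ} (μ : Fin n → ℝ) (f g : MvPolynomial (Fin n) ℂ) : ℂ :=
  ∑ c ∈ f.support, (starRingEnd ℂ) (f.coeff c) * g.coeff c *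
    ((∏ i, dunklFactorial (μ i) (c i) : ℝ) : ℂ)

/-- `β_m = γ_{[m+1]} - 1 + ∑_{j=1}^{m+1} ε_j`, where `γ_{[m]} = m/2 + ∑_{j=1}^m μ_j`. -/
def betaPar {n : ℕ} (μ : Fin n → ℝ) (ε : Fin n → Fin 2) (m : ℕ) : ℝ :=
  ∑ i ∈ initialSet n (m + 1), (1 / 2 + μ i + ((ε i : ℕ) : ℝ)) - 1

/-- `κ(x, β) = (x + (β+1)/2) (x + (β-1)/2)`. -/
def kappa (x β : ℝ) : ℝ := (x + (β + 1) / 2) * (x + (β - 1) / 2)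

/-! ### Quantum numbers -/

/-- The quantum numbers: vectors `ℓ ∈ ℕ^p` with `ℓ_1 + ⋯ + ℓ_p ≤ N`. -/
abbrev QuantumNumbers (p N : ℕ) : Type := {l : Fin p → ℕ // ∑ i, l i ≤ N}

/-- The partial sum `|ℓ|_m = ℓ_1 + ⋯ + ℓ_m`; the index `i : Fin p` stands for `i + 1`. -/
def partialSum {p : ℕ} (l : Fin p → ℕ) (m : ℕ) : ℕ := ∑ i ∈ initialSet p m, l i

/-- The grid point `x = (x_1, …, x_p)` with `x_m = |ℓ|_m`. -/
def gridPoint {p : ℕ} (l : Fin p → ℕ) : Fin p → ℝ := fun i => partialSum l ((i : ℕ) + 1)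

/-- The sequence `x_0, x_1, …, x_{p+1}` attached to `(x_1, …, x_p)` and `N`, with `x_0 = 0` and
`x_{p+1} = N`. -/
def extend {p : ℕ} (x : Fin p → ℝ) (N : ℝ) : ℕ → ℝ
  | 0 => 0
  | j + 1 => if h : j < p then x ⟨j, h⟩ else N

/-- The bijection `ι ≃ {ℓ}` labels the family `ψ` by quantum numbers `ℓ` if
`C_{[m]} ψ_ℓ = κ(|ℓ|_{m-1}, β_{m-1}) ψ_ℓ` for `2 ≤ m ≤ n - 1`, where `n = p + 2`. -/
def IsFirstLabelling {p N : ℕ} (μ : Fin (p + 2) → ℝ) (ε : Fin (p + 2) → Fin 2) {ι : Type*}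
    (ψ : ι → MvPolynomial (Fin (p + 2)) ℂ) (l : ι ≃ QuantumNumbers p N) : Prop :=
  ∀ m ∈ Finset.Icc 2 (p + 1), ∀ i,
    casimir μ (initialSet (p + 2) m) (ψ i) =
      ((kappa (partialSum (l i).1 (m - 1)) (betaPar μ ε (m - 1)) : ℝ) : ℂ) • ψ i

/-- The bijection `ι ≃ {k}` labels the family `φ` by quantum numbers `k` if
`C_{[2…m+1]} φ_k = κ(|k|_{m-1}, β_m - β_0 - 1) φ_k` for `2 ≤ m ≤ n - 1`, where `n = p + 2`. -/
def IsSecondLabelling {p N : ℕ} (μ : Fin (p + 2) → ℝ) (ε : Fin (p + 2) → Fin 2) {ι : Type*}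
    (φ : ι → MvPolynomial (Fin (p + 2)) ℂ) (k : ι ≃ QuantumNumbers p N) : Prop :=
  ∀ m ∈ Finset.Icc 2 (p + 1), ∀ j,
    casimir μ (tailSet (p + 2) (m + 1)) (φ j) =
      ((kappa (partialSum (k j).1 (m - 1)) (betaPar μ ε m - betaPar μ ε 0 - 1) : ℝ) : ℂ) • φ j

/-! ### Racah polynomials -/

/-- The Pochhammer symbol `(a)_n = a (a+1) ⋯ (a+n-1)`. -/
def poch (a : ℝ) (n : ℕ) : ℝ := ∏ s ∈ Finset.range n, (a + s)

/-- The univariate Racah polynomial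
`r_n(α,β,γ,δ;x) = (α+1)_n (β+δ+1)_n (γ+1)_n
  ₄F₃(-n, n+α+β+1, -x, x+γ+δ+1; α+1, β+δ+1, γ+1; 1)`.
The prefactor is multiplied into the terminating series by `(a)_n = (a)_i (a+i)_{n-i}`, which gives
a polynomial in all the parameters, see `racah_eq`. -/
def racah (n : ℕ) (α β γ δ x : ℝ) : ℝ :=
  ∑ i ∈ Finset.range (n + 1),
    poch (-n) i * poch (n + α + β + 1) i * poch (-x) i * poch (x + γ + δ + 1) i / i.factorial *
      (poch (α + 1 + i) (n - i) * poch (β + δ + 1 + i) (n - i) * poch (γ + 1 + i) (n - i))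

/-- The multivariate Racah polynomial `R_p(k; x; β; N)` of Tratnik and Geronimo–Iliev; only
`β_0, …, β_{p+1}` enter. The index `j : Fin p` stands for the integer `j + 1`. -/
def multiRacah {p : ℕ} (k : Fin p → ℕ) (x : Fin p → ℝ) (β : ℕ → ℝ) (N : ℝ) : ℝ :=
  ∏ j : Fin p, racah (k j)
    (2 * partialSum k j + β ((j : ℕ) + 1) - β 0 - 1)
    (β ((j : ℕ) + 2) - β ((j : ℕ) + 1) - 1)
    (partialSum k j - extend x N ((j : ℕ) + 2) - 1)
    (partialSum k j + β ((j : ℕ) + 1) + extend x N ((j : ℕ) + 2))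
    (-partialSum k j + extend x N ((j : ℕ) + 1))

/-- The weight `ω_p(x)`; factorials `t!` are written `Γ(t+1)`. -/
def omega {p : ℕ} (x : Fin p → ℝ) (β : ℕ → ℝ) (N : ℝ) : ℝ :=
  (∏ j ∈ Finset.range (p + 1),
    Real.Gamma (β (j + 1) + extend x N (j + 1) + extend x N j) *
        Real.Gamma (β (j + 1) - β j + extend x N (j + 1) - extend x N j) /
      (Real.Gamma (β j + extend x N (j + 1) + 1 + extend x N j) *
        Real.Gamma (extend x N (j + 1) - extend x N j + 1))) *
  ∏ j ∈ Finset.Icc 1 p, (β j + 2 * extend x N j)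

/-- The normalization `μ_p(k)`. The index `j : Fin p` stands for the integer `j + 1`. -/
def dualWeight {p : ℕ} (k : Fin p → ℕ) (β : ℕ → ℝ) (N : ℕ) : ℝ :=
  (∏ j : Fin p,
    Real.Gamma (2 * partialSum k j + k j + β ((j : ℕ) + 2) - β 0 - 1) *
        (2 * partialSum k ((j : ℕ) + 1) + β ((j : ℕ) + 2) - β 0 - 1) /
      (Real.Gamma (k j + β ((j : ℕ) + 2) - β ((j : ℕ) + 1)) *
        Real.Gamma (2 * partialSum k j + k j + β ((j : ℕ) + 1) - β 0) * (k j).factorial)) *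
  (Real.Gamma (β 0 + N + 1 - partialSum k p) * (N - partialSum k p).factorial /
    (Real.Gamma (β (p + 1) - β 0 + N + partialSum k p) *
      Real.Gamma (β (p + 1) + N + partialSum k p)))

/-! ### Checks of the definitions -/

theorem poch_add (a : ℝ) (m n : ℕ) : poch a (m + n) = poch a m * poch (a + m) n := by
  simp [poch, Finset.prod_range_add, add_assoc]

/-- Where no denominator vanishes, `racah` is the hypergeometric expression. -/
theorem racah_eq (n : ℕ) (α β γ δ x : ℝ) (h1 : poch (α + 1) n ≠ 0)
    (h2 : poch (β + δ + 1) n ≠ 0) (h3 : poch (γ + 1) n ≠ 0) :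
    racah n α β γ δ x = poch (α + 1) n * poch (β + δ + 1) n * poch (γ + 1) n *
      ∑ i ∈ Finset.range (n + 1),
        poch (-n) i * poch (n + α + β + 1) i * poch (-x) i * poch (x + γ + δ + 1) i /
          (poch (α + 1) i * poch (β + δ + 1) i * poch (γ + 1) i * i.factorial) := by
  rw [racah, Finset.mul_sum]
  refine Finset.sum_congr rfl fun i hi => ?_
  obtain ⟨m, rfl⟩ := Nat.exists_eq_add_of_le (Nat.lt_succ_iff.mp (Finset.mem_range.mp hi))
  rw [poch_add] at h1 h2 h3
  rw [poch_add (α + 1), poch_add (β + δ + 1), poch_add (γ + 1), Nat.add_sub_cancel_left]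
  have a1 := left_ne_zero_of_mul h1
  have a2 := left_ne_zero_of_mul h2
  have a3 := left_ne_zero_of_mul h3
  have a4 : (i.factorial : ℝ) ≠ 0 := by exact_mod_cast i.factorial_ne_zero
  field_simp

theorem reflection_monomial {n : ℕ} (i : Fin n) (c : Fin n →₀ ℕ) (a : ℂ) :
    reflection i (MvPolynomial.monomial c a) = MvPolynomial.monomial c ((-1) ^ c i * a) := by
  have h : ∀ j, (Function.update MvPolynomial.X i (-MvPolynomial.X i) :
      Fin n → MvPolynomial (Fin n) ℂ) j ^ c j =
      (if j = i then (-1) ^ c i else 1) * MvPolynomial.X j ^ c j := by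
    intro j
    by_cases hj : j = i
    · subst hj
      simp only [Function.update_self, if_true]
      rw [neg_pow]
    · simp [hj]
  rw [reflection, MvPolynomial.aeval_monomial, MvPolynomial.monomial_eq,
    Finsupp.prod_fintype _ _ (by simp), Finsupp.prod_fintype _ _ (by simp)]
  simp only [h, Finset.prod_mul_distrib, Finset.prod_ite_eq', Finset.mem_univ, if_true]
  simp only [MvPolynomial.algebraMap_eq, map_mul, map_pow, map_neg, map_one]
  ring

theorem dunkl_monomial {n : ℕ} (μ : Fin n → ℝ) (i : Fin n) (c : Fin n →₀ ℕ) (a : ℂ) :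
    dunkl μ i (MvPolynomial.monomial c a) =
      MvPolynomial.monomial (c - Finsupp.single i 1)
        (((c i : ℂ) + μ i * (1 - (-1) ^ c i)) * a) := by
  have h : divByVar i (MvPolynomial.monomial c a - MvPolynomial.monomial c ((-1) ^ c i * a)) =
      MvPolynomial.monomial (c - Finsupp.single i 1) ((1 - (-1) ^ c i) * a) := by
    rw [← map_sub]
    by_cases hc : c i = 0
    · have : a - (-1) ^ c i * a = 0 := by simp [hc]
      rw [this]
      simp [hc]
    · have hle : Finsupp.single i 1 ≤ c := by
        rw [Finsupp.single_le_iff]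
        omega
      obtain ⟨d, rfl⟩ := exists_add_of_le hle
      rw [add_tsub_cancel_left]
      have e : MvPolynomial.monomial (Finsupp.single i 1 + d)
          (a - (-1) ^ (Finsupp.single i 1 + d : Fin n →₀ ℕ) i * a) = MvPolynomial.monomial (Finsupp.single i 1) 1 *
          MvPolynomial.monomial d ((1 - (-1) ^ (Finsupp.single i 1 + d : Fin n →₀ ℕ) i) * a) := by
        rw [MvPolynomial.monomial_mul]
        congr 1
        ring
      rw [e]
      exact MvPolynomial.divMonomial_monomial_mul _ _
  have e : dunkl μ i (MvPolynomial.monomial c a) =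
      MvPolynomial.pderiv i (MvPolynomial.monomial c a) + (μ i : ℂ) •
        divByVar i (MvPolynomial.monomial c a - reflection i (MvPolynomial.monomial c a)) := rfl
  rw [e, reflection_monomial, h, MvPolynomial.pderiv_monomial, MvPolynomial.smul_monomial, ← map_add]
  congr 1
  rw [smul_eq_mul]
  ring

/-- `f - r_i f` is divisible by `y_i`. -/
theorem X_mul_divByVar_sub_reflection {n : ℕ} (i : Fin n) (f : MvPolynomial (Fin n) ℂ) :
    MvPolynomial.X i * divByVar i (f - reflection i f) = f - reflection i f := by
  induction f using MvPolynomial.induction_on' with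
  | monomial c a =>
    rw [reflection_monomial, ← map_sub]
    by_cases hc : c i = 0
    · simp [hc]
    · have hle : Finsupp.single i 1 ≤ c := by
        rw [Finsupp.single_le_iff]
        omega
      obtain ⟨d, rfl⟩ := exists_add_of_le hle
      have e : ∀ b : ℂ, MvPolynomial.monomial (Finsupp.single i 1 + d) b =
          MvPolynomial.X i * MvPolynomial.monomial d b := by
        intro b
        rw [MvPolynomial.X, MvPolynomial.monomial_mul, one_mul]
      rw [e]
      congr 1
      exact MvPolynomial.X_mul_divMonomial _ _
  | add f g hf hg =>
    rw [map_add, add_sub_add_comm, map_add, mul_add, hf, hg]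

theorem fischer_eq_sum {n : ℕ} (μ : Fin n → ℝ) (f g : MvPolynomial (Fin n) ℂ)
    (s : Finset (Fin n →₀ ℕ)) (hs : f.support ⊆ s) :
    fischer μ f g = ∑ c ∈ s, (starRingEnd ℂ) (f.coeff c) * g.coeff c *
      ((∏ i, dunklFactorial (μ i) (c i) : ℝ) : ℂ) := by
  refine Finset.sum_subset hs fun c _ hc => ?_
  rw [MvPolynomial.notMem_support_iff.mp hc]
  simp

theorem fischer_add_left {n : ℕ} (μ : Fin n → ℝ) (f f' g : MvPolynomial (Fin n) ℂ) :
    fischer μ (f + f') g = fischer μ f g + fischer μ f' g := by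
  classical
  rw [fischer_eq_sum μ f g (f.support ∪ f'.support) Finset.subset_union_left,
    fischer_eq_sum μ f' g (f.support ∪ f'.support) Finset.subset_union_right,
    fischer_eq_sum μ (f + f') g _ MvPolynomial.support_add, ← Finset.sum_add_distrib]
  refine Finset.sum_congr rfl fun c _ => ?_
  rw [MvPolynomial.coeff_add, map_add]
  ring

theorem fischer_add_right {n : ℕ} (μ : Fin n → ℝ) (f g g' : MvPolynomial (Fin n) ℂ) :
    fischer μ f (g + g') = fischer μ f g + fischer μ f g' := by
  simp only [fischer, ← Finset.sum_add_distrib, MvPolynomial.coeff_add]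
  refine Finset.sum_congr rfl fun c _ => ?_
  ring

theorem fischer_monomial_left {n : ℕ} (μ : Fin n → ℝ) (c : Fin n →₀ ℕ) (a : ℂ)
    (g : MvPolynomial (Fin n) ℂ) :
    fischer μ (MvPolynomial.monomial c a) g = (starRingEnd ℂ) a * g.coeff c *
      ((∏ i, dunklFactorial (μ i) (c i) : ℝ) : ℂ) := by
  rw [fischer_eq_sum μ _ g {c} MvPolynomial.support_monomial_subset]
  simp

/-- Multiplication by `y_i` is adjoint to `T_i`. -/
theorem fischer_X_mul {n : ℕ} (μ : Fin n → ℝ) (i : Fin n) (f g : MvPolynomial (Fin n) ℂ) :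
    fischer μ (MvPolynomial.X i * f) g = fischer μ f (dunkl μ i g) := by
  induction f using MvPolynomial.induction_on' with
  | add f f' hf hf' => rw [mul_add, fischer_add_left, fischer_add_left, hf, hf']
  | monomial c a =>
    induction g using MvPolynomial.induction_on' with
    | add g g' hg hg' => rw [map_add, fischer_add_right, fischer_add_right, hg, hg']
    | monomial d b =>
      rw [MvPolynomial.X, MvPolynomial.monomial_mul, one_mul, fischer_monomial_left,
        fischer_monomial_left, dunkl_monomial, MvPolynomial.coeff_monomial,
        MvPolynomial.coeff_monomial]
      have hp : ∏ j, dunklFactorial (μ j) ((Finsupp.single i 1 + c : Fin n →₀ ℕ) j) =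
          ((c i + 1 : ℕ) + μ i * (1 - (-1) ^ (c i + 1))) * ∏ j, dunklFactorial (μ j) (c j) := by
        rw [← Finset.mul_prod_erase _ _ (Finset.mem_univ i),
          ← Finset.mul_prod_erase _ (fun j => dunklFactorial (μ j) (c j)) (Finset.mem_univ i),
          ← mul_assoc]
        congr 1
        · rw [Finsupp.add_apply, Finsupp.single_eq_same, add_comm 1, dunklFactorial,
            Finset.prod_Icc_succ_top (by omega), mul_comm]
          rfl
        · refine Finset.prod_congr rfl fun j hj => ?_
          rw [Finsupp.add_apply, Finsupp.single_eq_of_ne (Finset.ne_of_mem_erase hj), zero_add]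
      by_cases h : d = Finsupp.single i 1 + c
      · subst h
        rw [if_pos rfl, add_tsub_cancel_left, if_pos rfl, hp, Finsupp.add_apply,
          Finsupp.single_eq_same, add_comm 1 (c i)]
        push_cast
        ring
      · rw [if_neg h]
        by_cases h' : d - Finsupp.single i 1 = c
        · have hd : d i = 0 := by
            by_contra hd
            refine h ?_
            rw [← h', add_tsub_cancel_of_le]
            rw [Finsupp.single_le_iff]
            omega
          simp [hd]
        · rw [if_neg h']
          simp

end DunklRacah

end

/-!
Under `y ↦ s` with `s_i = y_i² / 2`, and after removal of the parity factor `y^ε`, the operators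
`T_i² / 2` become the Bessel operators `s_i ∂_i² + α_i ∂_i` with `α_i = 1/2 + μ_i + ε_i`, the
harmonics become the polynomials of degree `N` killed by the sum of all Bessel operators, and the
Fischer inner product becomes, up to the constant `parityNorm`, the bilinear form `form` in which
`s_i` is adjoint to its Bessel operator (`casimir_lift`, `fischer_lift`, `lift_mem_harmonics`).

In these variables a product of homogeneous Jacobi polynomials `jac` realizes the successive
coupling of `su(1,1)` representations: if `F` is harmonic in two disjoint groups of variables, then
`F * jac …` is harmonic in their union (`IsHarmonic.mul_jac`), and its square norm is that of `F`
times an explicit factor `jacNorm` (`IsHarmonic.form_mul_jac_self`). Multiplication by a polynomial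
in the sum of the variables in `A` and in variables outside `A` commutes with the Casimir operator
of `A`, so these products are joint eigenvectors: `leftVec` for the sets `[t]`, `rightVec` for the
sets `[2…t]`. Eigenvectors with different eigenvalues are orthogonal, and a harmonic polynomial is
determined by as many coefficients as there are quantum numbers, so both families are bases of the
harmonics (`exists_left_basis`, `exists_right_basis`). Their joint eigenvalues are distinct; hence
every basis of joint eigenvectors is labelled uniquely and agrees with the explicit one up to
nonzero scalars, which go into `u` and `v` (`existsUnique_labelling`,
`eq_smul_of_joint_eigenvector`).

It remains to compute `form (rightVec …) (leftVec …)`. For three variables the pairing of a vector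
of the scheme `(1 (2 3))` with a harmonic polynomial only depends on the former modulo multiples of
`s_1 + s_2 + s_3`, so it reduces to monomials in `s_1, s_2`; the resulting double sum becomes a
Racah polynomial by one Vandermonde convolution (`sum_sum_eq_racah`), which gives the recoupling
identity `coupleLeft_eq_sum`. This is an identity between polynomials in three variables, so
arbitrary elements may be substituted for them, in particular the sum of the variables in a group.
For general `n` one passes from `leftVec` to `rightVec` through the vectors `mixedVec`, in `p`
elementary steps that move the first variable to the right past one further variable. In the
pairing with `rightVec` a single term of each step survives, since the others are eigenvectors of a
Casimir operator for a different eigenvalue, and the product of the `p` univariate Racah polynomials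
is the multivariate one. Finally the remaining elementary factors are matched with the weights:
their squares differ from `ω_p(x) μ_p(k)` only by the square norms, by telescoping products of Gamma
functions (`coefficient_sq`).
-/

noncomputable section

namespace DunklRacah

open Finset MvPolynomial

/-! ### Pochhammer symbols -/

theorem poch_zero (a : ℝ) : poch a 0 = 1 := by simp [poch]

theorem poch_succ (a : ℝ) (n : ℕ) : poch a (n + 1) = poch a n * (a + n) := by
  simp [poch, prod_range_succ]

theorem poch_pos {a : ℝ} (ha : 0 < a) (n : ℕ) : 0 < poch a n :=
  prod_pos fun _ _ => by positivity

theorem poch_ne_zero {a : ℝ} (ha : 0 < a) (n : ℕ) : poch a n ≠ 0 := (poch_pos ha n).ne'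

theorem poch_reflect (a : ℝ) (n : ℕ) : poch a n = (-1) ^ n * poch (1 - a - n) n := by
  rw [poch, poch, ← prod_range_reflect, ← card_range n, ← prod_const, card_range,
    ← prod_mul_distrib]
  refine prod_congr rfl fun i hi => ?_
  have hi := mem_range.mp hi
  rw [Nat.cast_sub (by omega), Nat.cast_sub (by omega)]
  push_cast
  ring

theorem poch_neg_natCast (n i : ℕ) :
    poch (-n) i = (-1) ^ i * (n.choose i * i.factorial) := by
  induction i with
  | zero => simp [poch]
  | succ i ih =>
    rw [poch_succ, ih]
    have h : ((n.choose (i + 1) * (i + 1) : ℕ) : ℝ) = n.choose i * (n - i) := by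
      rw [Nat.choose_succ_right_eq]
      rcases le_or_gt i n with h | h
      · push_cast [Nat.cast_sub h]; ring
      · simp [Nat.choose_eq_zero_of_lt h]
    rw [Nat.factorial_succ]
    push_cast at h ⊢
    linear_combination (-1) ^ i * (i.factorial : ℝ) * h

theorem Gamma_add_natCast {a : ℝ} (ha : 0 < a) (n : ℕ) :
    Real.Gamma (a + n) = poch a n * Real.Gamma a := by
  induction n with
  | zero => simp [poch_zero]
  | succ n ih =>
    rw [poch_succ, Nat.cast_succ, ← add_assoc, Real.Gamma_add_one (by positivity), ih]
    ring

/-- The Vandermonde convolution for rising factorials. -/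
theorem poch_vandermonde (c A : ℝ) (m : ℕ) :
    ∑ t ∈ range (m + 1), (m.choose t : ℝ) * poch c t * poch A (m - t) = poch (A + c) m := by
  have key : ∀ m : ℕ, ∑ q ∈ antidiagonal m, (m.choose q.1 : ℝ) * (poch c q.1 * poch A q.2) =
      poch (A + c) m := by
    intro m
    induction m with
    | zero => simp [poch]
    | succ m ih =>
      rw [sum_antidiagonal_choose_succ_mul (fun i j => poch c i * poch A j), poch_succ, ← ih,
        sum_mul, ← sum_add_distrib]
      refine sum_congr rfl fun q hq => ?_
      have h : (q.1 : ℝ) + q.2 = m := by exact_mod_cast mem_antidiagonal.mp hq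
      rw [poch_succ, poch_succ, ← h, ← mem_antidiagonal.mp hq, Nat.choose_symm_add]
      ring
  rw [← key, Nat.sum_antidiagonal_eq_sum_range_succ
    (fun i j => (m.choose i : ℝ) * (poch c i * poch A j))]
  exact sum_congr rfl fun _ _ => by ring

theorem poch_alternating_vandermonde (c b : ℝ) (m : ℕ) :
    ∑ i ∈ range (m + 1), (-1) ^ i * (m.choose i : ℝ) * poch c i * poch (b + i) (m - i) =
      (-1) ^ m * poch (c + 1 - b - m) m := by
  rw [show c + 1 - b - m = (1 - b - m) + c by ring, ← poch_vandermonde, mul_sum]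
  refine sum_congr rfl fun i hi => ?_
  have hi : i ≤ m := Nat.lt_succ_iff.mp (mem_range.mp hi)
  rw [poch_reflect (b + i), Nat.cast_sub hi,
    show 1 - (b + i) - ((m : ℝ) - i) = 1 - b - m by ring]
  have : (-1 : ℝ) ^ m = (-1) ^ i * (-1) ^ (m - i) := by rw [← pow_add, Nat.add_sub_cancel' hi]
  rw [this]
  ring

/-! ### Two-variable harmonic polynomials -/

/-- The homogeneous polynomial of degree `j` in two commuting elements `u`, `v` that is annihilated
by `u ∂_u² + a ∂_u + v ∂_v² + b ∂_v`; it is a Jacobi polynomial in homogeneous form, normalized so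
that square norms come out as `jacNorm`. -/
def jac {R : Type*} [CommRing R] [Algebra ℝ R] (a b : ℝ) (j : ℕ) (u v : R) : R :=
  ∑ q ∈ antidiagonal j, ((-1) ^ q.1 /
    (q.1.factorial * poch a q.1 * (q.2.factorial * poch b q.2))) • (u ^ q.1 * v ^ q.2)

/-- The factor by which `jac a b j` multiplies square norms, see `IsHarmonic.form_mul_jac_self`. -/
def jacNorm (a b : ℝ) (j : ℕ) : ℝ :=
  poch (a + b + j - 1) j / (j.factorial * poch a j * poch b j)

theorem jacNorm_pos {a b : ℝ} (ha : 0 < a) (hb : 0 < b) (j : ℕ) : 0 < jacNorm a b j := by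
  have : 0 < poch (a + b + j - 1) j := by
    rcases j with _ | j
    · simp [poch_zero]
    · refine poch_pos ?_ _
      push_cast
      have : (0 : ℝ) ≤ j := by positivity
      linarith
  have := poch_pos ha j
  have := poch_pos hb j
  unfold jacNorm
  positivity

/-- The Chu–Vandermonde sum that evaluates the square norm of `jac`. -/
theorem sum_inv_eq_jacNorm {a b : ℝ} (ha : 0 < a) (hb : 0 < b) (j : ℕ) :
    ∑ q ∈ antidiagonal j, (1 / (q.1.factorial * poch a q.1 * (q.2.factorial * poch b q.2)) : ℝ) =
      jacNorm a b j := by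
  have h1 := poch_vandermonde (1 - b - j) (1 - a - j) j
  rw [poch_reflect, show 1 - (1 - a - j + (1 - b - j)) - (j : ℝ) = a + b + j - 1 by ring] at h1
  rw [jacNorm, eq_div_iff (mul_ne_zero (mul_ne_zero (by positivity) (poch_ne_zero ha _))
    (poch_ne_zero hb _))]
  have h2 : poch (a + b + j - 1) j = (-1) ^ j * ∑ t ∈ range (j + 1),
      (j.choose t : ℝ) * poch (1 - b - j) t * poch (1 - a - j) (j - t) := by
    rw [h1, ← mul_assoc, ← mul_pow]; simp
  rw [h2, sum_mul, mul_sum, ← Nat.sum_antidiagonal_eq_sum_range_succ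
    (fun i k => (-1 : ℝ) ^ j * ((j.choose i : ℝ) * poch (1 - b - j) i * poch (1 - a - j) k))]
  refine sum_congr rfl fun q hq => ?_
  have hq := mem_antidiagonal.mp hq
  have hj : (q.1 : ℝ) + q.2 = j := by exact_mod_cast hq
  have e1 : poch a j = poch a q.1 * ((-1) ^ q.2 * poch (1 - a - j) q.2) := by
    rw [← hq, poch_add, poch_reflect (a + q.1)]
    push_cast
    rw [show 1 - (a + (q.1 : ℝ)) - q.2 = 1 - a - (q.1 + q.2) by ring]
  have e2 : poch b j = poch b q.2 * ((-1) ^ q.1 * poch (1 - b - j) q.1) := by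
    rw [← hq, add_comm q.1, poch_add, poch_reflect (b + q.2)]
    push_cast
    rw [show 1 - (b + (q.2 : ℝ)) - q.1 = 1 - b - (q.2 + q.1) by ring]
  have e3 : (j.factorial : ℝ) = j.choose q.1 * q.1.factorial * q.2.factorial := by
    rw [← hq, ← Nat.add_choose_mul_factorial_mul_factorial q.1 q.2, Nat.choose_symm_add]; push_cast; ring
  rw [e1, e2, e3, ← hq, pow_add]
  have := poch_ne_zero ha q.1
  have := poch_ne_zero hb q.2
  field_simp

section jac

variable {R : Type*} [CommRing R] [Algebra ℝ R]

theorem map_jac {S : Type*} [CommRing S] [Algebra ℝ S] (f : R →ₐ[ℝ] S) (a b : ℝ) (j : ℕ)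
    (u v : R) : f (jac a b j u v) = jac a b j (f u) (f v) := by
  simp [jac, map_sum, map_smul]

@[simp] theorem jac_zero (a b : ℝ) (u v : R) : jac a b 0 u v = 1 := by
  simp [jac, poch_zero]

theorem jac_swap (a b : ℝ) (j : ℕ) (u v : R) :
    jac a b j u v = (-1 : ℝ) ^ j • jac b a j v u := by
  rw [jac, jac, smul_sum, ← Nat.sum_antidiagonal_swap]
  refine sum_congr rfl fun q hq => ?_
  rw [smul_smul, ← mem_antidiagonal.mp hq, Prod.fst_swap, Prod.snd_swap, mul_comm (u ^ _), pow_add]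
  congr 1
  have : (-1 : ℝ) ^ q.1 * (-1) ^ q.1 = 1 := by rw [← mul_pow]; simp
  rw [mul_div_assoc', mul_right_comm _ _ ((-1 : ℝ) ^ q.1), this, one_mul,
    mul_comm (_ * poch a q.2)]

/-- The coefficient of `u ^ (j - m) * v ^ m` in the expansion `jac_eq_sum_add`. -/
theorem sum_choose_div_poch {a b : ℝ} (hb : 0 < b) {j m : ℕ} (hm : m ≤ j) :
    ∑ i ∈ range (m + 1), (-1) ^ i * (j.choose i : ℝ) * poch (j + a + b - 1) i / poch b i *
      ((j - i).choose (m - i)) = (-1) ^ m * j.choose m * poch (a + (j - m : ℕ)) m / poch b m := by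
  have h := poch_alternating_vandermonde (j + a + b - 1) b m
  rw [show j + a + b - 1 + 1 - b - m = a + ((j : ℝ) - m) by ring, ← Nat.cast_sub hm] at h
  rw [mul_right_comm, mul_div_right_comm, ← h, sum_div, sum_mul]
  refine sum_congr rfl fun i hi => ?_
  have hi : i ≤ m := Nat.lt_succ_iff.mp (mem_range.mp hi)
  have e : (j.choose m : ℝ) * m.choose i = j.choose i * (j - i).choose (m - i) := by
    exact_mod_cast Nat.choose_mul hi
  have e2 : poch b m = poch b i * poch (b + i) (m - i) := by
    rw [← poch_add, Nat.add_sub_cancel' hi]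
  have n1 := poch_ne_zero hb i
  have n2 : poch (b + i) (m - i) ≠ 0 := poch_ne_zero (by positivity) _
  rw [e2]
  field_simp
  linear_combination (-poch (j + a + b - 1) i) * e

/-- Expansion of `jac` in powers of its second argument and of the sum of the arguments: the
hypergeometric form of Jacobi polynomials. -/
theorem jac_eq_sum_add {a b : ℝ} (ha : 0 < a) (hb : 0 < b) (j : ℕ) (u v : R) :
    jac a b j u v = ((-1) ^ j / (j.factorial * poch a j) : ℝ) • ∑ i ∈ range (j + 1),
      ((-1) ^ i * (j.choose i : ℝ) * poch (j + a + b - 1) i / poch b i) •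
        (v ^ i * (u + v) ^ (j - i)) := by
  have h1 : ∀ i ∈ range (j + 1), ((-1) ^ i * (j.choose i : ℝ) * poch (j + a + b - 1) i / poch b i) •
        (v ^ i * (u + v) ^ (j - i)) = ∑ m ∈ Ico i (j + 1),
        ((-1) ^ i * (j.choose i : ℝ) * poch (j + a + b - 1) i / poch b i *
          ((j - i).choose (m - i))) • (u ^ (j - m) * v ^ m) := by
    intro i hi
    have hi : i ≤ j := Nat.lt_succ_iff.mp (mem_range.mp hi)
    rw [sum_Ico_eq_sum_range, show j + 1 - i = j - i + 1 by omega, add_comm u, add_pow, mul_sum,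
      smul_sum]
    refine sum_congr rfl fun t _ => ?_
    rw [← smul_smul, Nat.add_sub_cancel_left, Nat.sub_add_eq, pow_add,
      Nat.cast_smul_eq_nsmul, nsmul_eq_mul]
    congr 1
    ring
  have h2 : ∑ i ∈ range (j + 1), ∑ m ∈ Ico i (j + 1),
        ((-1) ^ i * (j.choose i : ℝ) * poch (j + a + b - 1) i / poch b i *
          ((j - i).choose (m - i))) • (u ^ (j - m) * v ^ m) =
      ∑ m ∈ range (j + 1), ∑ i ∈ range (m + 1),
        ((-1) ^ i * (j.choose i : ℝ) * poch (j + a + b - 1) i / poch b i *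
          ((j - i).choose (m - i))) • (u ^ (j - m) * v ^ m) := by
    refine sum_comm' fun i m => ?_
    simp only [mem_range, mem_Ico]
    omega
  rw [sum_congr rfl h1, h2, jac, ← Nat.sum_antidiagonal_swap, Nat.sum_antidiagonal_eq_sum_range_succ_mk,
    smul_sum]
  refine sum_congr rfl fun m hm => ?_
  have hm : m ≤ j := Nat.lt_succ_iff.mp (mem_range.mp hm)
  rw [← sum_smul, smul_smul, sum_choose_div_poch hb hm, Prod.fst_swap, Prod.snd_swap]
  congr 1
  have e1 : poch a j = poch a (j - m) * poch (a + (j - m : ℕ)) m := by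
    rw [← poch_add, Nat.sub_add_cancel hm]
  have e2 : (j.factorial : ℝ) = j.choose m * m.factorial * (j - m).factorial := by
    exact_mod_cast (Nat.choose_mul_factorial_mul_factorial hm).symm
  have e3 : (-1 : ℝ) ^ j = (-1) ^ (j - m) * (-1) ^ m := by rw [← pow_add, Nat.sub_add_cancel hm]
  have e4 : (-1 : ℝ) ^ m * (-1) ^ m = 1 := by rw [← mul_pow]; simp
  have n1 := poch_ne_zero ha (j - m)
  have n2 : poch (a + (j - m : ℕ)) m ≠ 0 := poch_ne_zero (by positivity) _
  have n3 := poch_ne_zero hb m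
  have n4 : (j.choose m : ℝ) ≠ 0 := by exact_mod_cast (Nat.choose_pos hm).ne'
  rw [e1, e2, e3]
  field_simp
  linear_combination -e4

end jac

/-! ### The `su(1,1)` operators in the squared variables -/

section operators

variable {σ : Type*} (α : σ → ℝ) (A : Finset σ)

/-- The operator `X_i ∂_i² + α_i ∂_i`: this is `T_i² / 2` in the variable `X_i = y_i² / 2`. -/
def bessel (i : σ) : Module.End ℝ (MvPolynomial σ ℝ) :=
  LinearMap.mulLeft ℝ (X i) ∘ₗ (pderiv i).toLinearMap ∘ₗ (pderiv i).toLinearMap +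
    α i • (pderiv i).toLinearMap

/-- The Euler operator `X_i ∂_i`. -/
def euler (i : σ) : Module.End ℝ (MvPolynomial σ ℝ) :=
  LinearMap.mulLeft ℝ (X i) ∘ₗ (pderiv i).toLinearMap

/-- The lowering operator `∑_{i ∈ A} (X_i ∂_i² + α_i ∂_i)`. -/
def lowerOp : Module.End ℝ (MvPolynomial σ ℝ) := ∑ i ∈ A, bessel α i

/-- The Euler operator `∑_{i ∈ A} X_i ∂_i` of the variables in `A`. -/
def eulerOp : Module.End ℝ (MvPolynomial σ ℝ) := ∑ i ∈ A, euler i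

/-- The polynomial `∑_{i ∈ A} X_i`; multiplication by it is the raising operator. -/
def radius : MvPolynomial σ ℝ := ∑ i ∈ A, X i

/-- The operator `A₀ = ∑_{i ∈ A} (X_i ∂_i + α_i / 2)`. -/
def cartanOp : Module.End ℝ (MvPolynomial σ ℝ) := eulerOp A + ((∑ i ∈ A, α i) / 2) • 1

/-- The Casimir operator `A₀² - A₀ - J₊ J₋` of the variables in `A`. -/
def casimirOp : Module.End ℝ (MvPolynomial σ ℝ) :=
  cartanOp α A ^ 2 - cartanOp α A - LinearMap.mulLeft ℝ (radius A) * lowerOp α A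

variable {α A}

theorem bessel_apply (i : σ) (f : MvPolynomial σ ℝ) :
    bessel α i f = X i * pderiv i (pderiv i f) + α i • pderiv i f := rfl

theorem euler_apply (i : σ) (f : MvPolynomial σ ℝ) : euler i f = X i * pderiv i f := rfl

theorem lowerOp_apply (f : MvPolynomial σ ℝ) : lowerOp α A f = ∑ i ∈ A, bessel α i f := by
  simp [lowerOp]

theorem eulerOp_apply (f : MvPolynomial σ ℝ) : eulerOp A f = ∑ i ∈ A, euler i f := by
  simp [eulerOp]

theorem cartanOp_apply (f : MvPolynomial σ ℝ) :
    cartanOp α A f = eulerOp A f + ((∑ i ∈ A, α i) / 2) • f := rfl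

theorem casimirOp_apply (f : MvPolynomial σ ℝ) :
    casimirOp α A f = cartanOp α A (cartanOp α A f) - cartanOp α A f -
      radius A * lowerOp α A f := by
  simp [casimirOp, pow_two]

theorem jac_mem {S : Subalgebra ℝ (MvPolynomial σ ℝ)} (a b : ℝ) (j : ℕ) {u v : MvPolynomial σ ℝ}
    (hu : u ∈ S) (hv : v ∈ S) : jac a b j u v ∈ S :=
  S.sum_mem fun _ _ => S.smul_mem (S.mul_mem (S.pow_mem hu _) (S.pow_mem hv _)) _

variable (α A) in
/-- The polynomials `g` such that multiplication by `g` commutes with the Casimir operator of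
`A`. -/
def casimirCommutant : Subalgebra ℝ (MvPolynomial σ ℝ) where
  carrier := {g | ∀ f, casimirOp α A (g * f) = g * casimirOp α A f}
  mul_mem' {g h} hg hh f := by rw [mul_assoc, hg, hh, mul_assoc]
  add_mem' {g h} hg hh f := by rw [add_mul, map_add, hg, hh, add_mul]
  algebraMap_mem' r f := by
    rw [← Algebra.smul_def, map_smul, Algebra.smul_def]

variable (α A) in
/-- `f` is harmonic in the variables in `A`, and homogeneous of degree `d` in them. -/
structure IsHarmonic (d : ℝ) (f : MvPolynomial σ ℝ) : Prop where
  lower : lowerOp α A f = 0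
  euler : eulerOp A f = d • f

theorem isHarmonic_of_pderiv_eq_zero {f : MvPolynomial σ ℝ} (h : ∀ i ∈ A, pderiv i f = 0) :
    IsHarmonic α A 0 f where
  lower := by
    rw [lowerOp_apply]
    exact sum_eq_zero fun i hi => by simp [bessel_apply, h i hi]
  euler := by
    rw [eulerOp_apply, zero_smul]
    exact sum_eq_zero fun i hi => by simp [euler_apply, h i hi]

/-- Polynomials harmonic in the variables in `A` are eigenvectors of the Casimir operator of `A`, also
after multiplication by elements of its commutant. -/
theorem IsHarmonic.casimirOp_mul {d : ℝ} {f : MvPolynomial σ ℝ} (h : IsHarmonic α A d f) {g : MvPolynomial σ ℝ}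
    (hg : g ∈ casimirCommutant α A) :
    casimirOp α A (f * g) = kappa d (∑ i ∈ A, α i - 1) • (f * g) := by
  have h1 : cartanOp α A f = (d + (∑ i ∈ A, α i) / 2) • f := by
    rw [cartanOp_apply, h.euler, add_smul]
  rw [mul_comm f, hg f, casimirOp_apply, h.lower, h1, map_smul, h1, mul_zero, sub_zero, smul_smul,
    ← sub_smul, mul_smul_comm, kappa]
  congr 1
  ring

variable [DecidableEq σ]

theorem bessel_X_mul (i j : σ) (f : MvPolynomial σ ℝ) :
    bessel α i (X j * f) = X j * bessel α i f +
      if i = j then (2 : ℝ) • euler i f + α i • f else 0 := by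
  by_cases h : i = j
  · subst h
    simp only [bessel_apply, euler_apply, Derivation.leibniz, pderiv_X_self, smul_eq_mul,
      map_add, if_true, MvPolynomial.smul_eq_C_mul, map_ofNat, mul_one]
    ring
  · simp only [bessel_apply, Derivation.leibniz, pderiv_X_of_ne (Ne.symm h), smul_eq_mul,
      if_neg h, MvPolynomial.smul_eq_C_mul, mul_zero, add_zero]
    ring

theorem euler_X_mul (i j : σ) (f : MvPolynomial σ ℝ) :
    euler i (X j * f) = X j * euler i f + if i = j then X i * f else 0 := by
  by_cases h : i = j
  · subst h
    simp only [euler_apply, Derivation.leibniz, pderiv_X_self, smul_eq_mul, if_true, mul_one]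
    ring
  · simp only [euler_apply, Derivation.leibniz, pderiv_X_of_ne (Ne.symm h), smul_eq_mul,
      if_neg h, mul_zero, add_zero]
    ring

theorem lowerOp_X_mul (j : σ) (f : MvPolynomial σ ℝ) :
    lowerOp α A (X j * f) = X j * lowerOp α A f +
      if j ∈ A then (2 : ℝ) • euler j f + α j • f else 0 := by
  simp only [lowerOp_apply, bessel_X_mul, sum_add_distrib, mul_sum, sum_ite_eq']

theorem eulerOp_X_mul (j : σ) (f : MvPolynomial σ ℝ) :
    eulerOp A (X j * f) = X j * eulerOp A f + if j ∈ A then X j * f else 0 := by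
  simp only [eulerOp_apply, euler_X_mul, sum_add_distrib, mul_sum, sum_ite_eq']

theorem lowerOp_radius_mul (f : MvPolynomial σ ℝ) :
    lowerOp α A (radius A * f) = radius A * lowerOp α A f + (2 : ℝ) • eulerOp A f +
      (∑ i ∈ A, α i) • f := by
  simp only [radius, sum_mul, map_sum, lowerOp_X_mul, sum_add_distrib, eulerOp_apply, smul_sum,
    sum_smul, add_assoc]
  congr 1
  rw [← sum_add_distrib]
  exact sum_congr rfl fun i hi => if_pos hi

theorem eulerOp_radius_mul (f : MvPolynomial σ ℝ) :
    eulerOp A (radius A * f) = radius A * eulerOp A f + radius A * f := by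
  simp only [radius, sum_mul, map_sum, eulerOp_X_mul, sum_add_distrib]
  congr 1
  exact sum_congr rfl fun i hi => if_pos hi

theorem lowerOp_radius_mul_of_disjoint {B : Finset σ} (h : Disjoint A B) (f : MvPolynomial σ ℝ) :
    lowerOp α A (radius B * f) = radius B * lowerOp α A f := by
  simp only [radius, sum_mul, map_sum, lowerOp_X_mul]
  refine sum_congr rfl fun i hi => ?_
  rw [if_neg (disjoint_right.mp h hi), add_zero]

theorem eulerOp_radius_mul_of_disjoint {B : Finset σ} (h : Disjoint A B) (f : MvPolynomial σ ℝ) :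
    eulerOp A (radius B * f) = radius B * eulerOp A f := by
  simp only [radius, sum_mul, map_sum, eulerOp_X_mul]
  refine sum_congr rfl fun i hi => ?_
  rw [if_neg (disjoint_right.mp h hi), add_zero]

theorem cartanOp_X_mul {j : σ} (hj : j ∉ A) (f : MvPolynomial σ ℝ) :
    cartanOp α A (X j * f) = X j * cartanOp α A f := by
  rw [cartanOp_apply, cartanOp_apply, eulerOp_X_mul, if_neg hj, add_zero, mul_add, mul_smul_comm]

theorem cartanOp_radius_mul (f : MvPolynomial σ ℝ) :
    cartanOp α A (radius A * f) = radius A * (cartanOp α A f + f) := by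
  rw [cartanOp_apply, cartanOp_apply, eulerOp_radius_mul]
  simp only [MvPolynomial.smul_eq_C_mul]
  ring

theorem X_mem_casimirCommutant {j : σ} (hj : j ∉ A) : X j ∈ casimirCommutant α A := by
  intro f
  simp only [casimirOp_apply, cartanOp_X_mul hj, lowerOp_X_mul, if_neg hj, add_zero]
  ring

theorem radius_mem_casimirCommutant : radius A ∈ casimirCommutant α A := by
  intro f
  simp only [casimirOp_apply, cartanOp_radius_mul, lowerOp_radius_mul, map_add]
  have h : (2 : ℝ) • eulerOp A f + (∑ i ∈ A, α i) • f = (2 : ℝ) • cartanOp α A f := by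
    rw [cartanOp_apply, smul_add, smul_smul]
    congr 2
    ring
  rw [add_assoc (radius A * lowerOp α A f), h, MvPolynomial.smul_eq_C_mul, map_ofNat]
  ring

/-! ### Extension of harmonic polynomials by one more group of variables -/

variable {d e : ℝ} {f F : MvPolynomial σ ℝ}

theorem IsHarmonic.eulerOp_radius_pow_mul (h : IsHarmonic α A d f) (i : ℕ) :
    eulerOp A (radius A ^ i * f) = (d + i) • (radius A ^ i * f) := by
  induction i with
  | zero => simp [h.euler]
  | succ i ih =>
    rw [pow_succ', mul_assoc, eulerOp_radius_mul, ih]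
    simp only [MvPolynomial.smul_eq_C_mul, map_add, Nat.cast_succ, map_one]
    ring

theorem IsHarmonic.lowerOp_radius_pow_succ_mul (h : IsHarmonic α A d f) (i : ℕ) :
    lowerOp α A (radius A ^ (i + 1) * f) =
      ((i + 1) * (∑ i ∈ A, α i + 2 * d + i)) • (radius A ^ i * f) := by
  induction i with
  | zero =>
    rw [zero_add, pow_one, lowerOp_radius_mul, h.lower, h.euler]
    simp only [mul_zero, zero_add, smul_smul, ← add_smul]
    congr 1
    · push_cast; ring
    · simp
  | succ i ih =>
    rw [pow_succ', mul_assoc, lowerOp_radius_mul, ih, h.eulerOp_radius_pow_mul, mul_smul_comm,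
      ← mul_assoc, ← pow_succ', smul_smul, ← add_smul, ← add_smul]
    congr 1
    push_cast
    ring

theorem IsHarmonic.radius_pow_mul {B : Finset σ} (h : IsHarmonic α A d f) (hd : Disjoint A B)
    (m : ℕ) : IsHarmonic α A d (radius B ^ m * f) := by
  induction m with
  | zero => simpa using h
  | succ m ih =>
    rw [pow_succ', mul_assoc]
    exact ⟨by rw [lowerOp_radius_mul_of_disjoint hd, ih.lower, mul_zero],
      by rw [eulerOp_radius_mul_of_disjoint hd, ih.euler, mul_smul_comm]⟩

theorem lowerOp_union {B : Finset σ} (h : Disjoint A B) (f : MvPolynomial σ ℝ) :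
    lowerOp α (A ∪ B) f = lowerOp α A f + lowerOp α B f := by
  simp [lowerOp_apply, sum_union h]

theorem eulerOp_union {B : Finset σ} (h : Disjoint A B) (f : MvPolynomial σ ℝ) :
    eulerOp (A ∪ B) f = eulerOp A f + eulerOp B f := by
  simp [eulerOp_apply, sum_union h]

/-- Addition of angular momenta: a polynomial that is harmonic in two disjoint groups of variables
becomes harmonic in their union after multiplication by a suitable `jac`. -/
theorem IsHarmonic.mul_jac {B : Finset σ} (hA : IsHarmonic α A d F) (hB : IsHarmonic α B e F)
    (h : Disjoint A B) {a b : ℝ} (ha : a = ∑ i ∈ A, α i + 2 * d) (hb : b = ∑ i ∈ B, α i + 2 * e)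
    (ha0 : 0 < a) (hb0 : 0 < b) (j : ℕ) :
    IsHarmonic α (A ∪ B) (d + e + j) (F * jac a b j (radius A) (radius B)) := by
  have hexp : F * jac a b j (radius A) (radius B) = ∑ q ∈ antidiagonal j, ((-1) ^ q.1 /
      (q.1.factorial * poch a q.1 * (q.2.factorial * poch b q.2)) : ℝ) •
        (radius A ^ q.1 * (radius B ^ q.2 * F)) := by
    rw [jac, mul_sum]
    refine sum_congr rfl fun q _ => ?_
    rw [mul_smul_comm]
    congr 1
    ring
  have hcomm : ∀ q : ℕ × ℕ, radius A ^ q.1 * (radius B ^ q.2 * F) =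
      radius B ^ q.2 * (radius A ^ q.1 * F) := fun q => by ring
  constructor
  · rw [lowerOp_union h, hexp]
    simp only [map_sum, map_smul]
    rcases j with _ | j
    · simp [hA.lower, hB.lower]
    · rw [Nat.sum_antidiagonal_succ, Nat.sum_antidiagonal_succ']
      simp only [hcomm (0, _), hcomm (_, _ + 1)]
      have z1 : lowerOp α A (radius A ^ 0 * (radius B ^ (j + 1) * F)) = 0 := by
        rw [pow_zero, one_mul, (hA.radius_pow_mul h _).lower]
      have z2 : lowerOp α B (radius B ^ 0 * (radius A ^ (j + 1) * F)) = 0 := by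
        rw [pow_zero, one_mul, (hB.radius_pow_mul h.symm _).lower]
      simp only [hcomm (_, 0)]
      rw [← hcomm (0, j + 1), z1, z2, smul_zero, smul_zero, zero_add, zero_add, ← sum_add_distrib]
      refine sum_eq_zero fun q _ => ?_
      rw [(hA.radius_pow_mul h _).lowerOp_radius_pow_succ_mul,
        (hB.radius_pow_mul h.symm _).lowerOp_radius_pow_succ_mul, ← hcomm, smul_smul, smul_smul,
        ← add_smul, ← ha, ← hb, poch_succ, poch_succ, Nat.factorial_succ, Nat.factorial_succ]
      have n1 := poch_ne_zero ha0 q.1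
      have n2 := poch_ne_zero hb0 q.2
      have n3 : a + q.1 ≠ 0 := by positivity
      have n4 : b + q.2 ≠ 0 := by positivity
      convert zero_smul ℝ _
      push_cast
      field_simp
      ring
  · rw [eulerOp_union h, hexp]
    simp only [map_sum, map_smul]
    rw [← sum_add_distrib, smul_sum]
    refine sum_congr rfl fun q hq => ?_
    have hj : (q.1 : ℝ) + q.2 = j := by exact_mod_cast mem_antidiagonal.mp hq
    rw [(hA.radius_pow_mul h _).eulerOp_radius_pow_mul, hcomm,
      (hB.radius_pow_mul h.symm _).eulerOp_radius_pow_mul, ← smul_add, ← add_smul, ← hj,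
      smul_comm]
    congr 1
    ring

end operators

/-! ### The invariant bilinear form -/

section form

theorem coeff_bessel {σ : Type*} [DecidableEq σ] {α : σ → ℝ} (i : σ) (c : σ →₀ ℕ) (g : MvPolynomial σ ℝ) :
    coeff c (bessel α i g) = (c i + 1) * (α i + c i) * coeff (c + Finsupp.single i 1) g := by
  rw [bessel_apply, coeff_add, coeff_smul, coeff_X_mul', coeff_pderiv]
  by_cases h : i ∈ c.support
  · have h1 : Finsupp.single i 1 ≤ c := by
      rw [Finsupp.single_le_iff]
      exact Nat.one_le_iff_ne_zero.mpr (Finsupp.mem_support_iff.mp h)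
    obtain ⟨d, rfl⟩ := exists_add_of_le h1
    rw [if_pos h, add_tsub_cancel_left, coeff_pderiv, coeff_pderiv, add_comm (Finsupp.single i 1)]
    simp only [Finsupp.add_apply, Finsupp.single_eq_same, smul_eq_mul]
    push_cast
    ring
  · have h0 : c i = 0 := Finsupp.notMem_support_iff.mp h
    rw [if_neg h, h0, coeff_pderiv, h0, smul_eq_mul]
    push_cast
    ring

theorem coeff_euler {σ : Type*} [DecidableEq σ] (i : σ) (c : σ →₀ ℕ) (g : MvPolynomial σ ℝ) :
    coeff c (euler i g) = c i * coeff c g := by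
  rw [euler_apply, coeff_X_mul']
  by_cases h : i ∈ c.support
  · have h1 : Finsupp.single i 1 ≤ c := by
      rw [Finsupp.single_le_iff]
      exact Nat.one_le_iff_ne_zero.mpr (Finsupp.mem_support_iff.mp h)
    obtain ⟨d, rfl⟩ := exists_add_of_le h1
    rw [if_pos h, add_tsub_cancel_left, coeff_pderiv, add_comm (Finsupp.single i 1)]
    simp only [Finsupp.add_apply, Finsupp.single_eq_same]
    push_cast
    ring
  · rw [if_neg h, Finsupp.notMem_support_iff.mp h]
    simp

variable {σ : Type*} [Fintype σ] (α : σ → ℝ)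

/-- The square norm `∏_i c_i! (α_i)_{c_i}` of the monomial `X^c`. -/
def formWeight (c : σ →₀ ℕ) : ℝ := ∏ i, ((c i).factorial * poch (α i) (c i))

/-- The bilinear form for which monomials are orthogonal with square norm `formWeight`; it is the
Fischer form in the squared variables, and `X_i` is adjoint to `bessel α i`. -/
def form : MvPolynomial σ ℝ →ₗ[ℝ] MvPolynomial σ ℝ →ₗ[ℝ] ℝ :=
  (basisMonomials σ ℝ).constr ℝ fun c => formWeight α c • lcoeff ℝ c

variable {α}

theorem form_monomial (c : σ →₀ ℕ) (r : ℝ) (g : MvPolynomial σ ℝ) :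
    form α (monomial c r) g = r * (formWeight α c * coeff c g) := by
  have h : (monomial c r : MvPolynomial σ ℝ) = r • basisMonomials σ ℝ c := by
    rw [coe_basisMonomials, smul_monomial, smul_eq_mul, mul_one]
  rw [h, map_smul, form, Module.Basis.constr_basis]
  rfl

theorem form_comm (f g : MvPolynomial σ ℝ) : form α f g = form α g f := by
  induction f using MvPolynomial.induction_on' with
  | add f f' hf hf' => rw [map_add, LinearMap.add_apply, hf, hf', map_add]
  | monomial c r =>
    induction g using MvPolynomial.induction_on' with
    | add g g' hg hg' => rw [map_add, hg, hg', map_add, LinearMap.add_apply]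
    | monomial d s =>
      classical
      rw [form_monomial, form_monomial, coeff_monomial, coeff_monomial]
      by_cases h : d = c
      · subst h
        simp only [if_true]
        ring
      · rw [if_neg h, if_neg (Ne.symm h)]
        simp

theorem formWeight_single_add [DecidableEq σ] (i : σ) (c : σ →₀ ℕ) :
    formWeight α (c + Finsupp.single i 1) = formWeight α c * ((c i + 1) * (α i + c i)) := by
  rw [formWeight, formWeight, ← mul_prod_erase _ _ (mem_univ i),
    ← mul_prod_erase _ (fun j => ((c j).factorial * poch (α j) (c j) : ℝ)) (mem_univ i)]
  have h : ∀ j ∈ univ.erase i, (((c + Finsupp.single i 1 : σ →₀ ℕ) j).factorial *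
      poch (α j) ((c + Finsupp.single i 1 : σ →₀ ℕ) j) : ℝ) =
      (c j).factorial * poch (α j) (c j) := fun j hj => by
    rw [Finsupp.add_apply, Finsupp.single_eq_of_ne (ne_of_mem_erase hj), add_zero]
  rw [prod_congr rfl h, Finsupp.add_apply, Finsupp.single_eq_same, poch_succ, Nat.factorial_succ]
  push_cast
  ring

theorem form_X_mul [DecidableEq σ] (i : σ) (f g : MvPolynomial σ ℝ) :
    form α (X i * f) g = form α f (bessel α i g) := by
  induction f using MvPolynomial.induction_on' with
  | add f f' hf hf' =>
    rw [mul_add, map_add, map_add, LinearMap.add_apply, LinearMap.add_apply, hf, hf']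
  | monomial c r =>
    rw [X, monomial_mul, one_mul, form_monomial, form_monomial, add_comm, formWeight_single_add,
      coeff_bessel]
    ring

variable [DecidableEq σ]

theorem form_radius_mul (A : Finset σ) (f g : MvPolynomial σ ℝ) :
    form α (radius A * f) g = form α f (lowerOp α A g) := by
  rw [radius, sum_mul, map_sum, LinearMap.sum_apply, lowerOp_apply, map_sum]
  exact sum_congr rfl fun i _ => form_X_mul i f g

theorem form_euler (i : σ) (f g : MvPolynomial σ ℝ) :
    form α (euler i f) g = form α f (euler i g) := by
  induction f using MvPolynomial.induction_on' with
  | add f f' hf hf' =>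
    rw [map_add, map_add, map_add, LinearMap.add_apply, LinearMap.add_apply, hf, hf']
  | monomial c r =>
    have h : euler i (monomial c r) = monomial c (c i * r) := by
      ext d
      rw [coeff_euler, coeff_monomial, coeff_monomial]
      split_ifs with h <;> simp [h]
    rw [h, form_monomial, form_monomial, coeff_euler]
    ring

theorem form_cartanOp (A : Finset σ) (f g : MvPolynomial σ ℝ) :
    form α (cartanOp α A f) g = form α f (cartanOp α A g) := by
  simp only [cartanOp_apply, eulerOp_apply, map_add, map_sum, map_smul, LinearMap.add_apply,
    LinearMap.sum_apply, LinearMap.smul_apply, form_euler]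

theorem form_casimirOp (A : Finset σ) (f g : MvPolynomial σ ℝ) :
    form α (casimirOp α A f) g = form α f (casimirOp α A g) := by
  simp only [casimirOp_apply, map_sub, LinearMap.sub_apply, form_cartanOp, form_radius_mul]
  rw [form_comm f (radius A * _), form_radius_mul, form_comm (lowerOp α A g)]

/-- Eigenvectors of a Casimir operator for different eigenvalues are orthogonal. -/
theorem form_eq_zero_of_casimirOp {A : Finset σ} {f g : MvPolynomial σ ℝ} {s t : ℝ}
    (hf : casimirOp α A f = s • f) (hg : casimirOp α A g = t • g) (h : s ≠ t) :
    form α f g = 0 := by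
  have := form_casimirOp (α := α) A f g
  rw [hf, hg, map_smul, map_smul, LinearMap.smul_apply, smul_eq_mul, smul_eq_mul] at this
  have : (s - t) * form α f g = 0 := by linear_combination this
  exact (mul_eq_zero.mp this).resolve_left (sub_ne_zero.mpr h)

/-- If `G` is killed by the sum of two lowering operators, then in pairings with `G` the radius of
`B` may be replaced by minus the radius of `A`. -/
theorem form_radius_pow_mul_of_lowerOp {A B : Finset σ} {G : MvPolynomial σ ℝ}
    (hG : lowerOp α A G + lowerOp α B G = 0) (m : ℕ) (f : MvPolynomial σ ℝ) :
    form α (radius B ^ m * f) G = (-1) ^ m * form α (radius A ^ m * f) G := by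
  induction m generalizing f with
  | zero => simp
  | succ m ih =>
    have h3 : form α (radius B * (radius A ^ m * f)) G +
        form α (radius A * (radius A ^ m * f)) G = 0 := by
      rw [form_radius_mul, form_radius_mul, ← map_add, add_comm, hG, map_zero]
    rw [pow_succ, mul_assoc, ih, show radius A ^ m * (radius B * f) =
      radius B * (radius A ^ m * f) by ring, show radius A ^ (m + 1) * f =
      radius A * (radius A ^ m * f) by ring]
    linear_combination (-1) ^ m * h3

variable {A B : Finset σ} {d e : ℝ} {F : MvPolynomial σ ℝ}

theorem IsHarmonic.form_radius_pow_mul (h : IsHarmonic α A d F) (j : ℕ) :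
    form α (radius A ^ j * F) (radius A ^ j * F) =
      j.factorial * poch (∑ i ∈ A, α i + 2 * d) j * form α F F := by
  induction j with
  | zero => simp [poch_zero]
  | succ j ih =>
    conv_lhs => rw [pow_succ', mul_assoc, form_radius_mul, ← mul_assoc (radius A), ← pow_succ']
    rw [h.lowerOp_radius_pow_succ_mul, map_smul, ih, poch_succ, Nat.factorial_succ, smul_eq_mul]
    push_cast
    ring

/-- The square norm of a coupled vector. All terms of one factor `jac` are moved, modulo the raising
operator, to the top power of the radius of `A`, and only one term of the other factor pairs
nontrivially with that power. -/
theorem IsHarmonic.form_mul_jac_self (hA : IsHarmonic α A d F) (hB : IsHarmonic α B e F)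
    (h : Disjoint A B) {a b : ℝ} (ha : a = ∑ i ∈ A, α i + 2 * d) (hb : b = ∑ i ∈ B, α i + 2 * e)
    (ha0 : 0 < a) (hb0 : 0 < b) (j : ℕ) :
    form α (F * jac a b j (radius A) (radius B)) (F * jac a b j (radius A) (radius B)) =
      form α F F * jacNorm a b j := by
  set G := F * jac a b j (radius A) (radius B) with hG
  have hexp : G = ∑ q ∈ antidiagonal j, ((-1) ^ q.1 /
      (q.1.factorial * poch a q.1 * (q.2.factorial * poch b q.2)) : ℝ) •
        (radius B ^ q.2 * (radius A ^ q.1 * F)) := by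
    rw [hG, jac, mul_sum]
    refine sum_congr rfl fun q _ => ?_
    rw [mul_smul_comm]
    congr 1
    ring
  have hl : lowerOp α A G + lowerOp α B G = 0 := by
    rw [← lowerOp_union h]
    exact (hA.mul_jac hB h ha hb ha0 hb0 j).lower
  have hmove := form_radius_pow_mul_of_lowerOp hl
  have htop : form α (radius A ^ j * F) G = (-1) ^ j * form α F F := by
    rw [hexp, map_sum, sum_eq_single (j, 0)]
    · rw [pow_zero, one_mul, map_smul, hA.form_radius_pow_mul, ← ha, smul_eq_mul, poch_zero,
        Nat.factorial_zero]
      have := poch_ne_zero ha0 j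
      push_cast
      field_simp
    · rintro ⟨i, m⟩ hq hne
      have hq := mem_antidiagonal.mp hq
      obtain ⟨m, rfl⟩ : ∃ m', m = m' + 1 := by
        rcases m with _ | m
        · exact absurd (by simpa using hq) (by simpa using hne)
        · exact ⟨m, rfl⟩
      rw [map_smul, form_comm, pow_succ', mul_assoc (radius B), form_radius_mul,
        (hB.radius_pow_mul h.symm j).lower, map_zero, smul_zero]
    · intro hq
      simp at hq
  have hsum : ∀ H, form α G H = _ := fun H => by rw [hexp, map_sum, LinearMap.sum_apply]
  rw [hsum, ← sum_inv_eq_jacNorm ha0 hb0, mul_sum]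
  refine sum_congr rfl fun q hq => ?_
  rw [map_smul, LinearMap.smul_apply, hmove, ← mul_assoc (radius A ^ _), ← pow_add, add_comm q.2,
    mem_antidiagonal.mp hq, htop, smul_eq_mul, ← mem_antidiagonal.mp hq, pow_add]
  have e1 : (-1 : ℝ) ^ q.1 * (-1) ^ q.1 = 1 := by rw [← mul_pow]; simp
  have e2 : (-1 : ℝ) ^ q.2 * (-1) ^ q.2 = 1 := by rw [← mul_pow]; simp
  have n1 := poch_ne_zero ha0 q.1
  have n2 := poch_ne_zero hb0 q.2
  field_simp
  linear_combination form α F F * ((-1) ^ q.2 * (-1) ^ q.2 * e1 + e2)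

end form

/-! ### Recoupling of three variables -/

/-- The double sum arising from the expansions of both coupled vectors collapses to a Racah
polynomial, by one application of the Vandermonde convolution. -/
theorem sum_sum_eq_racah {b : ℝ} (a c : ℝ) (hb : 0 < b) {x k n : ℕ} (hx : x ≤ n)
    (hk : k ≤ n) :
    ∑ i ∈ range (k + 1), (k.choose i * poch (k + b + c - 1) i *
        (i.factorial * ((n - i).factorial * poch a (n - i))) : ℝ) *
        ∑ j ∈ range (x + 1), (-1) ^ j * (x.choose j : ℝ) * poch (x + a + b - 1) j / poch b j *
          ((n - j).choose (n - i)) =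
      (-1) ^ k * (poch a (n - k) * (n - k).factorial) / poch b k *
        racah k (b - 1) (c - 1) (-n - 1) (a + b - 1 + n) x := by
  have hx0 : ∀ i, ∑ j ∈ range (x + 1), (-1) ^ j * (x.choose j : ℝ) * poch (x + a + b - 1) j /
      poch b j * ((n - j).choose (n - i)) = ∑ j ∈ range (n + 1), (-1) ^ j * (x.choose j : ℝ) *
      poch (x + a + b - 1) j / poch b j * ((n - j).choose (n - i)) := fun i => by
    refine sum_subset (range_mono (by omega)) fun j _ hj => ?_
    rw [Nat.choose_eq_zero_of_lt (by simpa using hj)]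
    simp
  simp only [hx0, mul_sum]
  rw [sum_comm]
  have hin : ∀ j ∈ range (n + 1), j ∉ range (k + 1) → ∑ i ∈ range (k + 1),
      (k.choose i * poch (k + b + c - 1) i *
        (i.factorial * ((n - i).factorial * poch a (n - i))) : ℝ) *
        ((-1) ^ j * (x.choose j : ℝ) * poch (x + a + b - 1) j / poch b j *
          ((n - j).choose (n - i))) = 0 := fun j hj hj' => by
    refine sum_eq_zero fun i hi => ?_
    simp only [mem_range] at hi hj hj'
    rw [Nat.choose_eq_zero_of_lt (show n - j < n - i by omega)]
    simp
  rw [← sum_subset (range_mono (by omega)) hin, racah, mul_sum]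
  refine sum_congr rfl fun j hj => ?_
  have hj : j ≤ k := Nat.lt_succ_iff.mp (mem_range.mp hj)
  -- the sum over `i` is a Vandermonde convolution in `i - j`
  have inner : ∑ i ∈ range (k + 1), (k.choose i * poch (k + b + c - 1) i *
        (i.factorial * ((n - i).factorial * poch a (n - i))) : ℝ) * ((n - j).choose (n - i)) =
      (n - j).factorial * (k.choose j * j.factorial) * poch (k + b + c - 1) j * poch a (n - k) *
        poch (a + b + c - 1 + n + j) (k - j) := by
    have v := poch_vandermonde (k + b + c - 1 + j) (a + (n - k : ℕ)) (k - j)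
    rw [Nat.cast_sub hk, show a + ((n : ℝ) - k) + (k + b + c - 1 + j) = a + b + c - 1 + n + j by
      ring] at v
    rw [← v, mul_sum, show k + 1 = j + (k - j + 1) by omega, sum_range_add]
    rw [sum_eq_zero (s := range j), zero_add]
    · refine sum_congr rfl fun t ht => ?_
      have ht : t ≤ k - j := Nat.lt_succ_iff.mp (mem_range.mp ht)
      have e1 : poch a (n - (j + t)) = poch a (n - k) * poch (a + ((n : ℝ) - k)) (k - j - t) := by
        rw [show n - (j + t) = (n - k) + (k - j - t) by omega, poch_add, Nat.cast_sub hk]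
      have e2 : (((n - j).choose (n - (j + t)) * (n - (j + t)).factorial * t.factorial : ℕ) : ℝ) =
          (n - j).factorial := by
        have := Nat.choose_mul_factorial_mul_factorial (show n - (j + t) ≤ n - j by omega)
        rw [show n - j - (n - (j + t)) = t by omega] at this
        exact_mod_cast this
      have e3 : ((k.choose (j + t) * (j + t).factorial : ℕ) : ℝ) =
          k.choose j * j.factorial * ((k - j).choose t * t.factorial) := by
        have : k.choose (j + t) * (j + t).factorial =
            k.choose j * j.factorial * ((k - j).choose t * t.factorial) := by
          have h1 := Nat.descFactorial_eq_factorial_mul_choose k (j + t)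
          have h2 := Nat.descFactorial_eq_factorial_mul_choose k j
          have h3 := Nat.descFactorial_eq_factorial_mul_choose (k - j) t
          rw [mul_comm, ← h1, mul_comm (k.choose j), ← h2, mul_comm ((k - j).choose t), ← h3,
            mul_comm, ← Nat.descFactorial_mul_descFactorial (Nat.le_add_right j t),
            Nat.add_sub_cancel_left]
        exact_mod_cast this
      push_cast at e2 e3
      rw [poch_add, e1]
      linear_combination (poch (k + b + c - 1) j * poch (k + b + c - 1 + j) t * poch a (n - k) *
        poch (a + ((n : ℝ) - k)) (k - j - t) * ((n - j).choose (n - (j + t))) *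
          (n - (j + t)).factorial) * e3 + (poch (k + b + c - 1) j * poch (k + b + c - 1 + j) t *
          poch a (n - k) * poch (a + ((n : ℝ) - k)) (k - j - t) * k.choose j * j.factorial *
          (k - j).choose t) * e2
    · intro i hi
      have hi := mem_range.mp hi
      rw [Nat.choose_eq_zero_of_lt (show n - j < n - i by omega)]
      simp
  have e4 : ∑ i ∈ range (k + 1), (k.choose i * poch (k + b + c - 1) i *
        (i.factorial * ((n - i).factorial * poch a (n - i))) : ℝ) *
        ((-1) ^ j * (x.choose j : ℝ) * poch (x + a + b - 1) j / poch b j *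
          ((n - j).choose (n - i))) = (-1) ^ j * (x.choose j : ℝ) * poch (x + a + b - 1) j /
          poch b j * ((n - j).factorial * (k.choose j * j.factorial) * poch (k + b + c - 1) j *
          poch a (n - k) * poch (a + b + c - 1 + n + j) (k - j)) := by
    rw [← inner, mul_sum]
    exact sum_congr rfl fun i _ => by ring
  have e5 : poch (-(n : ℝ) - 1 + 1 + j) (k - j) * (n - k).factorial =
      (-1) ^ (k - j) * (n - j).factorial := by
    have h := poch_neg_natCast (n - j) (k - j)
    rw [Nat.cast_sub (by omega)] at h
    rw [show -(n : ℝ) - 1 + 1 + j = -((n : ℝ) - j) by ring, h]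
    have := Nat.choose_mul_factorial_mul_factorial (show k - j ≤ n - j by omega)
    rw [show n - j - (k - j) = n - k by omega] at this
    have : ((n - j).choose (k - j) * (k - j).factorial * (n - k).factorial : ℝ) =
      (n - j).factorial := by exact_mod_cast this
    linear_combination (-1) ^ (k - j) * this
  have e6 : poch b k = poch b j * poch (b + j) (k - j) := by
    rw [← poch_add, Nat.add_sub_cancel' hj]
  have e7 : (-1 : ℝ) ^ k = (-1) ^ j * (-1) ^ (k - j) := by rw [← pow_add, Nat.add_sub_cancel' hj]
  have e8 : (-1 : ℝ) ^ (k - j) * (-1) ^ (k - j) = 1 := by rw [← mul_pow]; simp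
  have e9 : (-1 : ℝ) ^ j * (-1) ^ j = 1 := by rw [← mul_pow]; simp
  have n1 := poch_ne_zero hb j
  have n2 : poch (b + j) (k - j) ≠ 0 := poch_ne_zero (by positivity) _
  rw [e4, poch_neg_natCast, poch_neg_natCast,
    show (k : ℝ) + (b - 1) + (c - 1) + 1 = k + b + c - 1 by ring,
    show (x : ℝ) + (-n - 1) + (a + b - 1 + n) + 1 = x + a + b - 1 by ring,
    show b - 1 + 1 + (j : ℝ) = b + j by ring,
    show c - 1 + (a + b - 1 + n) + 1 + (j : ℝ) = a + b + c - 1 + n + j by ring, e6, e7]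
  field_simp
  linear_combination (-(k.choose j * poch (k + b + c - 1) j * x.choose j * poch (x + a + b - 1) j *
    poch a (n - k) * poch (a + b + c - 1 + n + j) (k - j) : ℝ)) *
    ((-1) ^ j * (-1) ^ j * (-1) ^ (k - j) * e5 + (-1) ^ j * (-1) ^ j * (n - j).factorial * e8 +
      (n - j).factorial * e9)

/-- The polynomials killed by `∂_i`. -/
def pderivKer {σ : Type*} (i : σ) : Subalgebra ℝ (MvPolynomial σ ℝ) where
  carrier := {f | pderiv i f = 0}
  mul_mem' {f g} (hf : pderiv i f = 0) (hg : pderiv i g = 0) := by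
    change pderiv i (f * g) = 0
    rw [Derivation.leibniz, hf, hg, smul_zero, smul_zero, add_zero]
  add_mem' {f g} (hf : pderiv i f = 0) (hg : pderiv i g = 0) := by
    change pderiv i (f + g) = 0
    rw [map_add, hf, hg, add_zero]
  algebraMap_mem' r := by simp [algebraMap_eq]

theorem X_mem_pderivKer {σ : Type*} {i j : σ} (h : j ≠ i) : X j ∈ pderivKer i :=
  pderiv_X_of_ne h

section couple

variable {R : Type*} [CommRing R] [Algebra ℝ R]

/-- The vector of the coupling scheme `((1 2) 3)` with intermediate degree `x` and total degree
`x + d`. -/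
def coupleLeft (a b c : ℝ) (x d : ℕ) (u v w : R) : R :=
  jac a b x u v * jac (a + b + 2 * x) c d (u + v) w

/-- The vector of the coupling scheme `(1 (2 3))` with intermediate degree `k` and total degree
`k + e`. -/
def coupleRight (a b c : ℝ) (k e : ℕ) (u v w : R) : R :=
  jac b c k v w * jac a (b + c + 2 * k) e u (v + w)

end couple

section three

variable {a b c : ℝ}

theorem radius_pair {σ : Type*} [DecidableEq σ] {i j : σ} (h : i ≠ j) :
    (radius ({i} ∪ {j}) : MvPolynomial σ ℝ) = X i + X j := by
  rw [radius, sum_union (by simpa using h)]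
  simp

theorem isHarmonic_jac_pair {σ : Type*} [DecidableEq σ] {α : σ → ℝ} {i j : σ} (h : i ≠ j)
    (hi : 0 < α i) (hj : 0 < α j) (x : ℕ) :
    IsHarmonic α ({i} ∪ {j}) x (jac (α i) (α j) x (X i) (X j)) := by
  have := (isHarmonic_of_pderiv_eq_zero (α := α) (A := {i}) (f := 1) (by simp)).mul_jac
    (isHarmonic_of_pderiv_eq_zero (α := α) (A := {j}) (f := 1) (by simp)) (by simpa using h)
    (a := α i) (b := α j) (by simp) (by simp) hi hj x
  simpa [radius] using this

theorem isHarmonic_coupleLeft (ha : 0 < a) (hb : 0 < b) (hc : 0 < c) (x d : ℕ) :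
    IsHarmonic ![a, b, c] univ (x + d : ℕ) (coupleLeft a b c x d (X 0) (X 1) (X 2)) := by
  have h1 : IsHarmonic ![a, b, c] ({0} ∪ {1}) x (jac a b x (X 0) (X 1)) :=
    isHarmonic_jac_pair (α := ![a, b, c]) (i := 0) (j := 1) (by decide) ha hb x
  have h2 : IsHarmonic ![a, b, c] {2} 0 (jac a b x (X 0) (X 1)) := by
    refine isHarmonic_of_pderiv_eq_zero fun i hi => ?_
    rw [mem_singleton] at hi
    subst hi
    exact jac_mem (S := pderivKer 2) _ _ _ (X_mem_pderivKer (by decide))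
      (X_mem_pderivKer (by decide))
  have h3 := h1.mul_jac h2 (by decide) (a := a + b + 2 * x) (b := c)
    (by rw [sum_union (by decide)]; simp) (by simp) (by positivity) hc d
  have hu : ({0} ∪ {1} ∪ {2} : Finset (Fin 3)) = univ := by decide
  rw [radius_pair (by decide), hu] at h3
  simpa [radius, coupleLeft] using h3

theorem isHarmonic_jac_right (hb : 0 < b) (hc : 0 < c) (k : ℕ) :
    IsHarmonic ![a, b, c] ({1} ∪ {2}) k (jac b c k (X 1) (X 2)) :=
  isHarmonic_jac_pair (α := ![a, b, c]) (i := 1) (j := 2) (by decide) hb hc k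

theorem isHarmonic_jac_right_zero (k : ℕ) :
    IsHarmonic ![a, b, c] {0} 0 (jac b c k (X 1) (X 2)) := by
  refine isHarmonic_of_pderiv_eq_zero fun i hi => ?_
  rw [mem_singleton] at hi
  subst hi
  exact jac_mem (S := pderivKer 0) _ _ _ (X_mem_pderivKer (by decide)) (X_mem_pderivKer (by decide))

theorem isHarmonic_coupleRight (ha : 0 < a) (hb : 0 < b) (hc : 0 < c) (k e : ℕ) :
    IsHarmonic ![a, b, c] univ (k + e : ℕ) (coupleRight a b c k e (X 0) (X 1) (X 2)) := by
  have h3 := (isHarmonic_jac_right_zero (a := a) k).mul_jac (isHarmonic_jac_right hb hc k)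
    (by decide) (a := a) (b := b + c + 2 * k) (by simp)
    (by rw [sum_union (by decide)]; simp) ha (by positivity) e
  have hu : ({0} ∪ ({1} ∪ {2}) : Finset (Fin 3)) = univ := by decide
  rw [radius_pair (by decide), hu] at h3
  simpa [radius, coupleRight] using h3

theorem form_one {σ : Type*} [Fintype σ] (α : σ → ℝ) : form α 1 1 = 1 := by
  have : (1 : MvPolynomial σ ℝ) = monomial 0 1 := rfl
  rw [this, form_monomial]
  simp [formWeight, poch_zero]

theorem form_jac_pair {σ : Type*} [Fintype σ] [DecidableEq σ] {α : σ → ℝ} {i j : σ} (h : i ≠ j)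
    (hi : 0 < α i) (hj : 0 < α j) (x : ℕ) :
    form α (jac (α i) (α j) x (X i) (X j)) (jac (α i) (α j) x (X i) (X j)) =
      jacNorm (α i) (α j) x := by
  have := (isHarmonic_of_pderiv_eq_zero (α := α) (A := {i}) (f := 1) (by simp)).form_mul_jac_self
    (isHarmonic_of_pderiv_eq_zero (α := α) (A := {j}) (f := 1) (by simp)) (by simpa using h)
    (a := α i) (b := α j) (by simp) (by simp) hi hj x
  simpa [radius, form_one] using this

theorem form_coupleRight_self (ha : 0 < a) (hb : 0 < b) (hc : 0 < c) (k e : ℕ) :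
    form ![a, b, c] (coupleRight a b c k e (X 0) (X 1) (X 2))
      (coupleRight a b c k e (X 0) (X 1) (X 2)) = jacNorm b c k * jacNorm a (b + c + 2 * k) e := by
  have h3 := (isHarmonic_jac_right_zero (a := a) k).form_mul_jac_self (isHarmonic_jac_right hb hc k)
    (by decide) (a := a) (b := b + c + 2 * k) (by simp)
    (by rw [sum_union (by decide)]; simp) ha (by positivity) e
  have h1 : form ![a, b, c] (jac b c k (X 1) (X 2)) (jac b c k (X 1) (X 2)) = jacNorm b c k :=
    form_jac_pair (α := ![a, b, c]) (i := 1) (j := 2) (by decide) hb hc k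
  rw [radius_pair (by decide), h1] at h3
  simpa [radius, coupleRight] using h3

theorem kappa_injective_of_pos {β : ℝ} (hβ : 0 < β) {x y : ℕ} (h : kappa x β = kappa y β) :
    x = y := by
  have h' : ((x : ℝ) - y) * (x + y + β) = 0 := by
    rw [kappa, kappa] at h
    linear_combination h
  have : (x : ℝ) + y + β ≠ 0 := by positivity
  exact_mod_cast sub_eq_zero.mp ((mul_eq_zero.mp h').resolve_right this)

theorem form_coupleRight_of_ne (hb : 0 < b) (hc : 0 < c) (hbc : 1 < b + c) {k k' : ℕ}
    (h : k ≠ k') (e e' : ℕ) :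
    form ![a, b, c] (coupleRight a b c k e (X 0) (X 1) (X 2))
      (coupleRight a b c k' e' (X 0) (X 1) (X 2)) = 0 := by
  have hmem : ∀ (s t : ℝ) (j : ℕ), jac s t j (X 0) (X 1 + X 2) ∈
      casimirCommutant ![a, b, c] ({1} ∪ {2}) := fun s t j => by
    rw [← radius_pair (by decide)]
    exact jac_mem _ _ _ (X_mem_casimirCommutant (by decide)) radius_mem_casimirCommutant
  refine form_eq_zero_of_casimirOp ((isHarmonic_jac_right hb hc k).casimirOp_mul (hmem _ _ _))
    ((isHarmonic_jac_right hb hc k').casimirOp_mul (hmem _ _ _)) fun hk => h ?_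
  refine kappa_injective_of_pos ?_ hk
  rw [sum_union (by decide)]
  simpa using hbc

/-- Reduction of a vector of the scheme `(1 (2 3))`, modulo the image of the raising operator, to
monomials in the first two variables. -/
theorem form_coupleRight (hb : 0 < b) (hc : 0 < c) (ha : 0 < a) (k e : ℕ)
    {g : MvPolynomial (Fin 3) ℝ} (hg : lowerOp ![a, b, c] univ g = 0) :
    form ![a, b, c] (coupleRight a b c k e (X 0) (X 1) (X 2)) g =
      (-1) ^ (k + e) * jacNorm a (b + c + 2 * k) e / (k.factorial * poch c k) *
        ∑ i ∈ range (k + 1), (k.choose i * poch (k + b + c - 1) i / poch b i) *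
          form ![a, b, c] (X 1 ^ i * X 0 ^ (k + e - i)) g := by
  have hl : lowerOp ![a, b, c] {0} g + lowerOp ![a, b, c] ({1} ∪ {2}) g = 0 := by
    rw [← lowerOp_union (by decide)]
    exact hg
  have hmove : ∀ (m : ℕ) (f : MvPolynomial (Fin 3) ℝ), form ![a, b, c] ((X 1 + X 2) ^ m * f) g =
      (-1) ^ m * form ![a, b, c] (X 0 ^ m * f) g := fun m f => by
    have := form_radius_pow_mul_of_lowerOp hl m f
    rw [radius_pair (by decide)] at this
    simpa [radius] using this
  have hjac : ∀ f : MvPolynomial (Fin 3) ℝ,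
      form ![a, b, c] (f * jac a (b + c + 2 * k) e (X 0) (X 1 + X 2)) g =
        (-1) ^ e * jacNorm a (b + c + 2 * k) e * form ![a, b, c] (f * X 0 ^ e) g := fun f => by
    rw [jac, mul_sum, map_sum, LinearMap.sum_apply, ← sum_inv_eq_jacNorm ha (by positivity),
      mul_sum, sum_mul]
    refine sum_congr rfl fun q hq => ?_
    have hq := mem_antidiagonal.mp hq
    rw [mul_smul_comm, map_smul, LinearMap.smul_apply, smul_eq_mul,
      show f * (X 0 ^ q.1 * (X 1 + X 2) ^ q.2) = (X 1 + X 2) ^ q.2 * (f * X 0 ^ q.1) by ring, hmove,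
      show X 0 ^ q.2 * (f * X 0 ^ q.1) = f * X 0 ^ e by rw [← hq]; ring, ← hq, pow_add]
    ring
  rw [coupleRight, hjac, jac_swap, jac_eq_sum_add hc hb, smul_mul_assoc, smul_mul_assoc, sum_mul,
    map_smul, map_smul, LinearMap.smul_apply, LinearMap.smul_apply, map_sum, LinearMap.sum_apply,
    smul_eq_mul, smul_eq_mul, mul_sum, mul_sum, mul_sum, mul_sum]
  refine sum_congr rfl fun i hi => ?_
  have hi : i ≤ k := Nat.lt_succ_iff.mp (mem_range.mp hi)
  rw [smul_mul_assoc, map_smul, LinearMap.smul_apply, smul_eq_mul, add_comm (X 2),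
    show (X 1 ^ i * (X 1 + X 2) ^ (k - i) * X 0 ^ e : MvPolynomial (Fin 3) ℝ) =
      (X 1 + X 2) ^ (k - i) * (X 1 ^ i * X 0 ^ e) by ring, hmove,
    show (X 0 ^ (k - i) * (X 1 ^ i * X 0 ^ e) : MvPolynomial (Fin 3) ℝ) =
      X 1 ^ i * X 0 ^ (k + e - i) by
      rw [show k + e - i = k - i + e by omega]; ring,
    show (k : ℝ) + c + b - 1 = k + b + c - 1 by ring, pow_add]
  have e1 : (-1 : ℝ) ^ k = (-1) ^ i * (-1) ^ (k - i) := by rw [← pow_add, Nat.add_sub_cancel' hi]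
  have e2 : (-1 : ℝ) ^ i * (-1) ^ i = 1 := by rw [← mul_pow]; simp
  have e3 : (-1 : ℝ) ^ (k - i) * (-1) ^ (k - i) = 1 := by rw [← mul_pow]; simp
  have n1 := poch_ne_zero hc k
  have n2 := poch_ne_zero hb i
  rw [e1]
  field_simp
  linear_combination (form ![a, b, c]) (X 1 ^ i * X 0 ^ (k + e - i)) g * jacNorm a (b + c + 2 * k) e *
    (k.choose i * poch (k + b + c - 1) i) * (e2 + (-1) ^ i * (-1) ^ i * e3)

theorem form_X_pow_mul_X_pow (i m i' m' : ℕ) (h : i + m = i' + m') :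
    form ![a, b, c] (X 1 ^ i * X 0 ^ m) (X 1 ^ i' * X 0 ^ m') =
      if m' = m then i.factorial * poch b i * (m.factorial * poch a m) else 0 := by
  have hm : ∀ i m : ℕ, (X 1 ^ i * X 0 ^ m : MvPolynomial (Fin 3) ℝ) =
      monomial (Finsupp.single 1 i + Finsupp.single 0 m) 1 := fun i m => by
    rw [X_pow_eq_monomial, X_pow_eq_monomial, monomial_mul, one_mul]
  rw [hm, hm, form_monomial, coeff_monomial, one_mul]
  split_ifs with h1 h2 h2
  · simp [formWeight, Fin.prod_univ_three, poch_zero, mul_comm]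
  · exact absurd (by simpa using DFunLike.congr_fun h1 0) h2
  · exact absurd (by rw [h2, show i = i' by omega]) h1
  · simp

theorem form_X_pow_mul_add_pow (i m j l : ℕ) (h : i + m = j + l) :
    form ![a, b, c] (X 1 ^ i * X 0 ^ m) (X 1 ^ j * (X 0 + X 1) ^ l) =
      i.factorial * poch b i * (m.factorial * poch a m) * l.choose m := by
  have h1 : ∀ t ∈ range (l + 1), form ![a, b, c] (X 1 ^ i * X 0 ^ m)
      (X 1 ^ j * (X 0 ^ t * X 1 ^ (l - t) * (l.choose t : MvPolynomial (Fin 3) ℝ))) =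
      if t = m then i.factorial * poch b i * (m.factorial * poch a m) * l.choose m else 0 := by
    intro t ht
    have ht : t ≤ l := Nat.lt_succ_iff.mp (mem_range.mp ht)
    rw [show (X 1 ^ j * (X 0 ^ t * X 1 ^ (l - t) * (l.choose t : MvPolynomial (Fin 3) ℝ))) =
      (l.choose t : ℝ) • (X 1 ^ (j + (l - t)) * X 0 ^ t) by
        rw [MvPolynomial.smul_eq_C_mul, map_natCast]; ring,
      map_smul, form_X_pow_mul_X_pow _ _ _ _ (by omega)]
    split_ifs with h2
    · rw [h2, smul_eq_mul, mul_comm]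
    · simp
  rw [add_pow, mul_sum, map_sum, sum_congr rfl h1, sum_ite_eq']
  split_ifs with h2
  · rfl
  · rw [Nat.choose_eq_zero_of_lt (by simpa using h2)]
    simp

/-- Only the part of `coupleLeft` that does not involve the third variable contributes. -/
theorem form_X_pow_mul_coupleLeft (ha : 0 < a) (hb : 0 < b) (x d i m : ℕ) (h : i + m = x + d) :
    form ![a, b, c] (X 1 ^ i * X 0 ^ m) (coupleLeft a b c x d (X 0) (X 1) (X 2)) =
      (-1) ^ (x + d) / (x.factorial * poch a x * (d.factorial * poch (a + b + 2 * x) d)) *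
        (i.factorial * poch b i * (m.factorial * poch a m)) *
        ∑ j ∈ range (x + 1), (-1) ^ j * (x.choose j : ℝ) * poch (x + a + b - 1) j / poch b j *
          ((x + d - j).choose m) := by
  have h0 : ∀ f : MvPolynomial (Fin 3) ℝ, form ![a, b, c] (X 1 ^ i * X 0 ^ m) (X 2 * f) = 0 := by
    intro f
    have hp : (X 1 ^ i * X 0 ^ m : MvPolynomial (Fin 3) ℝ) ∈ pderivKer 2 :=
      mul_mem (pow_mem (X_mem_pderivKer (by decide)) _) (pow_mem (X_mem_pderivKer (by decide)) _)
    have hp : pderiv 2 (X 1 ^ i * X 0 ^ m : MvPolynomial (Fin 3) ℝ) = 0 := hp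
    rw [form_comm, form_X_mul, bessel_apply, hp]
    simp
  rw [coupleLeft, jac.eq_1 (a + b + 2 * x), mul_sum, map_sum, sum_eq_single (d, 0)]
  · rw [jac_eq_sum_add ha hb, pow_zero, mul_one, smul_mul_assoc, mul_smul_comm, sum_mul, map_smul,
      map_smul, map_sum, smul_eq_mul, smul_eq_mul, mul_sum, mul_sum, mul_sum, poch_zero]
    refine sum_congr rfl fun j hj => ?_
    have hj : j ≤ x := Nat.lt_succ_iff.mp (mem_range.mp hj)
    rw [smul_mul_assoc, mul_assoc (X 1 ^ j), ← pow_add, map_smul,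
      form_X_pow_mul_add_pow _ _ _ _ (by omega), show x - j + d = x + d - j by omega, smul_eq_mul,
      pow_add]
    have := poch_ne_zero ha x
    have := poch_ne_zero hb j
    have : poch (a + b + 2 * x) d ≠ 0 := poch_ne_zero (by positivity) _
    simp only [Nat.factorial_zero, Nat.cast_one]
    field_simp
  · rintro ⟨q, r⟩ hq hne
    have hq := mem_antidiagonal.mp hq
    obtain ⟨r, rfl⟩ : ∃ r', r = r' + 1 := by
      rcases r with _ | r
      · exact absurd (by simpa using hq) (by simpa using hne)
      · exact ⟨r, rfl⟩
    rw [mul_smul_comm, map_smul, show (jac a b x (X 0) (X 1) * ((X 0 + X 1) ^ (q, r + 1).1 *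
      X 2 ^ (q, r + 1).2) : MvPolynomial (Fin 3) ℝ) = X 2 * (jac a b x (X 0) (X 1) * ((X 0 + X 1) ^ q * X 2 ^ r)) by
        simp only; ring, h0, smul_zero]
  · intro hq
    simp at hq

/-- The coefficients of the expansion of the coupling scheme `((1 2) 3)` in the scheme
`(1 (2 3))`, see `coupleLeft_eq_sum`. -/
def recoupling (a b c : ℝ) (x d k : ℕ) : ℝ :=
  (-1) ^ k * (poch a (x + d - k) * (x + d - k).factorial) /
    (poch (b + c + k - 1) k * (x.factorial * poch a x * (d.factorial * poch (a + b + 2 * x) d))) *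
    racah k (b - 1) (c - 1) (-(x + d : ℕ) - 1) (a + b - 1 + (x + d : ℕ)) x

/-- The overlap of the two coupling schemes of three variables. -/
theorem form_coupleRight_coupleLeft (ha : 0 < a) (hb : 0 < b) (hc : 0 < c) (hbc : 1 < b + c)
    {x d k e : ℕ} (h : k + e = x + d) :
    form ![a, b, c] (coupleRight a b c k e (X 0) (X 1) (X 2))
      (coupleLeft a b c x d (X 0) (X 1) (X 2)) =
      recoupling a b c x d k * (jacNorm b c k * jacNorm a (b + c + 2 * k) e) := by
  rw [form_coupleRight hb hc ha k e (isHarmonic_coupleLeft ha hb hc x d).lower]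
  have hr := sum_sum_eq_racah a c hb (show x ≤ x + d by omega) (show k ≤ x + d by omega)
  have hs : ∑ i ∈ range (k + 1), (k.choose i * poch (k + b + c - 1) i / poch b i) *
      form ![a, b, c] (X 1 ^ i * X 0 ^ (k + e - i)) (coupleLeft a b c x d (X 0) (X 1) (X 2)) =
      (-1) ^ (x + d) / (x.factorial * poch a x * (d.factorial * poch (a + b + 2 * x) d)) *
      ((-1) ^ k * (poch a (x + d - k) * (x + d - k).factorial) / poch b k *
        racah k (b - 1) (c - 1) (-(x + d : ℕ) - 1) (a + b - 1 + (x + d : ℕ)) x) := by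
    rw [← hr, mul_sum]
    refine sum_congr rfl fun i hi => ?_
    have hi : i ≤ k := Nat.lt_succ_iff.mp (mem_range.mp hi)
    rw [form_X_pow_mul_coupleLeft ha hb _ _ _ _ (by omega), h]
    have := poch_ne_zero hb i
    field_simp
  have e1 : (-1 : ℝ) ^ (x + d) * (-1) ^ (x + d) = 1 := by rw [← mul_pow]; simp
  have n1 := poch_ne_zero hb k
  have n2 := poch_ne_zero hc k
  have n3 : poch (b + c + k - 1) k ≠ 0 := poch_ne_zero (by
    have : (0 : ℝ) ≤ k := by positivity
    linarith) k
  have n4 := poch_ne_zero ha x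
  have n5 : poch (a + b + 2 * x) d ≠ 0 := poch_ne_zero (by positivity) d
  rw [hs, recoupling, jacNorm.eq_1 b, h]
  field_simp
  linear_combination (jacNorm a (b + c + 2 * k) e * poch a (x + d - k) *
    racah k (b - 1) (c - 1) (-(x + d : ℕ) - 1) (a + b - 1 + (x + d : ℕ)) x) * e1

theorem monomial_fin_three (s : Fin 3 →₀ ℕ) :
    (monomial s 1 : MvPolynomial (Fin 3) ℝ) = X 2 ^ s 2 * (X 1 ^ s 1 * X 0 ^ s 0) := by
  rw [monomial_eq, Finsupp.prod_fintype _ _ (by simp), Fin.prod_univ_three]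
  simp only [map_one]
  ring

/-- A harmonic polynomial in three variables that is orthogonal to all monomials in the first two
variables is zero. -/
theorem eq_zero_of_form_X_pow (ha : 0 < a) (hb : 0 < b) (hc : 0 < c) {n : ℕ}
    {g : MvPolynomial (Fin 3) ℝ} (hg : IsHarmonic ![a, b, c] univ n g)
    (h : ∀ i m, i + m = n → form ![a, b, c] (X 1 ^ i * X 0 ^ m) g = 0) : g = 0 := by
  have h1 : ∀ l i m, l + i + m = n → form ![a, b, c] (X 2 ^ l * (X 1 ^ i * X 0 ^ m)) g = 0 := by
    intro l
    induction l with
    | zero =>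
      intro i m him
      rw [pow_zero, one_mul]
      exact h i m (by omega)
    | succ l ih =>
      intro i m him
      have := form_radius_mul (α := ![a, b, c]) univ (X 2 ^ l * (X 1 ^ i * X 0 ^ m)) g
      rw [hg.lower, map_zero, radius, Fin.sum_univ_three,
        show ((X 0 + X 1 + X 2) * (X 2 ^ l * (X 1 ^ i * X 0 ^ m)) : MvPolynomial (Fin 3) ℝ) =
          X 2 ^ l * (X 1 ^ i * X 0 ^ (m + 1)) + X 2 ^ l * (X 1 ^ (i + 1) * X 0 ^ m) +
            X 2 ^ (l + 1) * (X 1 ^ i * X 0 ^ m) by ring, map_add, map_add, LinearMap.add_apply,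
        LinearMap.add_apply, ih i (m + 1) (by omega), ih (i + 1) m (by omega), zero_add,
        zero_add] at this
      exact this
  ext s
  rw [coeff_zero]
  by_cases hs : s 2 + s 1 + s 0 = n
  · have h2 := h1 _ _ _ hs
    rw [← monomial_fin_three, form_monomial, one_mul] at h2
    refine (mul_eq_zero.mp h2).resolve_left (prod_ne_zero_iff.mpr fun i _ => ?_)
    have : 0 < (![a, b, c] : Fin 3 → ℝ) i := by fin_cases i <;> assumption
    exact mul_ne_zero (by positivity) (poch_ne_zero this _)
  · have h2 := congrArg (coeff s) hg.euler
    rw [eulerOp_apply, coeff_sum, coeff_smul, smul_eq_mul] at h2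
    simp only [coeff_euler, Fin.sum_univ_three] at h2
    have h3 : ((s 2 + s 1 + s 0 : ℕ) - (n : ℝ)) * coeff s g = 0 := by
      push_cast
      linear_combination h2
    refine (mul_eq_zero.mp h3).resolve_left (sub_ne_zero.mpr ?_)
    exact_mod_cast hs

/-- The vectors of the scheme `(1 (2 3))` span the harmonic polynomials in three variables. -/
theorem eq_zero_of_form_coupleRight (ha : 0 < a) (hb : 0 < b) (hc : 0 < c) (hbc : 1 < b + c) {n : ℕ}
    {g : MvPolynomial (Fin 3) ℝ} (hg : IsHarmonic ![a, b, c] univ n g)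
    (h : ∀ k ≤ n, form ![a, b, c] (coupleRight a b c k (n - k) (X 0) (X 1) (X 2)) g = 0) :
    g = 0 := by
  refine eq_zero_of_form_X_pow ha hb hc hg fun i m him => ?_
  induction i using Nat.strong_induction_on generalizing m with
  | _ k ih =>
    have hk := h k (by omega)
    rw [form_coupleRight hb hc ha k _ hg.lower, sum_range_succ, sum_eq_zero, zero_add] at hk
    · rw [show k + (n - k) - k = m by omega] at hk
      have n1 := poch_ne_zero hb k
      have n2 := poch_ne_zero hc k
      have n3 : poch (k + b + c - 1) k ≠ 0 := poch_ne_zero (by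
        have : (0 : ℝ) ≤ k := by positivity
        linarith) k
      have n4 := (jacNorm_pos ha (show 0 < b + c + 2 * (k : ℝ) by positivity) (n - k)).ne'
      rw [Nat.choose_self, Nat.cast_one, one_mul] at hk
      exact (mul_eq_zero.mp ((mul_eq_zero.mp hk).resolve_left (by positivity))).resolve_left
        (by positivity)
    · intro i hi
      have hi := mem_range.mp hi
      rw [ih i hi _ (by omega), mul_zero]

theorem coupleLeft_X_eq_sum (ha : 0 < a) (hb : 0 < b) (hc : 0 < c) (hbc : 1 < b + c) (x d : ℕ) :
    (coupleLeft a b c x d (X 0) (X 1) (X 2) : MvPolynomial (Fin 3) ℝ) =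
      ∑ k ∈ range (x + d + 1), recoupling a b c x d k •
        coupleRight a b c k (x + d - k) (X 0) (X 1) (X 2) := by
  rw [← sub_eq_zero]
  have hR : ∀ k ∈ range (x + d + 1), IsHarmonic ![a, b, c] univ (x + d : ℕ)
      (coupleRight a b c k (x + d - k) (X 0) (X 1) (X 2)) := fun k hk => by
    have := isHarmonic_coupleRight ha hb hc k (x + d - k)
    rwa [Nat.add_sub_cancel' (Nat.lt_succ_iff.mp (mem_range.mp hk))] at this
  have hL := isHarmonic_coupleLeft ha hb hc x d
  refine eq_zero_of_form_coupleRight ha hb hc hbc (n := x + d) ⟨?_, ?_⟩ fun k hk => ?_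
  · rw [map_sub, map_sum, hL.lower, sum_eq_zero, sub_zero]
    intro k hk
    rw [map_smul, (hR k hk).lower, smul_zero]
  · rw [map_sub, map_sum, hL.euler, smul_sub, smul_sum]
    congr 1
    refine sum_congr rfl fun k hk => ?_
    rw [map_smul, (hR k hk).euler, smul_comm]
  · rw [map_sub, map_sum, form_coupleRight_coupleLeft ha hb hc hbc (Nat.add_sub_cancel' hk),
      sum_eq_single k]
    · rw [map_smul, form_coupleRight_self ha hb hc, smul_eq_mul, sub_self]
    · intro k' _ hk'
      rw [map_smul, form_coupleRight_of_ne hb hc hbc hk'.symm, smul_zero]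
    · intro hk'
      exact absurd (mem_range.mpr (by omega)) hk'

/-- The recoupling identity: the univariate Racah polynomials connect the two coupling schemes of
three representations. -/
theorem coupleLeft_eq_sum {R : Type*} [CommRing R] [Algebra ℝ R] (ha : 0 < a) (hb : 0 < b)
    (hc : 0 < c) (hbc : 1 < b + c) (x d : ℕ) (u v w : R) :
    coupleLeft a b c x d u v w = ∑ k ∈ range (x + d + 1), recoupling a b c x d k •
      coupleRight a b c k (x + d - k) u v w := by
  have h := congrArg (aeval ![u, v, w]) (coupleLeft_X_eq_sum ha hb hc hbc x d)
  simpa [coupleLeft, coupleRight, map_jac] using h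

end three

/-! ### The two coupled bases -/

section chain

variable {p : ℕ}

/-- The index `j` as an element of `Fin (p + 2)`, for `j < p + 2`. -/
def idx (p j : ℕ) : Fin (p + 2) := Fin.ofNat (p + 2) j

theorem idx_val {j : ℕ} (h : j < p + 2) : (idx p j : ℕ) = j := Nat.mod_eq_of_lt h

theorem mem_initialSet {n m : ℕ} {i : Fin n} : i ∈ initialSet n m ↔ (i : ℕ) < m := by
  simp [initialSet]

theorem mem_tailSet {n m : ℕ} {i : Fin n} : i ∈ tailSet n m ↔ 1 ≤ (i : ℕ) ∧ (i : ℕ) < m := by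
  simp only [tailSet, mem_filter, mem_univ, true_and]
  omega

theorem initialSet_succ {m : ℕ} (h : m < p + 2) :
    initialSet (p + 2) (m + 1) = initialSet (p + 2) m ∪ {idx p m} := by
  ext i
  rw [mem_union, mem_singleton, mem_initialSet, mem_initialSet, Fin.ext_iff, idx_val h]
  omega

theorem disjoint_initialSet {m : ℕ} (h : m < p + 2) :
    Disjoint (initialSet (p + 2) m) {idx p m} := by
  rw [disjoint_singleton_right, mem_initialSet, idx_val h]
  omega

theorem tailSet_succ {m : ℕ} (h1 : 1 ≤ m) (h : m < p + 2) :
    tailSet (p + 2) (m + 1) = tailSet (p + 2) m ∪ {idx p m} := by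
  ext i
  rw [mem_union, mem_singleton, mem_tailSet, mem_tailSet, Fin.ext_iff, idx_val h]
  omega

theorem disjoint_tailSet {m : ℕ} (h : m < p + 2) :
    Disjoint (tailSet (p + 2) m) {idx p m} := by
  rw [disjoint_singleton_right, mem_tailSet, idx_val h]
  omega

theorem initialSet_eq_union {m : ℕ} (h : 1 ≤ m) :
    initialSet (p + 2) m = {idx p 0} ∪ tailSet (p + 2) m := by
  ext i
  rw [mem_union, mem_singleton, mem_initialSet, mem_tailSet, Fin.ext_iff, idx_val (by omega)]
  omega

theorem disjoint_zero_tailSet {m : ℕ} : Disjoint {idx p 0} (tailSet (p + 2) m) := by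
  rw [disjoint_singleton_left, mem_tailSet, idx_val (by omega)]
  omega

theorem initialSet_one : initialSet (p + 2) 1 = {idx p 0} := by
  ext i
  rw [mem_singleton, mem_initialSet, Fin.ext_iff, idx_val (by omega)]
  omega

theorem tailSet_two : tailSet (p + 2) 2 = {idx p 1} := by
  ext i
  rw [mem_singleton, mem_tailSet, Fin.ext_iff, idx_val (by omega)]
  omega

theorem initialSet_full : initialSet (p + 2) (p + 2) = univ := by
  ext i
  rw [mem_initialSet]
  simp

theorem radius_union {σ : Type*} [DecidableEq σ] {A B : Finset σ} (h : Disjoint A B) :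
    (radius (A ∪ B) : MvPolynomial σ ℝ) = radius A + radius B :=
  sum_union h

theorem radius_singleton {σ : Type*} (i : σ) : (radius {i} : MvPolynomial σ ℝ) = X i :=
  sum_singleton _ _

theorem radius_mem_casimirCommutant_of_disjoint {σ : Type*} [DecidableEq σ] {α : σ → ℝ}
    {A B : Finset σ} (h : Disjoint A B) : radius B ∈ casimirCommutant α A :=
  sum_mem fun _ hi => X_mem_casimirCommutant (disjoint_right.mp h hi)

theorem radius_mem_casimirCommutant_of_subset {σ : Type*} [DecidableEq σ] {α : σ → ℝ}
    {A B : Finset σ} (h : A ⊆ B) : radius B ∈ casimirCommutant α A := by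
  rw [← union_sdiff_of_subset h, radius_union disjoint_sdiff]
  exact add_mem radius_mem_casimirCommutant
    (radius_mem_casimirCommutant_of_disjoint disjoint_sdiff)

theorem radius_mem_pderivKer {σ : Type*} {A : Finset σ} {i : σ} (h : i ∉ A) :
    radius A ∈ pderivKer i :=
  sum_mem fun _ hj => X_mem_pderivKer fun hij => h (hij ▸ hj)

variable (α : Fin (p + 2) → ℝ) (x K : ℕ → ℕ)

/-- The factor of `leftVec` that couples the variable with index `j + 1` to the preceding ones. -/
def leftFactor (j : ℕ) : MvPolynomial (Fin (p + 2)) ℝ :=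
  jac (∑ i ∈ initialSet (p + 2) (j + 1), α i + 2 * x j) (α (idx p (j + 1))) (x (j + 1) - x j)
    (radius (initialSet (p + 2) (j + 1))) (X (idx p (j + 1)))

/-- The vector of the coupling scheme `((1 2) 3) …` whose part in the first `j + 1` variables has
degree `x j`. -/
def leftVec : MvPolynomial (Fin (p + 2)) ℝ := ∏ j ∈ range (p + 1), leftFactor α x j

/-- The factor of `rightVec` that couples the variable with index `j + 2` to the variables
`1, …, j + 1`. -/
def rightFactor (j : ℕ) : MvPolynomial (Fin (p + 2)) ℝ :=
  jac (∑ i ∈ tailSet (p + 2) (j + 2), α i + 2 * K j) (α (idx p (j + 2))) (K (j + 1) - K j)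
    (radius (tailSet (p + 2) (j + 2))) (X (idx p (j + 2)))

/-- The factor of degree `t` that couples the variable with index `0` to a vector of degree `m` in
the variables `1, …, j + 1`. -/
def joinFactor (t m j : ℕ) : MvPolynomial (Fin (p + 2)) ℝ :=
  jac (α (idx p 0)) (∑ i ∈ tailSet (p + 2) (j + 2), α i + 2 * m) t
    (X (idx p 0)) (radius (tailSet (p + 2) (j + 2)))

/-- The vector of the coupling scheme `1 ((2 3) 4) …` of degree `N` whose part in the variables
`1, …, j + 1` has degree `K j`. -/
def rightVec (N : ℕ) : MvPolynomial (Fin (p + 2)) ℝ :=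
  (∏ j ∈ range p, rightFactor α K j) * joinFactor α (N - K p) (K p) p

/-- The intermediate coupling schemes between `leftVec` (`j = 0`) and `rightVec` (`j = p`): the
variables `1, …, j + 1` are coupled first, then the variable `0`, then the remaining ones. -/
def mixedVec (j : ℕ) : MvPolynomial (Fin (p + 2)) ℝ :=
  (∏ i ∈ range j, rightFactor α K i) * joinFactor α (x (j + 1) - K j) (K j) j *
    ∏ i ∈ Ico (j + 1) (p + 1), leftFactor α x i

variable {α x K}

theorem half_lt_sum (hα : ∀ i, 1 / 2 < α i) {A : Finset (Fin (p + 2))} {i : Fin (p + 2)}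
    (hi : i ∈ A) : 1 / 2 < ∑ i ∈ A, α i :=
  (hα i).trans_le (single_le_sum (f := α) (fun j _ => by linarith [hα j]) hi)

theorem half_lt_sum_initialSet (hα : ∀ i, 1 / 2 < α i) (j : ℕ) :
    1 / 2 < ∑ i ∈ initialSet (p + 2) (j + 1), α i :=
  half_lt_sum hα (i := idx p 0) (by rw [mem_initialSet, idx_val (by omega)]; omega)

theorem half_lt_sum_tailSet (hα : ∀ i, 1 / 2 < α i) (j : ℕ) :
    1 / 2 < ∑ i ∈ tailSet (p + 2) (j + 2), α i :=
  half_lt_sum hα (i := idx p 1) (by rw [mem_tailSet, idx_val (by omega)]; omega)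

theorem sum_initialSet_succ {m : ℕ} (h : m < p + 2) :
    ∑ i ∈ initialSet (p + 2) (m + 1), α i = ∑ i ∈ initialSet (p + 2) m, α i + α (idx p m) := by
  rw [initialSet_succ h, sum_union (disjoint_initialSet h), sum_singleton]

theorem sum_tailSet_succ {m : ℕ} (h1 : 1 ≤ m) (h : m < p + 2) :
    ∑ i ∈ tailSet (p + 2) (m + 1), α i = ∑ i ∈ tailSet (p + 2) m, α i + α (idx p m) := by
  rw [tailSet_succ h1 h, sum_union (disjoint_tailSet h), sum_singleton]

theorem sum_initialSet_eq {m : ℕ} (h : 1 ≤ m) :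
    ∑ i ∈ initialSet (p + 2) m, α i = α (idx p 0) + ∑ i ∈ tailSet (p + 2) m, α i := by
  rw [initialSet_eq_union h, sum_union disjoint_zero_tailSet, sum_singleton]

theorem leftFactor_mem_pderivKer {j : ℕ} {i : Fin (p + 2)} (hj : j + 1 < p + 2)
    (hi : i ∉ initialSet (p + 2) (j + 2)) : leftFactor α x j ∈ pderivKer i := by
  rw [mem_initialSet] at hi
  refine jac_mem _ _ _ (radius_mem_pderivKer ?_) (X_mem_pderivKer ?_)
  · rw [mem_initialSet]
    omega
  · rw [ne_eq, Fin.ext_iff, idx_val hj]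
    omega

theorem prod_leftFactor_mem_pderivKer {m : ℕ} {i : Fin (p + 2)} (hm : m ≤ p + 1)
    (hi : i ∉ initialSet (p + 2) (m + 1)) :
    ∏ j ∈ range m, leftFactor α x j ∈ pderivKer i := by
  refine prod_mem fun j hj => leftFactor_mem_pderivKer ?_ ?_
  · have := mem_range.mp hj
    omega
  · have := mem_range.mp hj
    rw [mem_initialSet] at hi ⊢
    omega

theorem rightFactor_mem_pderivKer {j : ℕ} {i : Fin (p + 2)} (hj : j + 2 < p + 2)
    (hi : i ∉ tailSet (p + 2) (j + 3)) : rightFactor α K j ∈ pderivKer i := by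
  rw [mem_tailSet] at hi
  refine jac_mem _ _ _ (radius_mem_pderivKer ?_) (X_mem_pderivKer ?_)
  · rw [mem_tailSet]
    omega
  · rw [ne_eq, Fin.ext_iff, idx_val hj]
    omega

theorem prod_rightFactor_mem_pderivKer {m : ℕ} {i : Fin (p + 2)} (hm : m ≤ p)
    (hi : i ∉ tailSet (p + 2) (m + 2)) :
    ∏ j ∈ range m, rightFactor α K j ∈ pderivKer i := by
  refine prod_mem fun j hj => rightFactor_mem_pderivKer ?_ ?_
  · have := mem_range.mp hj
    omega
  · have := mem_range.mp hj
    rw [mem_tailSet] at hi ⊢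
    omega

theorem isHarmonic_zero_of_mem_pderivKer {σ : Type*} {β : σ → ℝ} {i : σ} {f : MvPolynomial σ ℝ}
    (h : f ∈ pderivKer i) : IsHarmonic β {i} 0 f :=
  isHarmonic_of_pderiv_eq_zero fun j hj => by
    rw [mem_singleton] at hj
    subst hj
    exact h

/-- The partial products of `leftVec` are harmonic, with square norm the product of the factors
`jacNorm`. -/
theorem isHarmonic_prod_leftFactor (hα : ∀ i, 1 / 2 < α i) (hx : Monotone x) (h0 : x 0 = 0) {m : ℕ}
    (hm : m ≤ p + 1) :
    IsHarmonic α (initialSet (p + 2) (m + 1)) (x m) (∏ j ∈ range m, leftFactor α x j) ∧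
      form α (∏ j ∈ range m, leftFactor α x j) (∏ j ∈ range m, leftFactor α x j) =
        ∏ j ∈ range m, jacNorm (∑ i ∈ initialSet (p + 2) (j + 1), α i + 2 * x j)
          (α (idx p (j + 1))) (x (j + 1) - x j) := by
  induction m with
  | zero =>
    rw [h0, range_zero, prod_empty, prod_empty, Nat.cast_zero]
    exact ⟨isHarmonic_of_pderiv_eq_zero (by simp), form_one α⟩
  | succ m ih =>
    obtain ⟨ih1, ih2⟩ := ih (by omega)
    have hB := isHarmonic_zero_of_mem_pderivKer (β := α) (prod_leftFactor_mem_pderivKer (α := α)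
      (x := x) (i := idx p (m + 1)) (show m ≤ p + 1 by omega)
      (by rw [mem_initialSet, idx_val (by omega)]; omega))
    have ha : 0 < ∑ i ∈ initialSet (p + 2) (m + 1), α i + 2 * (x m : ℝ) := by
      have := half_lt_sum_initialSet hα m
      positivity
    have hb : 0 < α (idx p (m + 1)) := by linarith [hα (idx p (m + 1))]
    have hd : (x m : ℝ) + 0 + (x (m + 1) - x m : ℕ) = x (m + 1) := by
      rw [Nat.cast_sub (hx (Nat.le_succ m))]
      ring
    rw [prod_range_succ, prod_range_succ, ← ih2]
    constructor
    · have := ih1.mul_jac hB (disjoint_initialSet (by omega)) rfl (by simp) ha hb (x (m + 1) - x m)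
      rwa [hd, ← initialSet_succ (by omega), radius_singleton] at this
    · have := ih1.form_mul_jac_self hB (disjoint_initialSet (by omega)) rfl (by simp) ha hb
        (x (m + 1) - x m)
      rwa [radius_singleton] at this

/-- The partial products of `rightVec` are harmonic, with square norm the product of the factors
`jacNorm`. -/
theorem isHarmonic_prod_rightFactor (hα : ∀ i, 1 / 2 < α i) (hK : Monotone K) (h0 : K 0 = 0)
    {m : ℕ} (hm : m ≤ p) :
    IsHarmonic α (tailSet (p + 2) (m + 2)) (K m) (∏ j ∈ range m, rightFactor α K j) ∧
      form α (∏ j ∈ range m, rightFactor α K j) (∏ j ∈ range m, rightFactor α K j) =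
        ∏ j ∈ range m, jacNorm (∑ i ∈ tailSet (p + 2) (j + 2), α i + 2 * K j)
          (α (idx p (j + 2))) (K (j + 1) - K j) := by
  induction m with
  | zero =>
    rw [h0, range_zero, prod_empty, prod_empty, Nat.cast_zero]
    exact ⟨isHarmonic_of_pderiv_eq_zero (by simp), form_one α⟩
  | succ m ih =>
    obtain ⟨ih1, ih2⟩ := ih (by omega)
    have hB := isHarmonic_zero_of_mem_pderivKer (β := α) (prod_rightFactor_mem_pderivKer (α := α)
      (K := K) (i := idx p (m + 2)) (show m ≤ p by omega)
      (by rw [mem_tailSet, idx_val (by omega)]; omega))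
    have ha : 0 < ∑ i ∈ tailSet (p + 2) (m + 2), α i + 2 * (K m : ℝ) := by
      have := half_lt_sum_tailSet hα m
      positivity
    have hb : 0 < α (idx p (m + 2)) := by linarith [hα (idx p (m + 2))]
    have hd : (K m : ℝ) + 0 + (K (m + 1) - K m : ℕ) = K (m + 1) := by
      rw [Nat.cast_sub (hK (Nat.le_succ m))]
      ring
    rw [prod_range_succ, prod_range_succ, ← ih2]
    constructor
    · have := ih1.mul_jac hB (disjoint_tailSet (by omega)) rfl (by simp) ha hb (K (m + 1) - K m)
      rwa [hd, ← tailSet_succ (by omega) (by omega), radius_singleton] at this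
    · have := ih1.form_mul_jac_self hB (disjoint_tailSet (by omega)) rfl (by simp) ha hb
        (K (m + 1) - K m)
      rwa [radius_singleton] at this

theorem isHarmonic_leftVec (hα : ∀ i, 1 / 2 < α i) (hx : Monotone x) (h0 : x 0 = 0) :
    IsHarmonic α univ (x (p + 1)) (leftVec α x) := by
  rw [← initialSet_full]
  exact (isHarmonic_prod_leftFactor hα hx h0 le_rfl).1

theorem form_leftVec_self (hα : ∀ i, 1 / 2 < α i) (hx : Monotone x) (h0 : x 0 = 0) :
    form α (leftVec α x) (leftVec α x) =
      ∏ j ∈ range (p + 1), jacNorm (∑ i ∈ initialSet (p + 2) (j + 1), α i + 2 * x j)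
          (α (idx p (j + 1))) (x (j + 1) - x j) :=
  (isHarmonic_prod_leftFactor hα hx h0 le_rfl).2

theorem isHarmonic_rightVec (hα : ∀ i, 1 / 2 < α i) (hK : Monotone K) (h0 : K 0 = 0) {N : ℕ}
    (hN : K p ≤ N) :
    IsHarmonic α univ N (rightVec α K N) ∧ form α (rightVec α K N) (rightVec α K N) =
      (∏ j ∈ range p, jacNorm (∑ i ∈ tailSet (p + 2) (j + 2), α i + 2 * K j)
          (α (idx p (j + 2))) (K (j + 1) - K j)) *
        jacNorm (α (idx p 0)) (∑ i ∈ tailSet (p + 2) (p + 2), α i + 2 * K p) (N - K p) := by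
  obtain ⟨h1, h2⟩ := isHarmonic_prod_rightFactor (p := p) hα hK h0 le_rfl
  have hA := isHarmonic_zero_of_mem_pderivKer (β := α) (prod_rightFactor_mem_pderivKer (α := α)
      (K := K) (i := idx p 0) (le_refl p)
      (by rw [mem_tailSet, idx_val (by omega)]; omega))
  have ha : 0 < α (idx p 0) := by linarith [hα (idx p 0)]
  have hb : 0 < ∑ i ∈ tailSet (p + 2) (p + 2), α i + 2 * (K p : ℝ) := by
    have := half_lt_sum_tailSet hα p
    positivity
  have hd : 0 + (K p : ℝ) + (N - K p : ℕ) = N := by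
    rw [Nat.cast_sub hN]
    ring
  rw [← h2]
  constructor
  · have := hA.mul_jac h1 disjoint_zero_tailSet (by simp) rfl ha hb (N - K p)
    rwa [hd, ← initialSet_eq_union (by omega), initialSet_full, radius_singleton] at this
  · have := hA.form_mul_jac_self h1 disjoint_zero_tailSet (by simp) rfl ha hb (N - K p)
    rwa [radius_singleton] at this

theorem initialSet_subset {n m m' : ℕ} (h : m ≤ m') : initialSet n m ⊆ initialSet n m' :=
  fun i hi => by
    rw [mem_initialSet] at hi ⊢
    omega

theorem tailSet_subset {n m m' : ℕ} (h : m ≤ m') : tailSet n m ⊆ tailSet n m' :=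
  fun i hi => by
    rw [mem_tailSet] at hi ⊢
    omega

theorem tailSet_subset_initialSet {n m m' : ℕ} (h : m ≤ m') : tailSet n m ⊆ initialSet n m' :=
  fun i hi => by
    rw [mem_tailSet] at hi
    rw [mem_initialSet]
    omega

theorem leftFactor_mem_casimirCommutant {A : Finset (Fin (p + 2))} {j : ℕ} (hj : j + 1 < p + 2)
    (hA : A ⊆ initialSet (p + 2) (j + 1)) : leftFactor α x j ∈ casimirCommutant α A := by
  refine jac_mem _ _ _ (radius_mem_casimirCommutant_of_subset hA) (X_mem_casimirCommutant fun h => ?_)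
  have := mem_initialSet.mp (hA h)
  rw [idx_val hj] at this
  omega

theorem rightFactor_mem_casimirCommutant {A : Finset (Fin (p + 2))} {j : ℕ} (hj : j + 2 < p + 2)
    (hA : A ⊆ tailSet (p + 2) (j + 2)) : rightFactor α K j ∈ casimirCommutant α A := by
  refine jac_mem _ _ _ (radius_mem_casimirCommutant_of_subset hA) (X_mem_casimirCommutant fun h => ?_)
  have := mem_tailSet.mp (hA h)
  rw [idx_val hj] at this
  omega

theorem joinFactor_mem_casimirCommutant {A : Finset (Fin (p + 2))} {j : ℕ} (t m : ℕ)
    (hA : A ⊆ tailSet (p + 2) (j + 2)) : joinFactor α t m j ∈ casimirCommutant α A := by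
  refine jac_mem _ _ _ (X_mem_casimirCommutant fun h => ?_) (radius_mem_casimirCommutant_of_subset hA)
  have := mem_tailSet.mp (hA h)
  rw [idx_val (by omega)] at this
  omega

/-- `leftVec` is a joint eigenvector of the Casimir operators of the initial sets: the factors from
`m` on lie in the commutant, and the others form a harmonic polynomial. -/
theorem casimirOp_leftVec (hα : ∀ i, 1 / 2 < α i) (hx : Monotone x) (h0 : x 0 = 0) {m : ℕ}
    (hm : m ≤ p + 1) :
    casimirOp α (initialSet (p + 2) (m + 1)) (leftVec α x) =
      kappa (x m) (∑ i ∈ initialSet (p + 2) (m + 1), α i - 1) • leftVec α x := by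
  rw [leftVec, ← prod_range_mul_prod_Ico _ hm]
  refine (isHarmonic_prod_leftFactor hα hx h0 hm).1.casimirOp_mul (prod_mem fun j hj => ?_)
  have := mem_Ico.mp hj
  exact leftFactor_mem_casimirCommutant (by omega) (initialSet_subset (by omega))

/-- `rightVec` is a joint eigenvector of the Casimir operators of the tail sets. -/
theorem casimirOp_rightVec (hα : ∀ i, 1 / 2 < α i) (hK : Monotone K) (h0 : K 0 = 0) {m : ℕ}
    (hm : m ≤ p) (N : ℕ) :
    casimirOp α (tailSet (p + 2) (m + 2)) (rightVec α K N) =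
      kappa (K m) (∑ i ∈ tailSet (p + 2) (m + 2), α i - 1) • rightVec α K N := by
  rw [rightVec, ← prod_range_mul_prod_Ico _ hm, mul_assoc]
  refine (isHarmonic_prod_rightFactor hα hK h0 hm).1.casimirOp_mul
    (mul_mem (prod_mem fun j hj => ?_) (joinFactor_mem_casimirCommutant _ _ (tailSet_subset (by omega))))
  have := mem_Ico.mp hj
  exact rightFactor_mem_casimirCommutant (by omega) (tailSet_subset (by omega))

/-! ### Passing from one coupled basis to the other -/

theorem mixedVec_zero (h0x : x 0 = 0) (h0K : K 0 = 0) : mixedVec α x K 0 = leftVec α x := by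
  rw [mixedVec, leftVec]
  conv_rhs => rw [range_eq_Ico, prod_eq_prod_Ico_succ_bot (by omega : 0 < p + 1)]
  congr 1
  rw [range_zero, prod_empty, one_mul, joinFactor, leftFactor, h0x, h0K, zero_add, zero_add,
    initialSet_one, tailSet_two, sum_singleton, sum_singleton, radius_singleton, radius_singleton]
  simp

theorem mixedVec_last {N : ℕ} (hN : x (p + 1) = N) : mixedVec α x K p = rightVec α K N := by
  rw [mixedVec, rightVec, Ico_self, prod_empty, mul_one, hN]

/-- `mixedVec` with the intermediate degree in the variables `1, …, j + 2` replaced by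
`K j + k`. -/
def mixedVecAux (α : Fin (p + 2) → ℝ) (x K : ℕ → ℕ) (j k : ℕ) : MvPolynomial (Fin (p + 2)) ℝ :=
  ((∏ i ∈ range j, rightFactor α K i) *
    jac (∑ i ∈ tailSet (p + 2) (j + 2), α i + 2 * K j) (α (idx p (j + 2))) k
      (radius (tailSet (p + 2) (j + 2))) (X (idx p (j + 2)))) *
    (joinFactor α (x (j + 2) - K j - k) (K j + k) (j + 1) *
      ∏ i ∈ Ico (j + 2) (p + 1), leftFactor α x i)

theorem mixedVecAux_eq (hK : Monotone K) (j : ℕ) :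
    mixedVecAux α x K j (K (j + 1) - K j) = mixedVec α x K (j + 1) := by
  have h : K j ≤ K (j + 1) := hK (Nat.le_succ j)
  have hx : x (j + 1 + 1) = x (j + 2) := rfl
  rw [mixedVecAux, mixedVec, prod_range_succ, rightFactor, mul_assoc,
    show x (j + 2) - K j - (K (j + 1) - K j) = x (j + 1 + 1) - K (j + 1) by omega,
    show K j + (K (j + 1) - K j) = K (j + 1) from Nat.add_sub_cancel' h]
  ring

/-- The elementary step: recoupling of the first variable, the group of variables `1, …, j + 1`, and
the variable `j + 2`. -/
theorem mixedVec_eq_sum (hα : ∀ i, 1 / 2 < α i) (hx : Monotone x) {j : ℕ} (hj : j < p)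
    (hKx : K j ≤ x (j + 1)) :
    mixedVec α x K j = ∑ k ∈ range (x (j + 2) - K j + 1),
      recoupling (α (idx p 0)) (∑ i ∈ tailSet (p + 2) (j + 2), α i + 2 * K j) (α (idx p (j + 2)))
        (x (j + 1) - K j) (x (j + 2) - x (j + 1)) k • mixedVecAux α x K j k := by
  have hx' : x (j + 1) ≤ x (j + 2) := hx (Nat.le_succ _)
  have hν := half_lt_sum_tailSet hα j
  have hK0 : (0 : ℝ) ≤ K j := by positivity
  have key := coupleLeft_eq_sum (a := α (idx p 0))
    (b := ∑ i ∈ tailSet (p + 2) (j + 2), α i + 2 * K j) (c := α (idx p (j + 2)))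
    (by linarith [hα (idx p 0)]) (by linarith) (by linarith [hα (idx p (j + 2))])
    (by linarith [hα (idx p (j + 2))]) (x (j + 1) - K j) (x (j + 2) - x (j + 1))
    (X (idx p 0)) (radius (tailSet (p + 2) (j + 2))) (X (idx p (j + 2)))
  rw [show x (j + 1) - K j + (x (j + 2) - x (j + 1)) = x (j + 2) - K j by omega] at key
  have hleft : joinFactor α (x (j + 1) - K j) (K j) j * leftFactor α x (j + 1) =
      coupleLeft (α (idx p 0)) (∑ i ∈ tailSet (p + 2) (j + 2), α i + 2 * K j) (α (idx p (j + 2)))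
        (x (j + 1) - K j) (x (j + 2) - x (j + 1))
        (X (idx p 0)) (radius (tailSet (p + 2) (j + 2))) (X (idx p (j + 2))) := by
    rw [joinFactor, leftFactor, coupleLeft, sum_initialSet_eq (by omega),
      initialSet_eq_union (by omega), radius_union disjoint_zero_tailSet, radius_singleton,
      Nat.cast_sub hKx]
    congr 2
    ring
  have hright : ∀ k, jac (∑ i ∈ tailSet (p + 2) (j + 2), α i + 2 * K j) (α (idx p (j + 2))) k
      (radius (tailSet (p + 2) (j + 2))) (X (idx p (j + 2))) *
      joinFactor α (x (j + 2) - K j - k) (K j + k) (j + 1) =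
      coupleRight (α (idx p 0)) (∑ i ∈ tailSet (p + 2) (j + 2), α i + 2 * K j) (α (idx p (j + 2)))
        k (x (j + 2) - K j - k)
        (X (idx p 0)) (radius (tailSet (p + 2) (j + 2))) (X (idx p (j + 2))) := fun k => by
    rw [joinFactor, coupleRight, show j + 1 + 2 = j + 2 + 1 by omega,
      sum_tailSet_succ (m := j + 2) (by omega) (by omega),
      tailSet_succ (m := j + 2) (by omega) (by omega), radius_union (disjoint_tailSet (by omega)), radius_singleton]
    congr 2
    push_cast
    ring
  rw [mixedVec, prod_eq_prod_Ico_succ_bot (by omega : j + 1 < p + 1)]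
  calc _ = (∏ i ∈ range j, rightFactor α K i) * (joinFactor α (x (j + 1) - K j) (K j) j *
        leftFactor α x (j + 1)) * ∏ i ∈ Ico (j + 2) (p + 1), leftFactor α x i := by ring
    _ = _ := by
      rw [hleft, key, mul_sum, sum_mul]
      refine sum_congr rfl fun k _ => ?_
      rw [← hright, mixedVecAux, mul_smul_comm, smul_mul_assoc]
      congr 1
      ring

theorem casimirOp_mixedVecAux (hα : ∀ i, 1 / 2 < α i) (hK : Monotone K) (h0 : K 0 = 0) {j : ℕ}
    (hj : j < p) (k : ℕ) :
    casimirOp α (tailSet (p + 2) (j + 3)) (mixedVecAux α x K j k) =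
      kappa (K j + k : ℕ) (∑ i ∈ tailSet (p + 2) (j + 3), α i - 1) • mixedVecAux α x K j k := by
  have hB := isHarmonic_zero_of_mem_pderivKer (β := α) (prod_rightFactor_mem_pderivKer (α := α)
      (K := K) (i := idx p (j + 2)) (show j ≤ p by omega)
      (by rw [mem_tailSet, idx_val (by omega)]; omega))
  have ha : 0 < ∑ i ∈ tailSet (p + 2) (j + 2), α i + 2 * (K j : ℝ) := by
    have := half_lt_sum_tailSet hα j
    positivity
  have hb : 0 < α (idx p (j + 2)) := by linarith [hα (idx p (j + 2))]
  have h := (isHarmonic_prod_rightFactor hα hK h0 (show j ≤ p by omega)).1.mul_jac hB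
    (disjoint_tailSet (by omega)) rfl (by simp) ha hb k
  rw [← tailSet_succ (by omega) (by omega), radius_singleton,
    show (K j : ℝ) + 0 + k = (K j + k : ℕ) by push_cast; ring] at h
  refine h.casimirOp_mul (mul_mem (joinFactor_mem_casimirCommutant _ _ (tailSet_subset (by omega)))
    (prod_mem fun i hi => ?_))
  have := mem_Ico.mp hi
  exact leftFactor_mem_casimirCommutant (by omega) (tailSet_subset_initialSet (by omega))

theorem one_lt_sum_tailSet (hα : ∀ i, 1 / 2 < α i) {j : ℕ} (hj : j < p) :
    1 < ∑ i ∈ tailSet (p + 2) (j + 3), α i := by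
  rw [sum_tailSet_succ (by omega) (by omega)]
  linarith [half_lt_sum_tailSet hα j, hα (idx p (j + 2))]

/-- Only the term of `mixedVec_eq_sum` with the right intermediate degree has the same Casimir
eigenvalue as `rightVec`. -/
theorem form_rightVec_mixedVecAux (hα : ∀ i, 1 / 2 < α i) (hK : Monotone K) (h0 : K 0 = 0) {j : ℕ}
    (hj : j < p) {k : ℕ} (hk : k ≠ K (j + 1) - K j) (N : ℕ) :
    form α (rightVec α K N) (mixedVecAux α x K j k) = 0 := by
  refine form_eq_zero_of_casimirOp (casimirOp_rightVec hα hK h0 (m := j + 1) (by omega) N)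
    (casimirOp_mixedVecAux hα hK h0 hj k) fun h => hk ?_
  have := kappa_injective_of_pos (by
    linarith [one_lt_sum_tailSet hα hj, show j + 1 + 2 = j + 3 by omega]) h
  omega

/-- The coefficient of the elementary step from `mixedVec α x K j` to
`mixedVec α x K (j + 1)`. -/
def stepCoeff (α : Fin (p + 2) → ℝ) (x K : ℕ → ℕ) (j : ℕ) : ℝ :=
  recoupling (α (idx p 0)) (∑ i ∈ tailSet (p + 2) (j + 2), α i + 2 * K j) (α (idx p (j + 2)))
    (x (j + 1) - K j) (x (j + 2) - x (j + 1)) (K (j + 1) - K j)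

theorem form_rightVec_mixedVec (hα : ∀ i, 1 / 2 < α i) (hx : Monotone x) (hK : Monotone K)
    (h0 : K 0 = 0) {j : ℕ} (hj : j < p) (hKx : K j ≤ x (j + 1)) (N : ℕ) :
    form α (rightVec α K N) (mixedVec α x K j) = if K (j + 1) ≤ x (j + 2) then
      stepCoeff α x K j * form α (rightVec α K N) (mixedVec α x K (j + 1)) else 0 := by
  have hx' : x (j + 1) ≤ x (j + 2) := hx (Nat.le_succ _)
  have hK' : K j ≤ K (j + 1) := hK (Nat.le_succ _)
  rw [mixedVec_eq_sum hα hx hj hKx, map_sum]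
  have hzero : ∀ k, k ≠ K (j + 1) - K j → form α (rightVec α K N)
      (recoupling (α (idx p 0)) (∑ i ∈ tailSet (p + 2) (j + 2), α i + 2 * K j) (α (idx p (j + 2)))
        (x (j + 1) - K j) (x (j + 2) - x (j + 1)) k • mixedVecAux α x K j k) = 0 := fun k hk => by
    rw [map_smul, form_rightVec_mixedVecAux hα hK h0 hj hk, smul_zero]
  split_ifs with h
  · rw [sum_eq_single (K (j + 1) - K j) (fun k _ hk => hzero k hk)
      (fun hn => absurd (mem_range.mpr (by omega)) hn), map_smul, mixedVecAux_eq hK, smul_eq_mul,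
      stepCoeff]
  · refine sum_eq_zero fun k hk => hzero k ?_
    have := mem_range.mp hk
    omega

theorem form_rightVec_leftVec_eq_prod (hα : ∀ i, 1 / 2 < α i) (hx : Monotone x) (hK : Monotone K)
    (h0x : x 0 = 0) (h0 : K 0 = 0) (N : ℕ) {m : ℕ} (hm : m ≤ p) (h : ∀ j < m, K (j + 1) ≤ x (j + 2)) :
    form α (rightVec α K N) (leftVec α x) =
      (∏ j ∈ range m, stepCoeff α x K j) * form α (rightVec α K N) (mixedVec α x K m) := by
  induction m with
  | zero => rw [range_zero, prod_empty, one_mul, mixedVec_zero h0x h0]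
  | succ m ih =>
    have hKx : K m ≤ x (m + 1) := by
      rcases m with _ | m
      · omega
      · exact h m (by omega)
    rw [ih (by omega) fun j hj => h j (by omega),
      form_rightVec_mixedVec hα hx hK h0 (by omega) hKx, if_pos (h m (by omega)), prod_range_succ,
      mul_assoc]

/-- A degree `K (m + 1)` above `x (m + 2)` cannot occur in the recoupling, so the inner product
vanishes. -/
theorem form_rightVec_leftVec_eq_zero (hα : ∀ i, 1 / 2 < α i) (hx : Monotone x) (hK : Monotone K)
    (h0x : x 0 = 0) (h0 : K 0 = 0) (N : ℕ) {m : ℕ} (hm : m < p) (h : ∀ j < m, K (j + 1) ≤ x (j + 2))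
    (hlt : x (m + 2) < K (m + 1)) :
    form α (rightVec α K N) (leftVec α x) = 0 := by
  have hKx : K m ≤ x (m + 1) := by
    rcases m with _ | m
    · omega
    · exact h m (by omega)
  rw [form_rightVec_leftVec_eq_prod hα hx hK h0x h0 N hm.le h,
    form_rightVec_mixedVec hα hx hK h0 hm hKx, if_neg (by omega), mul_zero]

/-- Since `γ + 1 = -n`, the `i`-th term of the Racah polynomial contains `(-n + i)_{k - i}`, which
vanishes for `i ≤ x`, and `(-x)_i`, which vanishes for `i > x`. -/
theorem racah_eq_zero {x n k : ℕ} (hx : x ≤ n) (hn : n < k) (s t δ : ℝ) :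
    racah k s t (-n - 1) δ x = 0 := by
  refine sum_eq_zero fun i _ => ?_
  rcases le_or_gt i x with h | h
  · have : poch (-(n : ℝ) - 1 + 1 + i) (k - i) = 0 := by
      rw [show -(n : ℝ) - 1 + 1 + i = -((n - i : ℕ) : ℝ) by
        rw [Nat.cast_sub (by omega)]; ring, poch_neg_natCast, Nat.choose_eq_zero_of_lt (by omega)]
      simp
    rw [this]
    ring
  · rw [poch_neg_natCast x, Nat.choose_eq_zero_of_lt h]
    simp

end chain

/-! ### Passage to the Dunkl model -/

section lift

variable {n : ℕ}

/-- The exponent `2 c + ε`. -/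
def liftExp (ε : Fin n → Fin 2) (c : Fin n →₀ ℕ) : Fin n →₀ ℕ :=
  Finsupp.equivFunOnFinite.symm fun i => 2 * c i + ε i

@[simp] theorem liftExp_apply (ε : Fin n → Fin 2) (c : Fin n →₀ ℕ) (i : Fin n) :
    liftExp ε c i = 2 * c i + ε i := rfl

/-- The map `f ↦ y^ε f(y_1² / 2, …, y_n² / 2)` to the Dunkl model. -/
def lift (ε : Fin n → Fin 2) : MvPolynomial (Fin n) ℝ →ₗ[ℝ] MvPolynomial (Fin n) ℂ :=
  (basisMonomials (Fin n) ℝ).constr ℝ fun c => monomial (liftExp ε c) ((1 / 2 : ℂ) ^ ∑ i, c i)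

/-- The parameters `α_i = 1/2 + μ_i + ε_i` of the model in squared variables. -/
def liftPar (μ : Fin n → ℝ) (ε : Fin n → Fin 2) (i : Fin n) : ℝ := 1 / 2 + μ i + ((ε i : ℕ) : ℝ)

variable {ε : Fin n → Fin 2} {μ : Fin n → ℝ}

theorem lift_smul (r : ℝ) (f : MvPolynomial (Fin n) ℝ) : lift ε (r • f) = (r : ℂ) • lift ε f := by
  rw [map_smul]
  exact (algebraMap_smul ℂ r (lift ε f)).symm

theorem lift_monomial (c : Fin n →₀ ℕ) (r : ℝ) :
    lift ε (monomial c r) = monomial (liftExp ε c) ((r : ℂ) * (1 / 2) ^ ∑ i, c i) := by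
  have h : (monomial c r : MvPolynomial (Fin n) ℝ) = r • basisMonomials (Fin n) ℝ c := by
    rw [coe_basisMonomials, smul_monomial, smul_eq_mul, mul_one]
  rw [h, lift_smul, lift, Module.Basis.constr_basis, smul_monomial, smul_eq_mul]

theorem liftExp_add_single (c : Fin n →₀ ℕ) (i : Fin n) :
    liftExp ε (c + Finsupp.single i 1) = liftExp ε c + Finsupp.single i 2 := by
  ext j
  simp only [liftExp_apply, Finsupp.add_apply]
  by_cases h : j = i
  · subst h
    simp only [Finsupp.single_eq_same]
    ring
  · simp [Finsupp.single_eq_of_ne h]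

theorem sum_add_single (c : Fin n →₀ ℕ) (i : Fin n) :
    ∑ j, (c + Finsupp.single i 1 : Fin n →₀ ℕ) j = ∑ j, c j + 1 := by
  simp [sum_add_distrib, Finsupp.single_apply]

theorem bessel_monomial_of_eq_zero {σ : Type*} {α : σ → ℝ} {i : σ} {c : σ →₀ ℕ} (h : c i = 0)
    (r : ℝ) : bessel α i (monomial c r) = 0 := by
  simp [bessel_apply, pderiv_monomial, h]

theorem bessel_monomial_add_single {σ : Type*} [DecidableEq σ] {α : σ → ℝ} (i : σ) (c : σ →₀ ℕ)
    (r : ℝ) : bessel α i (monomial (c + Finsupp.single i 1) r) =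
      monomial c ((c i + 1) * (α i + c i) * r) := by
  ext d
  rw [coeff_bessel, coeff_monomial, coeff_monomial]
  by_cases h : c = d
  · subst h
    simp
  · rw [if_neg h, if_neg fun h' => h (add_right_cancel h'), mul_zero]

theorem fin_two_cases (e : Fin 2) : (e : ℕ) = 0 ∨ (e : ℕ) = 1 := by omega

/-- `T_i² / 2` corresponds to the Bessel operator in the squared variables. -/
theorem dunkl_dunkl_lift (i : Fin n) (f : MvPolynomial (Fin n) ℝ) :
    dunkl μ i (dunkl μ i (lift ε f)) = (2 : ℂ) • lift ε (bessel (liftPar μ ε) i f) := by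
  induction f using MvPolynomial.induction_on' with
  | add f g hf hg => simp only [map_add, hf, hg, smul_add]
  | monomial c r =>
    rw [lift_monomial, dunkl_monomial, dunkl_monomial]
    by_cases hc : c i = 0
    · rw [bessel_monomial_of_eq_zero hc, map_zero, smul_zero]
      convert monomial_zero
      rcases fin_two_cases (ε i) with h | h <;> simp [hc, h]
    · obtain ⟨d, rfl⟩ : ∃ d : Fin n →₀ ℕ, c = d + Finsupp.single i 1 :=
        ⟨c - Finsupp.single i 1, (tsub_add_cancel_of_le (by
          rw [Finsupp.single_le_iff]; omega)).symm⟩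
      rw [bessel_monomial_add_single, lift_monomial, smul_monomial, liftExp_add_single,
        show (Finsupp.single i 2 : Fin n →₀ ℕ) = Finsupp.single i 1 + Finsupp.single i 1 by
          rw [← Finsupp.single_add], ← add_assoc, add_tsub_cancel_right, add_tsub_cancel_right,
        sum_add_single]
      congr 1
      simp only [Finsupp.add_apply, Finsupp.single_eq_same, liftExp_apply, smul_eq_mul, liftPar]
      rcases fin_two_cases (ε i) with h | h
      · rw [h]
        simp only [add_zero, pow_add, pow_mul]
        push_cast
        norm_num
        ring
      · rw [h]
        simp only [pow_add, pow_mul]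
        push_cast
        norm_num
        ring

theorem lowering_lift (A : Finset (Fin n)) (f : MvPolynomial (Fin n) ℝ) :
    lowering μ A (lift ε f) = lift ε (lowerOp (liftPar μ ε) A f) := by
  rw [lowering, lowerOp_apply, map_sum, LinearMap.sum_apply]
  refine sum_congr rfl fun i _ => ?_
  rw [LinearMap.smul_apply, pow_two, Module.End.mul_apply, dunkl_dunkl_lift, smul_smul]
  norm_num

theorem raising_lift (A : Finset (Fin n)) (f : MvPolynomial (Fin n) ℝ) :
    raising A (lift ε f) = lift ε (radius A * f) := by
  rw [raising, radius, sum_mul, map_sum, LinearMap.sum_apply]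
  refine sum_congr rfl fun i _ => ?_
  rw [LinearMap.smul_apply, pow_two, Module.End.mul_apply]
  change (1 / 2 : ℂ) • (X i * (X i * lift ε f)) = lift ε (X i * f)
  induction f using MvPolynomial.induction_on' with
  | add f g hf hg => simp only [map_add, mul_add, smul_add, hf, hg]
  | monomial c r =>
    rw [X, X, monomial_mul, lift_monomial, lift_monomial, monomial_mul, monomial_mul, smul_monomial,
      add_comm (Finsupp.single i 1) c, liftExp_add_single, sum_add_single]
    congr 1
    · congr 1
      rw [← add_assoc, ← Finsupp.single_add, add_comm]
    · rw [smul_eq_mul]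
      push_cast
      ring

theorem X_mul_pderiv_monomial {σ R : Type*} [CommSemiring R] (i : σ) (c : σ →₀ ℕ) (r : R) :
    X i * pderiv i (monomial c r) = monomial c (c i * r) := by
  rw [pderiv_monomial, X, monomial_mul]
  by_cases h : c i = 0
  · simp [h]
  · rw [add_tsub_cancel_of_le (by rw [Finsupp.single_le_iff]; omega)]
    congr 1
    ring

theorem weightOp_lift (A : Finset (Fin n)) (f : MvPolynomial (Fin n) ℝ) :
    weightOp μ A (lift ε f) = lift ε (cartanOp (liftPar μ ε) A f) := by
  have h : cartanOp (liftPar μ ε) A f =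
      ∑ i ∈ A, (euler i f + (liftPar μ ε i / 2) • f) := by
    rw [cartanOp_apply, eulerOp_apply, sum_add_distrib, ← sum_smul, sum_div]
  rw [weightOp, h, map_sum, LinearMap.sum_apply]
  refine sum_congr rfl fun i _ => ?_
  change (1 / 2 : ℂ) • (X i * pderiv i (lift ε f) + ((1 / 2 + μ i : ℝ) : ℂ) • lift ε f) = _
  induction f using MvPolynomial.induction_on' with
  | add f g hf hg =>
    calc _ = (1 / 2 : ℂ) • (X i * pderiv i (lift ε f) + ((1 / 2 + μ i : ℝ) : ℂ) • lift ε f) +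
        (1 / 2 : ℂ) • (X i * pderiv i (lift ε g) + ((1 / 2 + μ i : ℝ) : ℂ) • lift ε g) := by
          simp only [map_add, mul_add, smul_add]
          abel
      _ = _ := by
          rw [hf (by simp [cartanOp_apply, eulerOp_apply, sum_add_distrib, sum_smul, sum_div]),
            hg (by simp [cartanOp_apply, eulerOp_apply, sum_add_distrib, sum_smul, sum_div])]
          simp only [map_add, smul_add]
          abel
  | monomial c r =>
    rw [euler_apply, X_mul_pderiv_monomial, smul_monomial, ← map_add, lift_monomial, lift_monomial,
      X_mul_pderiv_monomial, smul_monomial, ← map_add, smul_monomial]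
    congr 1
    simp only [liftExp_apply, smul_eq_mul, liftPar]
    push_cast
    ring

theorem casimir_lift (A : Finset (Fin n)) (f : MvPolynomial (Fin n) ℝ) :
    casimir μ A (lift ε f) = lift ε (casimirOp (liftPar μ ε) A f) := by
  rw [casimirOp_apply, map_sub, map_sub, ← raising_lift, ← lowering_lift, ← weightOp_lift,
    ← weightOp_lift, casimir, pow_two]
  rfl

theorem dunklFactorial_succ (μ : ℝ) (m : ℕ) :
    dunklFactorial μ (m + 1) = dunklFactorial μ m * ((m + 1 : ℕ) + μ * (1 - (-1) ^ (m + 1))) := by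
  rw [dunklFactorial, prod_Icc_succ_top (by omega)]
  rfl

/-- The Dunkl factorials are the weights of `form`, up to the powers of `2` absorbed in `lift` and
the square norm of `y^ε`. -/
theorem dunklFactorial_lift (μ : ℝ) (e : Fin 2) (c : ℕ) :
    dunklFactorial μ (2 * c + e) =
      4 ^ c * (c.factorial * poch (1 / 2 + μ + ((e : ℕ) : ℝ)) c) * (1 + 2 * μ) ^ (e : ℕ) := by
  induction c with
  | zero =>
    rcases fin_two_cases e with h | h
    · simp [h, dunklFactorial, poch_zero]
    · rw [h, show 2 * 0 + 1 = 0 + 1 by rfl, dunklFactorial_succ]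
      simp [dunklFactorial, poch_zero]
      ring
  | succ c ih =>
    rw [show 2 * (c + 1) + (e : ℕ) = 2 * c + e + 1 + 1 by ring, dunklFactorial_succ,
      dunklFactorial_succ, ih, poch_succ, Nat.factorial_succ]
    rcases fin_two_cases e with h | h
    · rw [h]
      simp only [pow_add, pow_mul]
      push_cast
      norm_num
      ring
    · rw [h]
      simp only [pow_add, pow_mul]
      push_cast
      norm_num
      ring

/-- The square norm of `y^ε` in the Fischer inner product. -/
def parityNorm (μ : Fin n → ℝ) (ε : Fin n → Fin 2) : ℝ := ∏ i, (1 + 2 * μ i) ^ (ε i : ℕ)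

theorem parityNorm_pos (hμ : ∀ i, 0 < μ i) : 0 < parityNorm μ ε :=
  prod_pos fun i _ => pow_pos (by linarith [hμ i]) _

/-- The Fischer inner product in the squared variables. -/
theorem fischer_lift (f g : MvPolynomial (Fin n) ℝ) :
    fischer μ (lift ε f) (lift ε g) = ((parityNorm μ ε * form (liftPar μ ε) f g : ℝ) : ℂ) := by
  induction f using MvPolynomial.induction_on' with
  | add f f' hf hf' =>
    rw [map_add, fischer_add_left, hf, hf', map_add, LinearMap.add_apply]
    push_cast
    ring
  | monomial c r =>
    induction g using MvPolynomial.induction_on' with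
    | add g g' hg hg' =>
      rw [map_add, fischer_add_right, hg, hg', map_add]
      push_cast
      ring
    | monomial d s =>
      rw [lift_monomial, lift_monomial, fischer_monomial_left, form_monomial, coeff_monomial,
        coeff_monomial]
      by_cases h : d = c
      · subst h
        have hp : ∏ i, dunklFactorial (μ i) (liftExp ε d i) =
            4 ^ (∑ i, d i) * formWeight (liftPar μ ε) d * parityNorm μ ε := by
          rw [formWeight, parityNorm, ← prod_pow_eq_pow_sum, ← prod_mul_distrib,
            ← prod_mul_distrib]
          exact prod_congr rfl fun i _ => dunklFactorial_lift _ _ _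
        have h4 : ((1 / 2 : ℂ) ^ ∑ i, d i) * (1 / 2) ^ (∑ i, d i) * 4 ^ (∑ i, d i) = 1 := by
          rw [← mul_pow, ← mul_pow]
          norm_num
        rw [if_pos rfl, if_pos rfl, hp]
        simp only [map_mul, map_pow, Complex.conj_ofReal, map_div₀, map_one, map_ofNat]
        push_cast
        linear_combination (r * s * formWeight (liftPar μ ε) d * parityNorm μ ε : ℂ) * h4
      · rw [if_neg h, if_neg fun h' => h ?_]
        · simp
        · ext i
          have := DFunLike.congr_fun h' i
          simpa using this

theorem reflection_lift (i : Fin n) (f : MvPolynomial (Fin n) ℝ) :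
    reflection i (lift ε f) = ((-1 : ℂ) ^ (ε i : ℕ)) • lift ε f := by
  induction f using MvPolynomial.induction_on' with
  | add f g hf hg => simp only [map_add, hf, hg, smul_add]
  | monomial c r =>
    rw [lift_monomial, reflection_monomial, smul_monomial, liftExp_apply, pow_add, pow_mul]
    norm_num

theorem lift_mem_harmonics {N : ℕ} {f : MvPolynomial (Fin n) ℝ}
    (hf : IsHarmonic (liftPar μ ε) univ N f) :
    lift ε f ∈ harmonics μ (2 * N + ∑ i, (ε i : ℕ)) ε := by
  refine ⟨⟨?_, ?_⟩, ?_⟩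
  · have hdeg : ∀ c ∈ f.support, ∑ i, c i = N := fun c hc => by
      have h := congrArg (coeff c) hf.euler
      rw [eulerOp_apply, coeff_sum, coeff_smul, smul_eq_mul] at h
      simp only [coeff_euler] at h
      rw [← sum_mul] at h
      exact_mod_cast mul_right_cancel₀ (mem_support_iff.mp hc) h
    rw [f.as_sum, map_sum]
    refine Submodule.sum_mem _ fun c hc => ?_
    rw [lift_monomial]
    refine (mem_homogeneousSubmodule _ _).mpr (isHomogeneous_monomial _ ?_)
    rw [Finsupp.degree_eq_sum, ← hdeg c hc, mul_sum, ← sum_add_distrib]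
    rfl
  · change laplacian μ (lift ε f) = 0
    rw [laplacian, LinearMap.sum_apply]
    calc _ = ∑ i, (2 : ℂ) • lift ε (bessel (liftPar μ ε) i f) :=
          sum_congr rfl fun i _ => by rw [pow_two, Module.End.mul_apply, dunkl_dunkl_lift]
      _ = _ := by rw [← smul_sum, ← map_sum, ← lowerOp_apply, hf.lower, map_zero, smul_zero]
  · refine (Submodule.mem_iInf _).mpr fun i => ?_
    rw [LinearMap.mem_ker, LinearMap.sub_apply, sub_eq_zero]
    exact reflection_lift i f

end lift

/-! ### The dimension of the space of harmonics -/

section dimension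

variable {n : ℕ} {μ : Fin n → ℝ}

theorem coeff_dunkl (i : Fin n) (c : Fin n →₀ ℕ) (f : MvPolynomial (Fin n) ℂ) :
    coeff c (dunkl μ i f) = (((c i + 1 : ℕ) + μ i * (1 - (-1) ^ (c i + 1)) : ℝ) : ℂ) *
      coeff (c + Finsupp.single i 1) f := by
  induction f using MvPolynomial.induction_on' with
  | add f g hf hg => rw [map_add, coeff_add, coeff_add, hf, hg, mul_add]
  | monomial d r =>
    rw [dunkl_monomial, coeff_monomial, coeff_monomial]
    by_cases hd : d i = 0
    · have h1 : d ≠ c + Finsupp.single i 1 := fun h => by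
        rw [h] at hd
        simp at hd
      rw [if_neg h1, hd]
      simp
    · obtain ⟨d, rfl⟩ : ∃ e : Fin n →₀ ℕ, d = e + Finsupp.single i 1 :=
        ⟨d - Finsupp.single i 1, (tsub_add_cancel_of_le (by
          rw [Finsupp.single_le_iff]; omega)).symm⟩
      rw [add_tsub_cancel_right]
      by_cases h : d = c
      · subst h
        rw [if_pos rfl, if_pos rfl, Finsupp.add_apply, Finsupp.single_eq_same]
        push_cast
        ring
      · rw [if_neg h, if_neg fun h' => h (add_right_cancel h'), mul_zero]

theorem coeff_reflection (i : Fin n) (c : Fin n →₀ ℕ) (f : MvPolynomial (Fin n) ℂ) :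
    coeff c (reflection i f) = (-1) ^ c i * coeff c f := by
  induction f using MvPolynomial.induction_on' with
  | add f g hf hg => rw [map_add, coeff_add, coeff_add, hf, hg, mul_add]
  | monomial d r =>
    rw [reflection_monomial, coeff_monomial, coeff_monomial]
    split_ifs with h
    · rw [h]
    · rw [mul_zero]

theorem dunkl_factor_pos {m : ℝ} (hm : 0 < m) (k : ℕ) :
    0 < ((k + 1 : ℕ) : ℝ) + m * (1 - (-1) ^ (k + 1)) := by
  rcases neg_one_pow_eq_or ℝ (k + 1) with h | h <;> rw [h] <;> push_cast <;> nlinarith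

variable {p N : ℕ}

instance : Finite (QuantumNumbers p N) := by
  refine Set.Finite.subset (Set.finite_Iic (fun _ : Fin p => N)) fun l hl i => ?_
  exact (single_le_sum (f := l) (fun _ _ => Nat.zero_le _) (mem_univ i)).trans hl

instance : Fintype (QuantumNumbers p N) := Fintype.ofFinite _

/-- The exponents whose coefficients determine a harmonic polynomial: the exponent of the first
variable is as small as possible, the next one is fixed by the degree, and the others are
arbitrary. -/
def freeExp (ε : Fin (p + 2) → Fin 2) (l : QuantumNumbers p N) : Fin (p + 2) →₀ ℕ :=
  liftExp ε (Finsupp.equivFunOnFinite.symm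
    (Fin.cons 0 (Fin.cons (N - ∑ i, l.1 i) l.1 : Fin (p + 1) → ℕ) : Fin (p + 2) → ℕ))

/-- Read as a recursion, `Δ f = 0` expresses every coefficient of `f` by coefficients with a smaller
exponent of the first variable. -/
theorem eq_zero_of_coeff_freeExp {μ : Fin (p + 2) → ℝ} (hμ : ∀ i, 0 < μ i)
    {ε : Fin (p + 2) → Fin 2} {f : MvPolynomial (Fin (p + 2)) ℂ}
    (hf : f ∈ harmonics μ (2 * N + ∑ i, (ε i : ℕ)) ε)
    (h : ∀ l : QuantumNumbers p N, coeff (freeExp ε l) f = 0) : f = 0 := by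
  obtain ⟨⟨hhom, hlap⟩, href⟩ := hf
  have hhom : f.IsHomogeneous (2 * N + ∑ i, (ε i : ℕ)) := (mem_homogeneousSubmodule _ _).mp hhom
  have hlap : laplacian μ f = 0 := hlap
  have hpar : ∀ c i, c i % 2 ≠ (ε i : ℕ) → coeff c f = 0 := by
    intro c i hci
    have h1 := (Submodule.mem_iInf _).mp href i
    rw [LinearMap.mem_ker, LinearMap.sub_apply, sub_eq_zero] at h1
    have h2 : reflection i f = ((-1 : ℂ) ^ (ε i : ℕ)) • f := h1
    have h3 := congrArg (coeff c) h2
    rw [coeff_reflection, coeff_smul, smul_eq_mul] at h3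
    have h4 : (-1 : ℂ) ^ c i = (-1) ^ (c i % 2) := by
      conv_lhs => rw [← Nat.mod_add_div (c i) 2, pow_add, pow_mul]
      norm_num
    rw [h4] at h3
    have h5 := Nat.mod_lt (c i) (by norm_num : 0 < 2)
    rcases fin_two_cases (ε i) with he | he
    · have : c i % 2 = 1 := by omega
      rw [this, he] at h3
      linear_combination (-1 / 2) * h3
    · have : c i % 2 = 0 := by omega
      rw [this, he] at h3
      linear_combination (1 / 2) * h3
  have key : ∀ m, ∀ c : Fin (p + 2) →₀ ℕ, c 0 = m → coeff c f = 0 := by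
    intro m
    induction m using Nat.strong_induction_on with
    | _ m ih =>
      intro c hc
      by_cases hp : ∃ i, c i % 2 ≠ (ε i : ℕ)
      · obtain ⟨i, hi⟩ := hp
        exact hpar c i hi
      push Not at hp
      obtain ⟨d, rfl⟩ : ∃ d : Fin (p + 2) →₀ ℕ, c = liftExp ε d :=
        ⟨Finsupp.equivFunOnFinite.symm fun i => c i / 2, by
          ext i
          have := hp i
          rw [liftExp_apply, Finsupp.equivFunOnFinite_symm_apply_apply]
          omega⟩
      by_cases hd : ∑ i, d i = N
      · rcases Nat.eq_zero_or_pos (d 0) with h0 | h0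
        · have hs : ∑ i : Fin p, d i.succ.succ ≤ N := by
            rw [← hd, Fin.sum_univ_succ, Fin.sum_univ_succ]
            omega
          have he : liftExp ε d = freeExp ε ⟨fun i => d i.succ.succ, hs⟩ := by
            rw [freeExp]
            congr 1
            ext i
            rw [Finsupp.equivFunOnFinite_symm_apply_apply]
            refine Fin.cases ?_ (fun i => ?_) i
            · exact h0
            · refine Fin.cases ?_ (fun i => ?_) i
              · rw [Fin.sum_univ_succ, Fin.sum_univ_succ] at hd
                simp only [Fin.cons_succ, Fin.cons_zero]
                omega
              · simp
          rw [he]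
          exact h _
        · obtain ⟨d, rfl⟩ : ∃ e : Fin (p + 2) →₀ ℕ, d = e + Finsupp.single 0 1 :=
            ⟨d - Finsupp.single 0 1, (tsub_add_cancel_of_le (by
              rw [Finsupp.single_le_iff]; omega)).symm⟩
          have hsum := congrArg (coeff (liftExp ε d)) hlap
          rw [laplacian, LinearMap.sum_apply, coeff_sum, coeff_zero, sum_eq_single 0] at hsum
          · rw [pow_two, Module.End.mul_apply, coeff_dunkl, coeff_dunkl, add_assoc,
              ← Finsupp.single_add] at hsum
            rw [liftExp_add_single]
            have n1 := dunkl_factor_pos (hμ 0) (liftExp ε d 0)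
            have n2 := dunkl_factor_pos (hμ 0) ((liftExp ε d + Finsupp.single 0 1 :
              Fin (p + 2) →₀ ℕ) 0)
            refine (mul_eq_zero.mp ((mul_eq_zero.mp hsum).resolve_left ?_)).resolve_left ?_
            · exact_mod_cast n1.ne'
            · exact_mod_cast n2.ne'
          · intro i _ hi
            rw [pow_two, Module.End.mul_apply, coeff_dunkl, coeff_dunkl, add_assoc,
              ← Finsupp.single_add]
            rw [ih (liftExp ε d 0) ?_ (liftExp ε d + Finsupp.single i (1 + 1)) ?_]
            · simp
            · rw [← hc, liftExp_add_single]
              simp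
            · simp [Finsupp.single_eq_of_ne (Ne.symm hi)]
          · intro h0
            exact absurd (mem_univ _) h0
      · refine hhom.coeff_eq_zero fun hdeg => hd ?_
        rw [Finsupp.degree_eq_sum] at hdeg
        simp only [liftExp_apply, sum_add_distrib, ← mul_sum] at hdeg
        omega
  ext c
  rw [key _ c rfl, coeff_zero]

/-- The coefficients that determine a harmonic polynomial, as a linear map. -/
def freeCoeff (μ : Fin (p + 2) → ℝ) (ε : Fin (p + 2) → Fin 2) (N : ℕ) :
    harmonics μ (2 * N + ∑ i, (ε i : ℕ)) ε →ₗ[ℂ] (QuantumNumbers p N → ℂ) :=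
  LinearMap.pi fun l => lcoeff ℂ (freeExp ε l) ∘ₗ Submodule.subtype _

theorem freeCoeff_injective {μ : Fin (p + 2) → ℝ} (hμ : ∀ i, 0 < μ i) (ε : Fin (p + 2) → Fin 2)
    (N : ℕ) : Function.Injective (freeCoeff μ ε N) := by
  rw [injective_iff_map_eq_zero]
  intro f hf
  exact Subtype.ext (eq_zero_of_coeff_freeExp hμ f.2 fun l => congrFun hf l)

/-- A linearly independent family of harmonics indexed by quantum numbers is a basis. -/
theorem exists_basis_harmonics {μ : Fin (p + 2) → ℝ} (hμ : ∀ i, 0 < μ i) {ε : Fin (p + 2) → Fin 2}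
    {b : QuantumNumbers p N → harmonics μ (2 * N + ∑ i, (ε i : ℕ)) ε}
    (hb : LinearIndependent ℂ b) :
    ∃ B : Module.Basis (QuantumNumbers p N) ℂ (harmonics μ (2 * N + ∑ i, (ε i : ℕ)) ε),
      ∀ l, B l = b l := by
  have hinj := freeCoeff_injective hμ ε N
  have : FiniteDimensional ℂ (harmonics μ (2 * N + ∑ i, (ε i : ℕ)) ε) :=
    FiniteDimensional.of_injective _ hinj
  have hle := LinearMap.finrank_le_finrank_of_injective hinj
  rw [Module.finrank_fintype_fun_eq_card] at hle
  have heq := le_antisymm hb.fintype_card_le_finrank hle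
  rcases isEmpty_or_nonempty (QuantumNumbers p N) with he | he
  · exact (he.false ⟨0, by simp⟩).elim
  · exact ⟨basisOfLinearIndependentOfCardEqFinrank hb heq, fun l => by simp⟩

end dimension

/-! ### Bases of joint eigenvectors -/

section labelling

variable {W Λ ι : Type*} [AddCommGroup W] [Module ℂ W] {H : Submodule ℂ W} [Fintype Λ]
  (b : Module.Basis Λ ℂ H) {S : Finset ℕ} {T : ℕ → Module.End ℂ W} {e : ℕ → Λ → ℂ}

/-- An eigenvector has components only along basis vectors with the same eigenvalue. -/
theorem repr_mul_eq_of_eigenvector {m : ℕ} (hb : ∀ i, T m (b i) = e m i • (b i : W)) {v : H} {c : ℂ}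
    (hv : T m v = c • (v : W)) (i : Λ) : b.repr v i * (e m i - c) = 0 := by
  have h1 : (v : W) = ∑ i, b.repr v i • (b i : W) := by
    have := congrArg Subtype.val (b.sum_repr v)
    rw [← this]
    simp only [Submodule.coe_sum, Submodule.coe_smul]
  have h2 : ∑ i, (b.repr v i * (e m i - c)) • b i = 0 := by
    apply Subtype.ext
    have h3 : T m v = ∑ i, b.repr v i • e m i • (b i : W) := by
      conv_lhs => rw [h1]
      simp only [map_sum, map_smul, hb]
    have h4 : c • (v : W) = ∑ i, c • b.repr v i • (b i : W) := by
      rw [← smul_sum, ← h1]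
    rw [h3, h4, ← sub_eq_zero, ← sum_sub_distrib] at hv
    simp only [Submodule.coe_sum, Submodule.coe_smul, Submodule.coe_zero]
    rw [← hv]
    refine sum_congr rfl fun i _ => ?_
    rw [smul_smul, smul_smul, ← sub_smul]
    congr 1
    ring
  exact Fintype.linearIndependent_iff.mp b.linearIndependent _ h2 i

/-- Joint eigenvectors with separating eigenvalues are unique up to a scalar. -/
theorem eq_smul_of_joint_eigenvector (hb : ∀ m ∈ S, ∀ i, T m (b i) = e m i • (b i : W))
    (hsep : ∀ i j, (∀ m ∈ S, e m i = e m j) → i = j) {v : H} {i : Λ}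
    (hv : ∀ m ∈ S, T m v = e m i • (v : W)) : v = b.repr v i • b i := by
  conv_lhs => rw [← b.sum_repr v]
  refine sum_eq_single i (fun j _ hj => ?_) fun h => absurd (mem_univ i) h
  by_contra hne
  have hr : b.repr v j ≠ 0 := fun h => hne (by rw [h, zero_smul])
  exact hj (hsep j i fun m hm => sub_eq_zero.mp
    ((mul_eq_zero.mp (repr_mul_eq_of_eigenvector b (hb m hm) (hv m hm) j)).resolve_left hr))

/-- A basis of joint eigenvectors is indexed in exactly one way by the joint eigenvalues of a given
basis, if these separate its members. -/
theorem existsUnique_labelling (hb : ∀ m ∈ S, ∀ i, T m (b i) = e m i • (b i : W))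
    (hsep : ∀ i j, (∀ m ∈ S, e m i = e m j) → i = j) (ψ : Module.Basis ι ℂ H)
    (hψ : ∀ m ∈ S, ∀ i, ∃ c : ℂ, T m (ψ i) = c • (ψ i : W)) :
    ∃! l : ι ≃ Λ, ∀ m ∈ S, ∀ i, T m (ψ i) = e m (l i) • (ψ i : W) := by
  have hne : ∀ i, (ψ i : W) ≠ 0 := fun i h => ψ.ne_zero i (Subtype.ext h)
  have hex : ∀ i, ∃ j, ∀ m ∈ S, T m (ψ i) = e m j • (ψ i : W) := by
    intro i
    obtain ⟨j, hj⟩ : ∃ j, b.repr (ψ i) j ≠ 0 := by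
      by_contra! h
      exact ψ.ne_zero i (b.repr.map_eq_zero_iff.mp (Finsupp.ext h))
    refine ⟨j, fun m hm => ?_⟩
    obtain ⟨c, hc⟩ := hψ m hm i
    have := (mul_eq_zero.mp (repr_mul_eq_of_eigenvector b (hb m hm) hc j)).resolve_left hj
    rw [hc, sub_eq_zero.mp this]
  choose l hl using hex
  have hinj : Function.Injective l := by
    intro i j hij
    obtain ⟨s, hs⟩ : ∃ s : ℂ, ψ i = s • b (l i) :=
      ⟨_, eq_smul_of_joint_eigenvector b hb hsep (hl i)⟩
    obtain ⟨t, ht⟩ : ∃ t : ℂ, ψ j = t • b (l i) :=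
      ⟨_, hij ▸ eq_smul_of_joint_eigenvector b hb hsep (hl j)⟩
    have h1 : s • ψ j = t • ψ i := by rw [hs, ht, smul_comm]
    by_contra hne'
    have h2 := congrArg (fun v => ψ.repr v j) h1
    have hs0 : s = 0 := by simpa [Finsupp.single_eq_of_ne (Ne.symm hne')] using h2
    rw [hs0, zero_smul] at hs
    exact ψ.ne_zero i hs
  have hbij : Function.Bijective l := by
    have : Fintype ι := Fintype.ofInjective l hinj
    rw [Fintype.bijective_iff_injective_and_card]
    exact ⟨hinj, by rw [← Module.finrank_eq_card_basis ψ, Module.finrank_eq_card_basis b]⟩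
  refine ⟨Equiv.ofBijective l hbij, fun m hm i => hl i m hm, fun l' hl' => Equiv.ext fun i => ?_⟩
  refine hsep _ _ fun m hm => ?_
  have h := (hl' m hm i).symm.trans (hl i m hm)
  exact smul_left_injective ℂ (hne i) h

end labelling

/-! ### Gamma function identities for the weights -/

section weights

variable {p : ℕ} {β : ℕ → ℝ} {x K : ℕ → ℕ}

theorem half_lt_beta_sub (hβ : ∀ j ≤ p, 1 / 2 < β (j + 1) - β j) {j : ℕ} (hj : j ≤ p) :
    1 / 2 < β (j + 1) - β 0 := by
  induction j with
  | zero => exact hβ 0 (by omega)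
  | succ j ih => linarith [ih (by omega), hβ (j + 1) hj]

theorem one_lt_beta_sub (hβ : ∀ j ≤ p, 1 / 2 < β (j + 1) - β j) {j : ℕ} (hj : j < p) :
    1 < β (j + 2) - β 0 := by
  linarith [half_lt_beta_sub hβ hj.le, hβ (j + 1) hj]

theorem beta_pos (h0 : 1 / 2 < β 0 + 1) (hβ : ∀ j ≤ p, 1 / 2 < β (j + 1) - β j) {j : ℕ}
    (hj : j ≤ p) : 0 < β (j + 1) := by
  linarith [half_lt_beta_sub hβ hj]

/-- The factor of `omega` with index `j`. -/
def omegaFactor (β : ℕ → ℝ) (x : ℕ → ℕ) (j : ℕ) : ℝ :=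
  Real.Gamma (β (j + 1) + x (j + 1) + x j) * Real.Gamma (β (j + 1) - β j + x (j + 1) - x j) /
    (Real.Gamma (β j + x (j + 1) + 1 + x j) * Real.Gamma ((x (j + 1) : ℝ) - x j + 1))

/-- The factor with index `j` of the coefficient of `rightVec` in `leftVec` that depends on `x`. -/
def leftDenominator (β : ℕ → ℝ) (x : ℕ → ℕ) (j : ℕ) : ℝ :=
  (x (j + 1) - x j).factorial * poch (β j + 1 + 2 * x j) (x (j + 1) - x j)

/-- One factor of `coefficient_sq` in terms of a factor of `omega`, up to a Gamma quotient that
telescopes by `prod_Gamma_div_Gamma`. -/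
theorem inv_leftDenominator_sq (h0 : 1 / 2 < β 0 + 1) (hβ : ∀ j ≤ p, 1 / 2 < β (j + 1) - β j)
    (hx : Monotone x) {j : ℕ} (hj : j ≤ p) :
    (1 / leftDenominator β x j) ^ 2 = jacNorm (β j + 1 + 2 * x j) (β (j + 1) - β j)
      (x (j + 1) - x j) * omegaFactor β x j * (Real.Gamma (β j + 1 + 2 * x j) /
        Real.Gamma (β (j + 1) + 2 * x (j + 1)) * (1 / Real.Gamma (β (j + 1) - β j))) := by
  obtain ⟨d, hd⟩ := Nat.exists_eq_add_of_le (hx (Nat.le_succ j))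
  have hd : x (j + 1) = x j + d := hd
  have hj1 : 0 < β j + 1 := by
    rcases j with _ | j
    · linarith
    · linarith [beta_pos h0 hβ (show j ≤ p by omega)]
  have hβj := beta_pos h0 hβ hj
  have ha : 0 < β (j + 1) - β j := by linarith [hβ j hj]
  have g1 := Gamma_add_natCast (show 0 < β j + 1 + 2 * (x j : ℝ) by positivity) d
  have g2 := Gamma_add_natCast ha d
  have g3 := Gamma_add_natCast (show 0 < β (j + 1) + 2 * (x j : ℝ) + d by positivity) d
  have n1 := poch_ne_zero (show 0 < β j + 1 + 2 * (x j : ℝ) by positivity) d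
  have n2 := poch_ne_zero ha d
  have n3 := poch_ne_zero (show 0 < β (j + 1) + 2 * (x j : ℝ) + d by positivity) d
  have m1 := (Real.Gamma_pos_of_pos (show 0 < β j + 1 + 2 * (x j : ℝ) by positivity)).ne'
  have m2 := (Real.Gamma_pos_of_pos ha).ne'
  have m3 := (Real.Gamma_pos_of_pos
    (show 0 < β (j + 1) + 2 * (x j : ℝ) + d by positivity)).ne'
  rw [leftDenominator, jacNorm, omegaFactor, hd, Nat.add_sub_cancel_left]
  push_cast
  rw [show β (j + 1) + (x j + (d : ℝ)) + x j = β (j + 1) + 2 * x j + d by ring,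
    show β (j + 1) - β j + (x j + (d : ℝ)) - x j = β (j + 1) - β j + d by ring,
    show β j + (x j + (d : ℝ)) + 1 + x j = β j + 1 + 2 * x j + d by ring,
    show (x j : ℝ) + d - x j + 1 = d + 1 by ring, Real.Gamma_nat_eq_factorial,
    show β (j + 1) + 2 * (x j + (d : ℝ)) = β (j + 1) + 2 * x j + d + d by ring,
    show β j + 1 + 2 * (x j : ℝ) + (β (j + 1) - β j) + d - 1 = β (j + 1) + 2 * x j + d by ring,
    g1, g2, g3]
  field_simp

/-- A telescoping product; each step leaves over a factor `β j + 2 * x j` by the functional equation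
of the Gamma function. -/
theorem prod_Gamma_div_Gamma (h0 : 1 / 2 < β 0 + 1) (hβ : ∀ j ≤ p, 1 / 2 < β (j + 1) - β j) {m : ℕ}
    (hm : m ≤ p) :
    ∏ j ∈ range (m + 1), (Real.Gamma (β j + 1 + 2 * x j) /
      Real.Gamma (β (j + 1) + 2 * x (j + 1))) = Real.Gamma (β 0 + 1 + 2 * x 0) /
        Real.Gamma (β (m + 1) + 2 * x (m + 1)) * ∏ j ∈ Icc 1 m, (β j + 2 * x j) := by
  induction m with
  | zero => simp
  | succ m ih =>
    have hp : 0 < β (m + 1) + 2 * (x (m + 1) : ℝ) := by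
      have := beta_pos h0 hβ (show m ≤ p by omega)
      positivity
    rw [prod_range_succ, ih (by omega), prod_Icc_succ_top (by omega),
      show β (m + 1) + 1 + 2 * (x (m + 1) : ℝ) = β (m + 1) + 2 * x (m + 1) + 1 by ring,
      Real.Gamma_add_one hp.ne']
    have m1 := (Real.Gamma_pos_of_pos hp).ne'
    field_simp

theorem prod_inv_leftDenominator_sq (h0 : 1 / 2 < β 0 + 1)
    (hβ : ∀ j ≤ p, 1 / 2 < β (j + 1) - β j) (hx : Monotone x) (hx0 : x 0 = 0) :
    (∏ j ∈ range (p + 1), (1 / leftDenominator β x j)) ^ 2 =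
      (∏ j ∈ range (p + 1), jacNorm (β j + 1 + 2 * x j) (β (j + 1) - β j) (x (j + 1) - x j)) *
      ((∏ j ∈ range (p + 1), omegaFactor β x j) * ∏ j ∈ Icc 1 p, (β j + 2 * x j)) *
      (Real.Gamma (β 0 + 1) / (Real.Gamma (β (p + 1) + 2 * x (p + 1)) *
        ∏ j ∈ range (p + 1), Real.Gamma (β (j + 1) - β j))) := by
  rw [← prod_pow, prod_congr rfl fun j hj => inv_leftDenominator_sq h0 hβ hx
    (Nat.lt_succ_iff.mp (mem_range.mp hj)), prod_mul_distrib, prod_mul_distrib, prod_mul_distrib,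
    prod_Gamma_div_Gamma h0 hβ le_rfl, hx0]
  simp only [one_div, prod_inv_distrib, Nat.cast_zero, mul_zero, add_zero]
  ring

/-- The factor of `dualWeight` with index `j`. -/
def dualFactor (β : ℕ → ℝ) (K : ℕ → ℕ) (j : ℕ) : ℝ :=
  Real.Gamma (2 * K j + (K (j + 1) - K j : ℕ) + β (j + 2) - β 0 - 1) *
    (2 * K (j + 1) + β (j + 2) - β 0 - 1) /
    (Real.Gamma ((K (j + 1) - K j : ℕ) + β (j + 2) - β (j + 1)) *
      Real.Gamma (2 * K j + (K (j + 1) - K j : ℕ) + β (j + 1) - β 0) *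
        (K (j + 1) - K j).factorial)

/-- The last factor of `dualWeight`. -/
def dualLast (β : ℕ → ℝ) (p N k : ℕ) : ℝ :=
  Real.Gamma (β 0 + N + 1 - k) * (N - k).factorial /
    (Real.Gamma (β (p + 1) - β 0 + N + k) * Real.Gamma (β (p + 1) + N + k))

/-- The factor with index `j` of the coefficient of `rightVec` in `leftVec` that depends on `K`. -/
def rightDenominator (β : ℕ → ℝ) (K : ℕ → ℕ) (j : ℕ) : ℝ :=
  poch (β (j + 2) - β 0 + 2 * K j + (K (j + 1) - K j : ℕ) - 1) (K (j + 1) - K j)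

/-- One factor of `coefficient_sq` in terms of a factor of `dualWeight`, up to a Gamma quotient that
telescopes by `prod_Gamma_shift_div_Gamma`. -/
theorem inv_rightDenominator_sq (hβ : ∀ j ≤ p, 1 / 2 < β (j + 1) - β j) (hK : Monotone K) {j : ℕ}
    (hj : j < p) :
    (1 / rightDenominator β K j) ^ 2 * jacNorm (β (j + 1) - β 0 + 2 * K j) (β (j + 2) - β (j + 1))
      (K (j + 1) - K j) = dualFactor β K j * (Real.Gamma (β (j + 1) - β 0 + 2 * K j) /
        Real.Gamma (β (j + 2) - β 0 + 2 * K (j + 1)) * Real.Gamma (β (j + 2) - β (j + 1))) := by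
  obtain ⟨k, hk⟩ := Nat.exists_eq_add_of_le (hK (Nat.le_succ j))
  have hk : K (j + 1) = K j + k := hk
  have h1 := half_lt_beta_sub hβ hj.le
  have h2 := one_lt_beta_sub hβ hj
  have hc : 0 < β (j + 2) - β (j + 1) := by linarith [hβ (j + 1) hj]
  have hK0 : (0 : ℝ) ≤ K j := by positivity
  have hk0 : (0 : ℝ) ≤ k := by positivity
  have hν : 0 < β (j + 1) - β 0 + 2 * (K j : ℝ) := by linarith
  have hb : 0 < β (j + 2) - β 0 + 2 * (K j : ℝ) + k - 1 := by linarith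
  have hb' : 0 < β (j + 2) - β 0 + 2 * (K j : ℝ) + k - 1 + k := by linarith
  have g1 := Gamma_add_natCast hν k
  have g2 := Gamma_add_natCast hc k
  have g3 := Gamma_add_natCast hb k
  have n1 := poch_ne_zero hν k
  have n2 := poch_ne_zero hc k
  have n3 := poch_ne_zero hb k
  have m1 := (Real.Gamma_pos_of_pos hν).ne'
  have m2 := (Real.Gamma_pos_of_pos hc).ne'
  have m3 := (Real.Gamma_pos_of_pos hb).ne'
  have g4 := Real.Gamma_add_one hb'.ne'
  rw [rightDenominator, jacNorm, dualFactor, hk, Nat.add_sub_cancel_left]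
  push_cast
  rw [show 2 * (K j : ℝ) + k + β (j + 2) - β 0 - 1 = β (j + 2) - β 0 + 2 * K j + k - 1 by ring,
    show (k : ℝ) + β (j + 2) - β (j + 1) = β (j + 2) - β (j + 1) + k by ring,
    show 2 * (K j : ℝ) + k + β (j + 1) - β 0 = β (j + 1) - β 0 + 2 * K j + k by ring,
    show β (j + 2) - β 0 + 2 * (K j + (k : ℝ)) = β (j + 2) - β 0 + 2 * K j + k - 1 + k + 1 by ring,
    show β (j + 1) - β 0 + 2 * (K j : ℝ) + (β (j + 2) - β (j + 1)) + k - 1 =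
      β (j + 2) - β 0 + 2 * K j + k - 1 by ring,
    show 2 * ((K j : ℝ) + k) + β (j + 2) - β 0 - 1 = β (j + 2) - β 0 + 2 * K j + k - 1 + k by ring,
    g4, g1, g2, g3]
  have m4 := hb'.ne'
  field_simp

theorem prod_Gamma_shift_div_Gamma (hβ : ∀ j ≤ p, 1 / 2 < β (j + 1) - β j) {m : ℕ} (hm : m ≤ p) :
    ∏ j ∈ range m, (Real.Gamma (β (j + 1) - β 0 + 2 * K j) /
      Real.Gamma (β (j + 2) - β 0 + 2 * K (j + 1))) = Real.Gamma (β 1 - β 0 + 2 * K 0) /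
        Real.Gamma (β (m + 1) - β 0 + 2 * K m) := by
  have hpos : ∀ j ≤ p, Real.Gamma (β (j + 1) - β 0 + 2 * K j) ≠ 0 := fun j hj =>
    (Real.Gamma_pos_of_pos (by
      have := half_lt_beta_sub hβ hj
      have : (0 : ℝ) ≤ K j := by positivity
      linarith)).ne'
  induction m with
  | zero => rw [range_zero, prod_empty, div_self (hpos 0 hm)]
  | succ m ih =>
    rw [prod_range_succ, ih (by omega), div_mul_div_cancel₀ (hpos m (by omega))]

/-- The contribution of the coupling of the first variable to all others. -/
theorem poch_sq_mul_jacNorm_eq_dualLast (h0 : 1 / 2 < β 0 + 1) (hβ : ∀ j ≤ p, 1 / 2 < β (j + 1) - β j) {N k : ℕ}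
    (hk : k ≤ N) :
    (poch (β 0 + 1) (N - k) * (N - k).factorial) ^ 2 *
      jacNorm (β 0 + 1) (β (p + 1) - β 0 + 2 * k) (N - k) = dualLast β p N k *
        (Real.Gamma (β (p + 1) + 2 * N) * Real.Gamma (β (p + 1) - β 0 + 2 * k) /
          Real.Gamma (β 0 + 1)) := by
  obtain ⟨m, rfl⟩ := Nat.exists_eq_add_of_le hk
  have h1 := half_lt_beta_sub hβ le_rfl
  have h2 := beta_pos h0 hβ le_rfl
  have hk0 : (0 : ℝ) ≤ k := by positivity
  have ha : 0 < β 0 + 1 := by linarith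
  have hν : 0 < β (p + 1) - β 0 + 2 * (k : ℝ) := by linarith
  have hb : 0 < β (p + 1) + 2 * (k : ℝ) + m := by positivity
  have g1 := Gamma_add_natCast ha m
  have g2 := Gamma_add_natCast hν m
  have g3 := Gamma_add_natCast hb m
  have n1 := poch_ne_zero ha m
  have n2 := poch_ne_zero hν m
  have n3 := poch_ne_zero hb m
  have m1 := (Real.Gamma_pos_of_pos ha).ne'
  have m2 := (Real.Gamma_pos_of_pos hν).ne'
  have m3 := (Real.Gamma_pos_of_pos hb).ne'
  rw [jacNorm, dualLast, Nat.add_sub_cancel_left]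
  push_cast
  rw [show β 0 + 1 + (β (p + 1) - β 0 + 2 * (k : ℝ)) + m - 1 = β (p + 1) + 2 * k + m by ring,
    show β 0 + ((k : ℝ) + m) + 1 - k = β 0 + 1 + m by ring,
    show β (p + 1) - β 0 + ((k : ℝ) + m) + k = β (p + 1) - β 0 + 2 * k + m by ring,
    show β (p + 1) + ((k : ℝ) + m) + k = β (p + 1) + 2 * k + m by ring,
    show β (p + 1) + 2 * ((k : ℝ) + m) = β (p + 1) + 2 * k + m + m by ring, g1, g2, g3]
  field_simp

theorem prod_inv_rightDenominator_sq (h0 : 1 / 2 < β 0 + 1)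
    (hβ : ∀ j ≤ p, 1 / 2 < β (j + 1) - β j) (hK : Monotone K) (hK0 : K 0 = 0) {N : ℕ}
    (hN : K p ≤ N) :
    (poch (β 0 + 1) (N - K p) * (N - K p).factorial *
        ∏ j ∈ range p, (1 / rightDenominator β K j)) ^ 2 *
      ((∏ j ∈ range p, jacNorm (β (j + 1) - β 0 + 2 * K j) (β (j + 2) - β (j + 1))
        (K (j + 1) - K j)) * jacNorm (β 0 + 1) (β (p + 1) - β 0 + 2 * K p) (N - K p)) =
      ((∏ j ∈ range p, dualFactor β K j) * dualLast β p N (K p)) *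
      (Real.Gamma (β (p + 1) + 2 * N) *
        (∏ j ∈ range (p + 1), Real.Gamma (β (j + 1) - β j)) / Real.Gamma (β 0 + 1)) := by
  have h1 : (∏ j ∈ range p, (1 / rightDenominator β K j)) ^ 2 *
      (∏ j ∈ range p, jacNorm (β (j + 1) - β 0 + 2 * K j) (β (j + 2) - β (j + 1))
        (K (j + 1) - K j)) = (∏ j ∈ range p, dualFactor β K j) *
          (Real.Gamma (β 1 - β 0) / Real.Gamma (β (p + 1) - β 0 + 2 * K p) *
            ∏ j ∈ range p, Real.Gamma (β (j + 2) - β (j + 1))) := by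
    rw [← prod_pow, ← prod_mul_distrib, prod_congr rfl fun j hj => inv_rightDenominator_sq hβ hK
      (mem_range.mp hj), prod_mul_distrib, prod_mul_distrib, prod_Gamma_shift_div_Gamma hβ le_rfl,
      hK0]
    simp
  have m1 : Real.Gamma (β (p + 1) - β 0 + 2 * K p) ≠ 0 := (Real.Gamma_pos_of_pos (by
      have := half_lt_beta_sub hβ le_rfl
      have : (0 : ℝ) ≤ K p := by positivity
      linarith)).ne'
  have m2 : Real.Gamma (β 0 + 1) ≠ 0 := (Real.Gamma_pos_of_pos (by linarith)).ne'
  calc _ = ((∏ j ∈ range p, (1 / rightDenominator β K j)) ^ 2 *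
      (∏ j ∈ range p, jacNorm (β (j + 1) - β 0 + 2 * K j) (β (j + 2) - β (j + 1))
        (K (j + 1) - K j))) * ((poch (β 0 + 1) (N - K p) * (N - K p).factorial) ^ 2 *
      jacNorm (β 0 + 1) (β (p + 1) - β 0 + 2 * K p) (N - K p)) := by ring
    _ = _ := by
      rw [h1, poch_sq_mul_jacNorm_eq_dualLast h0 hβ hN, prod_range_succ' (fun j => Real.Gamma (β (j + 1) - β j)),
        zero_add]
      field_simp

/-- The part of the connection coefficients left over when the Racah polynomials are removed, in
terms of the weights and the square norms. -/
theorem coefficient_sq (h0 : 1 / 2 < β 0 + 1) (hβ : ∀ j ≤ p, 1 / 2 < β (j + 1) - β j)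
    (hx : Monotone x) (hx0 : x 0 = 0) (hK : Monotone K) (hK0 : K 0 = 0)
    (hN : K p ≤ x (p + 1)) :
    (poch (β 0 + 1) (x (p + 1) - K p) * (x (p + 1) - K p).factorial *
        (∏ j ∈ range p, (1 / rightDenominator β K j)) *
          ∏ j ∈ range (p + 1), (1 / leftDenominator β x j)) ^ 2 *
      ((∏ j ∈ range p, jacNorm (β (j + 1) - β 0 + 2 * K j) (β (j + 2) - β (j + 1))
        (K (j + 1) - K j)) * jacNorm (β 0 + 1) (β (p + 1) - β 0 + 2 * K p) (x (p + 1) - K p)) =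
      (∏ j ∈ range (p + 1), jacNorm (β j + 1 + 2 * x j) (β (j + 1) - β j) (x (j + 1) - x j)) *
      (((∏ j ∈ range (p + 1), omegaFactor β x j) * ∏ j ∈ Icc 1 p, (β j + 2 * x j)) *
        ((∏ j ∈ range p, dualFactor β K j) * dualLast β p (x (p + 1)) (K p))) := by
  have m1 : Real.Gamma (β (p + 1) + 2 * x (p + 1)) ≠ 0 := (Real.Gamma_pos_of_pos (by
      have := beta_pos h0 hβ le_rfl
      positivity)).ne'
  have m2 : Real.Gamma (β 0 + 1) ≠ 0 := (Real.Gamma_pos_of_pos (by linarith)).ne'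
  have m3 : ∏ j ∈ range (p + 1), Real.Gamma (β (j + 1) - β j) ≠ 0 :=
    prod_ne_zero_iff.mpr fun j hj => (Real.Gamma_pos_of_pos (by
      linarith [hβ j (Nat.lt_succ_iff.mp (mem_range.mp hj))])).ne'
  rw [mul_pow, prod_inv_leftDenominator_sq h0 hβ hx hx0, mul_right_comm,
    prod_inv_rightDenominator_sq h0 hβ hK hK0 hN]
  field_simp

theorem omegaFactor_pos (h0 : 1 / 2 < β 0 + 1) (hβ : ∀ j ≤ p, 1 / 2 < β (j + 1) - β j)
    (hx : Monotone x) {j : ℕ} (hj : j ≤ p) : 0 < omegaFactor β x j := by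
  have h1 := beta_pos h0 hβ hj
  have h2 : (x j : ℝ) ≤ x (j + 1) := by exact_mod_cast hx (Nat.le_succ j)
  have h3 := hβ j hj
  have h4 : 0 < β j + 1 := by
    rcases j with _ | j
    · linarith
    · linarith [beta_pos h0 hβ (show j ≤ p by omega)]
  have h5 : (0 : ℝ) ≤ x j := by positivity
  exact div_pos (mul_pos (Real.Gamma_pos_of_pos (by linarith)) (Real.Gamma_pos_of_pos (by linarith)))
    (mul_pos (Real.Gamma_pos_of_pos (by linarith)) (Real.Gamma_pos_of_pos (by linarith)))

theorem dualFactor_pos (hβ : ∀ j ≤ p, 1 / 2 < β (j + 1) - β j) {j : ℕ} (hj : j < p) :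
    0 < dualFactor β K j := by
  have h1 := half_lt_beta_sub hβ hj.le
  have h2 := one_lt_beta_sub hβ hj
  have h3 := hβ (j + 1) hj
  have h4 : (0 : ℝ) ≤ K j := by positivity
  have h5 : (0 : ℝ) ≤ K (j + 1) := by positivity
  have h6 : (0 : ℝ) ≤ (K (j + 1) - K j : ℕ) := by positivity
  rw [show j + 1 + 1 = j + 2 by omega] at h3
  exact div_pos (mul_pos (Real.Gamma_pos_of_pos (by linarith)) (by linarith))
    (mul_pos (mul_pos (Real.Gamma_pos_of_pos (by linarith)) (Real.Gamma_pos_of_pos (by linarith)))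
      (by positivity))

theorem dualLast_pos (h0 : 1 / 2 < β 0 + 1) (hβ : ∀ j ≤ p, 1 / 2 < β (j + 1) - β j) {N k : ℕ}
    (hk : k ≤ N) : 0 < dualLast β p N k := by
  have h1 := half_lt_beta_sub hβ le_rfl
  have h2 := beta_pos h0 hβ le_rfl
  have h3 : (k : ℝ) ≤ N := by exact_mod_cast hk
  have h4 : (0 : ℝ) ≤ k := by positivity
  exact div_pos (mul_pos (Real.Gamma_pos_of_pos (by linarith)) (by positivity))
    (mul_pos (Real.Gamma_pos_of_pos (by linarith)) (Real.Gamma_pos_of_pos (by linarith)))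

end weights

/-! ### Partial sums of quantum numbers -/

section quantum

variable {p N : ℕ}

theorem partialSum_zero (l : Fin p → ℕ) : partialSum l 0 = 0 := by
  rw [partialSum, sum_eq_zero]
  intro i hi
  exact absurd (mem_initialSet.mp hi) (by omega)

theorem partialSum_succ (l : Fin p → ℕ) {j : ℕ} (hj : j < p) :
    partialSum l (j + 1) = partialSum l j + l ⟨j, hj⟩ := by
  have h : initialSet p (j + 1) = insert ⟨j, hj⟩ (initialSet p j) := by
    ext i
    rw [mem_insert, mem_initialSet, mem_initialSet, Fin.ext_iff]
    simp only
    omega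
  rw [partialSum, h, sum_insert (by rw [mem_initialSet]; simp), add_comm]
  rfl

theorem partialSum_mono (l : Fin p → ℕ) : Monotone (partialSum l) := fun _ _ h =>
  sum_le_sum_of_subset (initialSet_subset h)

theorem partialSum_le (l : QuantumNumbers p N) (j : ℕ) : partialSum l.1 j ≤ N :=
  (sum_le_sum_of_subset (subset_univ _)).trans l.2

theorem quantumNumbers_ext {l l' : QuantumNumbers p N}
    (h : ∀ m ∈ Icc 2 (p + 1), partialSum l.1 (m - 1) = partialSum l'.1 (m - 1)) : l = l' := by
  have h' : ∀ j ≤ p, partialSum l.1 j = partialSum l'.1 j := by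
    intro j hj
    rcases j with _ | j
    · rw [partialSum_zero, partialSum_zero]
    · exact h (j + 2) (mem_Icc.mpr ⟨by omega, by omega⟩)
  refine Subtype.ext (funext fun i => ?_)
  have h1 := h' (i + 1) i.2
  rw [partialSum_succ _ i.2, partialSum_succ _ i.2, h' i i.2.le] at h1
  exact add_left_cancel h1

/-- The sequence `x_0 = 0, x_1, …, x_p, x_{p+1} = N` of partial sums of `l`. -/
def gridNat (l : Fin p → ℕ) (N j : ℕ) : ℕ := if j ≤ p then partialSum l j else N

theorem gridNat_of_le (l : Fin p → ℕ) {j : ℕ} (hj : j ≤ p) : gridNat l N j = partialSum l j :=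
  if_pos hj

theorem gridNat_last (l : Fin p → ℕ) : gridNat l N (p + 1) = N := if_neg (by omega)

theorem gridNat_zero (l : Fin p → ℕ) : gridNat l N 0 = 0 := by
  rw [gridNat_of_le l (Nat.zero_le p), partialSum_zero]

theorem gridNat_mono (l : QuantumNumbers p N) : Monotone (gridNat l.1 N) := fun i j h => by
  unfold gridNat
  split_ifs with h1 h2 h2
  · exact partialSum_mono _ h
  · exact partialSum_le l i
  · omega
  · exact le_rfl

theorem extend_gridPoint (l : Fin p → ℕ) {j : ℕ} (hj : j ≤ p + 1) :
    extend (gridPoint l) N j = gridNat l N j := by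
  rcases j with _ | j
  · rw [gridNat_zero]
    simp [extend]
  · by_cases h : j < p
    · rw [extend, dif_pos h, gridNat_of_le l h, gridPoint]
    · rw [extend, dif_neg h, gridNat, if_neg (by omega)]

theorem omega_eq (l : Fin p → ℕ) (β : ℕ → ℝ) :
    omega (gridPoint l) β N = (∏ j ∈ range (p + 1), omegaFactor β (gridNat l N) j) *
      ∏ j ∈ Icc 1 p, (β j + 2 * gridNat l N j) := by
  rw [omega]
  congr 1
  · refine prod_congr rfl fun j hj => ?_
    have hj := mem_range.mp hj
    rw [extend_gridPoint l (by omega), extend_gridPoint l (by omega), omegaFactor]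
  · refine prod_congr rfl fun j hj => ?_
    have hj := mem_Icc.mp hj
    rw [extend_gridPoint l (by omega)]

theorem partialSum_succ_sub (k : Fin p → ℕ) (j : Fin p) :
    partialSum k (j + 1) - partialSum k j = k j := by
  rw [partialSum_succ k j.2, Nat.add_sub_cancel_left]

theorem dualWeight_eq (k : Fin p → ℕ) (β : ℕ → ℝ) :
    dualWeight k β N = (∏ j ∈ range p, dualFactor β (partialSum k) j) *
      dualLast β p N (partialSum k p) := by
  rw [dualWeight, ← Fin.prod_univ_eq_prod_range, dualLast]
  congr 1
  refine prod_congr rfl fun j _ => ?_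
  rw [dualFactor, partialSum_succ_sub]

/-- The factor of `multiRacah` with index `j`. -/
def racahFactor (β : ℕ → ℝ) (x K : ℕ → ℕ) (j : ℕ) : ℝ :=
  racah (K (j + 1) - K j) (2 * K j + β (j + 1) - β 0 - 1) (β (j + 2) - β (j + 1) - 1)
    (K j - x (j + 2) - 1) (K j + β (j + 1) + x (j + 2)) (-K j + x (j + 1))

theorem multiRacah_eq (k l : Fin p → ℕ) (β : ℕ → ℝ) :
    multiRacah k (gridPoint l) β N =
      ∏ j ∈ range p, racahFactor β (gridNat l N) (partialSum k) j := by
  rw [multiRacah, ← Fin.prod_univ_eq_prod_range]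
  refine prod_congr rfl fun j _ => ?_
  rw [racahFactor, partialSum_succ_sub, extend_gridPoint l (by omega), extend_gridPoint l (by omega)]

end quantum

/-! ### The connection coefficients -/

section overlap

variable {p : ℕ} {μ : Fin (p + 2) → ℝ} {ε : Fin (p + 2) → Fin 2} {x K : ℕ → ℕ}

theorem half_lt_liftPar (hμ : ∀ i, 0 < μ i) (i : Fin (p + 2)) : 1 / 2 < liftPar μ ε i := by
  have : (0 : ℝ) ≤ ((ε i : ℕ) : ℝ) := by positivity
  rw [liftPar]
  linarith [hμ i]

theorem sum_initialSet_liftPar (j : ℕ) :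
    ∑ i ∈ initialSet (p + 2) (j + 1), liftPar μ ε i = betaPar μ ε j + 1 := by
  rw [betaPar, sub_add_cancel]
  rfl

theorem liftPar_idx_zero : liftPar μ ε (idx p 0) = betaPar μ ε 0 + 1 := by
  rw [← sum_initialSet_liftPar, zero_add, initialSet_one, sum_singleton]

theorem liftPar_idx_succ {j : ℕ} (hj : j ≤ p) :
    liftPar μ ε (idx p (j + 1)) = betaPar μ ε (j + 1) - betaPar μ ε j := by
  have h := sum_initialSet_succ (α := liftPar μ ε) (show j + 1 < p + 2 by omega)
  rw [sum_initialSet_liftPar, sum_initialSet_liftPar] at h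
  linarith

theorem sum_tailSet_liftPar (j : ℕ) :
    ∑ i ∈ tailSet (p + 2) (j + 1), liftPar μ ε i = betaPar μ ε j - betaPar μ ε 0 := by
  have h := sum_initialSet_eq (p := p) (α := liftPar μ ε) (show 1 ≤ j + 1 by omega)
  rw [sum_initialSet_liftPar, liftPar_idx_zero] at h
  linarith

theorem half_lt_betaPar_zero (hμ : ∀ i, 0 < μ i) : 1 / 2 < betaPar μ ε 0 + 1 := by
  rw [← liftPar_idx_zero]
  exact half_lt_liftPar hμ _

theorem half_lt_betaPar_sub (hμ : ∀ i, 0 < μ i) (j : ℕ) (hj : j ≤ p) :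
    1 / 2 < betaPar μ ε (j + 1) - betaPar μ ε j := by
  rw [← liftPar_idx_succ hj]
  exact half_lt_liftPar hμ _

/-- The coefficient of an elementary step as a Racah polynomial with parameters in terms of
`betaPar`; the first quotient on the right telescopes over `j`. -/
theorem stepCoeff_eq {j : ℕ} (hj : j < p) (hx : Monotone x) (hK : Monotone K)
    (h1 : K j ≤ x (j + 1)) (h2 : K (j + 1) ≤ x (j + 2)) :
    stepCoeff (liftPar μ ε) x K j = (-1) ^ (K (j + 1) - K j) *
      ((poch (betaPar μ ε 0 + 1) (x (j + 2) - K (j + 1)) * (x (j + 2) - K (j + 1)).factorial) /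
        (poch (betaPar μ ε 0 + 1) (x (j + 1) - K j) * (x (j + 1) - K j).factorial)) *
      (1 / rightDenominator (betaPar μ ε) K j) * (1 / leftDenominator (betaPar μ ε) x (j + 1)) *
        racahFactor (betaPar μ ε) x K j := by
  have hK' : K j ≤ K (j + 1) := hK (Nat.le_succ j)
  have hx' : x (j + 1) ≤ x (j + 2) := hx (Nat.le_succ (j + 1))
  rw [stepCoeff, recoupling, liftPar_idx_zero, liftPar_idx_succ (show j + 1 ≤ p by omega),
    sum_tailSet_liftPar, racahFactor, rightDenominator, leftDenominator,
    show x (j + 1) - K j + (x (j + 2) - x (j + 1)) = x (j + 2) - K j by omega,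
    show x (j + 2) - K j - (K (j + 1) - K j) = x (j + 2) - K (j + 1) by omega,
    Nat.cast_sub h1, Nat.cast_sub (h1.trans hx')]
  simp only [show j + 1 + 1 = j + 2 from rfl]
  rw [show betaPar μ ε (j + 1) - betaPar μ ε 0 + 2 * (K j : ℝ) +
      (betaPar μ ε (j + 2) - betaPar μ ε (j + 1)) + (K (j + 1) - K j : ℕ) - 1 =
        betaPar μ ε (j + 2) - betaPar μ ε 0 + 2 * K j + (K (j + 1) - K j : ℕ) - 1 by ring,
    show betaPar μ ε 0 + 1 + (betaPar μ ε (j + 1) - betaPar μ ε 0 + 2 * (K j : ℝ)) +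
      2 * (x (j + 1) - K j) = betaPar μ ε (j + 1) + 1 + 2 * x (j + 1) by ring,
    show betaPar μ ε (j + 1) - betaPar μ ε 0 + 2 * (K j : ℝ) - 1 =
      2 * K j + betaPar μ ε (j + 1) - betaPar μ ε 0 - 1 by ring,
    show -((x (j + 2) : ℝ) - K j) - 1 = K j - x (j + 2) - 1 by ring,
    show betaPar μ ε 0 + 1 + (betaPar μ ε (j + 1) - betaPar μ ε 0 + 2 * (K j : ℝ)) - 1 +
      (x (j + 2) - K j) = K j + betaPar μ ε (j + 1) + x (j + 2) by ring,
    show (x (j + 1) : ℝ) - K j = -K j + x (j + 1) by ring]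
  simp only [mul_inv, div_eq_mul_inv]
  ring

theorem prod_range_div_of_ne_zero {f : ℕ → ℝ} (hf : ∀ j, f j ≠ 0) (n : ℕ) :
    ∏ j ∈ range n, f (j + 1) / f j = f n / f 0 := by
  induction n with
  | zero => simp [div_self (hf 0)]
  | succ n ih => rw [prod_range_succ, ih, mul_comm, div_mul_div_cancel₀ (hf n)]

/-- The product of the step coefficients is the multivariate Racah polynomial up to elementary
factors. -/
theorem prod_stepCoeff (hμ : ∀ i, 0 < μ i) (hx : Monotone x) (hK : Monotone K) (hx0 : x 0 = 0)
    (hK0 : K 0 = 0) (h : ∀ j < p, K (j + 1) ≤ x (j + 2)) :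
    ∏ j ∈ range p, stepCoeff (liftPar μ ε) x K j = (-1) ^ K p *
      (poch (betaPar μ ε 0 + 1) (x (p + 1) - K p) * (x (p + 1) - K p).factorial *
        (∏ j ∈ range p, (1 / rightDenominator (betaPar μ ε) K j)) *
          ∏ j ∈ range (p + 1), (1 / leftDenominator (betaPar μ ε) x j)) *
      ∏ j ∈ range p, racahFactor (betaPar μ ε) x K j := by
  have h1 : ∀ j < p, K j ≤ x (j + 1) := by
    intro j hj
    rcases j with _ | j
    · omega
    · exact h j (by omega)
  have hpos : ∀ t : ℕ, poch (betaPar μ ε 0 + 1) t * t.factorial ≠ 0 := fun t =>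
    mul_ne_zero (poch_ne_zero (by linarith [half_lt_betaPar_zero (ε := ε) hμ]) t) (by positivity)
  have hsign : ∏ j ∈ range p, (-1 : ℝ) ^ (K (j + 1) - K j) = (-1) ^ K p := by
    rw [prod_pow_eq_pow_sum, sum_range_tsub hK, hK0, Nat.sub_zero]
  have htel := prod_range_div_of_ne_zero (f := fun j => poch (betaPar μ ε 0 + 1) (x (j + 1) - K j) *
    ((x (j + 1) - K j).factorial : ℝ)) (fun j => hpos _) p
  rw [prod_congr rfl fun j hj => stepCoeff_eq (mem_range.mp hj) hx hK (h1 j (mem_range.mp hj))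
    (h j (mem_range.mp hj)), prod_mul_distrib, prod_mul_distrib, prod_mul_distrib,
    prod_mul_distrib, hsign]
  have e1 : (1 : ℝ) / leftDenominator (betaPar μ ε) x 0 =
      1 / (poch (betaPar μ ε 0 + 1) (x (0 + 1) - K 0) * (x (0 + 1) - K 0).factorial) := by
    rw [leftDenominator, hx0, hK0, Nat.cast_zero, mul_zero, add_zero, mul_comm]
  rw [prod_range_succ' (fun j => 1 / leftDenominator (betaPar μ ε) x j), e1]
  simp only [show ∀ j, j + 1 + 1 = j + 2 from fun _ => rfl] at htel
  rw [htel]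
  ring

/-- The inner product of the two coupled bases, in the model in squared variables. -/
theorem form_rightVec_leftVec (hμ : ∀ i, 0 < μ i) {N : ℕ} (k l : QuantumNumbers p N) :
    0 < omega (gridPoint l.1) (betaPar μ ε) N ∧ 0 < dualWeight k.1 (betaPar μ ε) N ∧
    form (liftPar μ ε) (rightVec (liftPar μ ε) (partialSum k.1) N)
        (leftVec (liftPar μ ε) (gridNat l.1 N)) =
      (-1) ^ partialSum k.1 p *
        (√(form (liftPar μ ε) (rightVec (liftPar μ ε) (partialSum k.1) N)
            (rightVec (liftPar μ ε) (partialSum k.1) N)) *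
          √(form (liftPar μ ε) (leftVec (liftPar μ ε) (gridNat l.1 N))
            (leftVec (liftPar μ ε) (gridNat l.1 N)))) *
        (√(omega (gridPoint l.1) (betaPar μ ε) N * dualWeight k.1 (betaPar μ ε) N) *
          multiRacah k.1 (gridPoint l.1) (betaPar μ ε) N) := by
  have hα := half_lt_liftPar (ε := ε) hμ
  have h0 := half_lt_betaPar_zero (ε := ε) hμ
  have hβ := half_lt_betaPar_sub (ε := ε) hμ
  have hx := gridNat_mono l
  have hx0 := gridNat_zero (N := N) l.1
  have hxl := gridNat_last (N := N) l.1
  have hK := partialSum_mono k.1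
  have hK0 := partialSum_zero k.1
  have hN := partialSum_le k p
  have hω : 0 < omega (gridPoint l.1) (betaPar μ ε) N := by
    rw [omega_eq]
    refine mul_pos (prod_pos fun j hj => omegaFactor_pos h0 hβ hx
      (Nat.lt_succ_iff.mp (mem_range.mp hj))) (prod_pos fun j hj => ?_)
    obtain ⟨hj1, hj2⟩ := mem_Icc.mp hj
    obtain ⟨j, rfl⟩ : ∃ i, j = i + 1 := ⟨j - 1, by omega⟩
    have := beta_pos h0 hβ (show j ≤ p by omega)
    positivity
  have hd : 0 < dualWeight k.1 (betaPar μ ε) N := by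
    rw [dualWeight_eq]
    exact mul_pos (prod_pos fun j hj => dualFactor_pos hβ (mem_range.mp hj))
      (dualLast_pos h0 hβ hN)
  refine ⟨hω, hd, ?_⟩
  rw [multiRacah_eq]
  by_cases h : ∀ j < p, partialSum k.1 (j + 1) ≤ gridNat l.1 N (j + 2)
  · rw [form_rightVec_leftVec_eq_prod hα hx hK hx0 hK0 N le_rfl h, mixedVec_last hxl,
      prod_stepCoeff hμ hx hK hx0 hK0 h]
    have hsq := coefficient_sq h0 hβ hx hx0 hK hK0 (hN.trans_eq hxl.symm)
    set C := poch (betaPar μ ε 0 + 1) (gridNat l.1 N (p + 1) - partialSum k.1 p) *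
      (gridNat l.1 N (p + 1) - partialSum k.1 p).factorial *
        (∏ j ∈ range p, (1 / rightDenominator (betaPar μ ε) (partialSum k.1) j)) *
          ∏ j ∈ range (p + 1), (1 / leftDenominator (betaPar μ ε) (gridNat l.1 N) j) with hC
    have hφ : form (liftPar μ ε) (rightVec (liftPar μ ε) (partialSum k.1) N)
        (rightVec (liftPar μ ε) (partialSum k.1) N) = (∏ j ∈ range p,
          jacNorm (betaPar μ ε (j + 1) - betaPar μ ε 0 + 2 * partialSum k.1 j)
            (betaPar μ ε (j + 2) - betaPar μ ε (j + 1))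
            (partialSum k.1 (j + 1) - partialSum k.1 j)) *
          jacNorm (betaPar μ ε 0 + 1) (betaPar μ ε (p + 1) - betaPar μ ε 0 + 2 * partialSum k.1 p)
            (gridNat l.1 N (p + 1) - partialSum k.1 p) := by
      rw [(isHarmonic_rightVec hα hK hK0 hN).2, hxl, liftPar_idx_zero, sum_tailSet_liftPar]
      congr 1
      refine prod_congr rfl fun j hj => ?_
      have hj := mem_range.mp hj
      rw [sum_tailSet_liftPar, liftPar_idx_succ (show j + 1 ≤ p by omega)]
    have hψ : form (liftPar μ ε) (leftVec (liftPar μ ε) (gridNat l.1 N))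
        (leftVec (liftPar μ ε) (gridNat l.1 N)) = ∏ j ∈ range (p + 1),
          jacNorm (betaPar μ ε j + 1 + 2 * gridNat l.1 N j)
            (betaPar μ ε (j + 1) - betaPar μ ε j) (gridNat l.1 N (j + 1) - gridNat l.1 N j) := by
      rw [form_leftVec_self hα hx hx0]
      refine prod_congr rfl fun j hj => ?_
      rw [sum_initialSet_liftPar, liftPar_idx_succ (Nat.lt_succ_iff.mp (mem_range.mp hj))]
    rw [← hφ, ← hψ, ← omega_eq, hxl, ← dualWeight_eq] at hsq
    have hC0 : 0 ≤ C := by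
      have hb : 0 < betaPar μ ε 0 + 1 := by linarith
      refine mul_nonneg (mul_nonneg (mul_nonneg (poch_pos hb _).le (by positivity))
        (prod_nonneg fun j hj => ?_)) (prod_nonneg fun j hj => ?_)
      · have h1 := one_lt_beta_sub hβ (mem_range.mp hj)
        have h2 : (0 : ℝ) ≤ (partialSum k.1 (j + 1) - partialSum k.1 j : ℕ) := by positivity
        have h3 : (0 : ℝ) ≤ partialSum k.1 j := by positivity
        exact div_nonneg zero_le_one (poch_pos (by linarith) _).le
      · have hj := Nat.lt_succ_iff.mp (mem_range.mp hj)
        have hb' : 0 < betaPar μ ε j + 1 := by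
          rcases j with _ | j
          · exact hb
          · linarith [beta_pos h0 hβ (show j ≤ p by omega)]
        exact div_nonneg zero_le_one (mul_nonneg (by positivity)
          (poch_pos (by positivity) _).le)
    set F := form (liftPar μ ε) (rightVec (liftPar μ ε) (partialSum k.1) N)
        (rightVec (liftPar μ ε) (partialSum k.1) N)
    set G := form (liftPar μ ε) (leftVec (liftPar μ ε) (gridNat l.1 N))
        (leftVec (liftPar μ ε) (gridNat l.1 N))
    have hF0 : 0 ≤ F := by
      rw [hφ]
      refine mul_nonneg (prod_nonneg fun j hj => (jacNorm_pos ?_ ?_ _).le)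
        (jacNorm_pos ?_ ?_ _).le
      · have h1 := half_lt_beta_sub hβ (mem_range.mp hj).le
        have h3 : (0 : ℝ) ≤ partialSum k.1 j := by positivity
        linarith
      · have h1 : 1 / 2 < betaPar μ ε (j + 2) - betaPar μ ε (j + 1) :=
          hβ (j + 1) (mem_range.mp hj)
        linarith
      · linarith
      · have h1 := half_lt_beta_sub hβ le_rfl
        have h3 : (0 : ℝ) ≤ partialSum k.1 p := by positivity
        linarith
    have hG0 : 0 ≤ G := by
      rw [hψ]
      refine prod_nonneg fun j hj => (jacNorm_pos ?_ ?_ _).le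
      · have hj := Nat.lt_succ_iff.mp (mem_range.mp hj)
        have h3 : (0 : ℝ) ≤ gridNat l.1 N j := by positivity
        rcases j with _ | j
        · linarith
        · linarith [beta_pos h0 hβ (show j ≤ p by omega)]
      · linarith [hβ j (Nat.lt_succ_iff.mp (mem_range.mp hj))]
    have key : C * F = √F * √G * √(omega (gridPoint l.1) (betaPar μ ε) N *
        dualWeight k.1 (betaPar μ ε) N) := by
      rw [mul_assoc (√F), ← Real.sqrt_mul hG0, ← hsq, Real.sqrt_mul (sq_nonneg C), Real.sqrt_sq hC0]
      linear_combination -C * Real.mul_self_sqrt hF0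
    linear_combination ((-1) ^ partialSum k.1 p *
      ∏ j ∈ range p, racahFactor (betaPar μ ε) (gridNat l.1 N) (partialSum k.1) j) * key
  · -- at the first violation of the inequalities a Racah polynomial vanishes, and so does the
    -- inner product
    push Not at h
    classical
    obtain ⟨hm, hlt⟩ := Nat.find_spec h
    have hmin : ∀ j < Nat.find h, partialSum k.1 (j + 1) ≤ gridNat l.1 N (j + 2) := by
      intro j hj
      have := Nat.find_min h hj
      push Not at this
      exact this (hj.trans hm)
    set m := Nat.find h
    have hKx : partialSum k.1 m ≤ gridNat l.1 N (m + 1) := by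
      rcases m with _ | m
      · omega
      · exact hmin m (by omega)
    have hx' : gridNat l.1 N (m + 1) ≤ gridNat l.1 N (m + 2) := hx (Nat.le_succ (m + 1))
    have hr : racahFactor (betaPar μ ε) (gridNat l.1 N) (partialSum k.1) m = 0 := by
      have := racah_eq_zero (x := gridNat l.1 N (m + 1) - partialSum k.1 m)
        (n := gridNat l.1 N (m + 2) - partialSum k.1 m)
        (k := partialSum k.1 (m + 1) - partialSum k.1 m) (by omega) (by omega)
        (2 * partialSum k.1 m + betaPar μ ε (m + 1) - betaPar μ ε 0 - 1)
        (betaPar μ ε (m + 2) - betaPar μ ε (m + 1) - 1)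
        (partialSum k.1 m + betaPar μ ε (m + 1) + gridNat l.1 N (m + 2))
      rw [Nat.cast_sub hKx, Nat.cast_sub (hKx.trans hx')] at this
      rw [racahFactor, ← this]
      congr 1 <;> ring
    rw [form_rightVec_leftVec_eq_zero hα hx hK hx0 hK0 N hm hmin hlt,
      prod_eq_zero (mem_range.mpr hm) hr]
    ring

end overlap

/-! ### The two bases in the Dunkl model -/

section bases

theorem fischer_smul_left {n : ℕ} (μ : Fin n → ℝ) (c : ℂ) (f g : MvPolynomial (Fin n) ℂ) :
    fischer μ (c • f) g = (starRingEnd ℂ) c * fischer μ f g := by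
  rw [fischer_eq_sum μ (c • f) g f.support support_smul, fischer, mul_sum]
  refine sum_congr rfl fun d _ => ?_
  rw [coeff_smul, smul_eq_mul, map_mul]
  ring

theorem fischer_smul_right {n : ℕ} (μ : Fin n → ℝ) (c : ℂ) (f g : MvPolynomial (Fin n) ℂ) :
    fischer μ f (c • g) = c * fischer μ f g := by
  rw [fischer, fischer, mul_sum]
  refine sum_congr rfl fun d _ => ?_
  rw [coeff_smul, smul_eq_mul]
  ring

/-- The Fischer inner product as a linear form in its second argument. -/
def fischerRight {n : ℕ} (μ : Fin n → ℝ) (f : MvPolynomial (Fin n) ℂ) :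
    MvPolynomial (Fin n) ℂ →ₗ[ℂ] ℂ where
  toFun := fischer μ f
  map_add' := fischer_add_right μ f
  map_smul' c g := fischer_smul_right μ c f g

variable {p N : ℕ} {μ : Fin (p + 2) → ℝ} {ε : Fin (p + 2) → Fin 2}

/-- An orthogonal family of harmonic polynomials indexed by quantum numbers gives a basis of the
Dunkl harmonics. -/
theorem exists_basis_of_orthogonal (hμ : ∀ i, 0 < μ i)
    {f : QuantumNumbers p N → MvPolynomial (Fin (p + 2)) ℝ}
    (hf : ∀ l, IsHarmonic (liftPar μ ε) univ N (f l))
    (hpos : ∀ l, 0 < form (liftPar μ ε) (f l) (f l))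
    (horth : ∀ l l', l ≠ l' → form (liftPar μ ε) (f l) (f l') = 0) :
    ∃ B : Module.Basis (QuantumNumbers p N) ℂ (harmonics μ (2 * N + ∑ i, (ε i : ℕ)) ε),
      ∀ l, (B l : MvPolynomial (Fin (p + 2)) ℂ) = lift ε (f l) := by
  have hli : LinearIndependent ℂ fun l => (⟨lift ε (f l), lift_mem_harmonics (hf l)⟩ :
      harmonics μ (2 * N + ∑ i, (ε i : ℕ)) ε) := by
    rw [Fintype.linearIndependent_iff]
    intro g hg l
    have h1 : ∑ i, g i • lift ε (f i) = 0 := by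
      have := congrArg Subtype.val hg
      simpa using this
    have h2 := congrArg (fischerRight μ (lift ε (f l))) h1
    rw [map_sum, map_zero, sum_eq_single l] at h2
    · have h3 : g l * fischer μ (lift ε (f l)) (lift ε (f l)) = 0 := by
        rw [← fischer_smul_right]
        exact h2
      rw [fischer_lift] at h3
      refine (mul_eq_zero.mp h3).resolve_right ?_
      exact_mod_cast (mul_pos (parityNorm_pos hμ) (hpos l)).ne'
    · intro l' _ hl'
      change fischer μ _ _ = 0
      rw [fischer_smul_right, fischer_lift, horth l l' hl'.symm]
      simp
    · intro hl
      exact absurd (mem_univ l) hl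
  obtain ⟨B, hB⟩ := exists_basis_harmonics hμ hli
  exact ⟨B, fun l => by rw [hB]⟩

/-- The eigenvalues in `IsFirstLabelling` separate quantum numbers. -/
theorem eq_of_kappa_first (hμ : ∀ i, 0 < μ i) {l l' : QuantumNumbers p N}
    (h : ∀ m ∈ Icc 2 (p + 1), kappa (partialSum l.1 (m - 1)) (betaPar μ ε (m - 1)) =
      kappa (partialSum l'.1 (m - 1)) (betaPar μ ε (m - 1))) : l = l' := by
  refine quantumNumbers_ext fun m hm => kappa_injective_of_pos ?_ (h m hm)
  obtain ⟨h2, h3⟩ := mem_Icc.mp hm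
  obtain ⟨j, rfl⟩ : ∃ j, m = j + 2 := ⟨m - 2, by omega⟩
  exact beta_pos (half_lt_betaPar_zero hμ) (half_lt_betaPar_sub hμ) (show j ≤ p by omega)

/-- The eigenvalues in `IsSecondLabelling` separate quantum numbers. -/
theorem eq_of_kappa_second (hμ : ∀ i, 0 < μ i) {k k' : QuantumNumbers p N}
    (h : ∀ m ∈ Icc 2 (p + 1),
      kappa (partialSum k.1 (m - 1)) (betaPar μ ε m - betaPar μ ε 0 - 1) =
        kappa (partialSum k'.1 (m - 1)) (betaPar μ ε m - betaPar μ ε 0 - 1)) : k = k' := by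
  refine quantumNumbers_ext fun m hm => kappa_injective_of_pos ?_ (h m hm)
  obtain ⟨h2, h3⟩ := mem_Icc.mp hm
  obtain ⟨j, rfl⟩ : ∃ j, m = j + 2 := ⟨m - 2, by omega⟩
  linarith [one_lt_beta_sub (half_lt_betaPar_sub (ε := ε) hμ) (show j < p by omega)]

theorem casimirOp_leftVec_gridNat (hμ : ∀ i, 0 < μ i) (l : QuantumNumbers p N) {m : ℕ}
    (hm : m ∈ Icc 2 (p + 1)) :
    casimirOp (liftPar μ ε) (initialSet (p + 2) m) (leftVec (liftPar μ ε) (gridNat l.1 N)) =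
      kappa (partialSum l.1 (m - 1)) (betaPar μ ε (m - 1)) •
        leftVec (liftPar μ ε) (gridNat l.1 N) := by
  obtain ⟨h2, h3⟩ := mem_Icc.mp hm
  obtain ⟨j, rfl⟩ : ∃ j, m = j + 1 := ⟨m - 1, by omega⟩
  rw [casimirOp_leftVec (half_lt_liftPar hμ) (gridNat_mono l) (gridNat_zero _) (by omega),
    sum_initialSet_liftPar, add_sub_cancel_right, Nat.add_sub_cancel, gridNat_of_le _ (by omega)]

theorem casimirOp_rightVec_partialSum (hμ : ∀ i, 0 < μ i) (k : QuantumNumbers p N) {m : ℕ}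
    (hm : m ∈ Icc 2 (p + 1)) :
    casimirOp (liftPar μ ε) (tailSet (p + 2) (m + 1))
        (rightVec (liftPar μ ε) (partialSum k.1) N) =
      kappa (partialSum k.1 (m - 1)) (betaPar μ ε m - betaPar μ ε 0 - 1) •
        rightVec (liftPar μ ε) (partialSum k.1) N := by
  obtain ⟨h2, h3⟩ := mem_Icc.mp hm
  obtain ⟨j, rfl⟩ : ∃ j, m = j + 1 := ⟨m - 1, by omega⟩
  rw [casimirOp_rightVec (half_lt_liftPar hμ) (partialSum_mono _) (partialSum_zero _) (by omega),
    sum_tailSet_liftPar, Nat.add_sub_cancel]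

theorem form_leftVec_pos (hμ : ∀ i, 0 < μ i) (l : QuantumNumbers p N) :
    0 < form (liftPar μ ε) (leftVec (liftPar μ ε) (gridNat l.1 N))
      (leftVec (liftPar μ ε) (gridNat l.1 N)) := by
  have hα := half_lt_liftPar (ε := ε) hμ
  rw [form_leftVec_self hα (gridNat_mono l) (gridNat_zero _)]
  refine prod_pos fun j _ => jacNorm_pos ?_ (by linarith [hα (idx p (j + 1))]) _
  have := half_lt_sum_initialSet hα j
  positivity

theorem form_rightVec_pos (hμ : ∀ i, 0 < μ i) (k : QuantumNumbers p N) :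
    0 < form (liftPar μ ε) (rightVec (liftPar μ ε) (partialSum k.1) N)
      (rightVec (liftPar μ ε) (partialSum k.1) N) := by
  have hα := half_lt_liftPar (ε := ε) hμ
  have hν : ∀ j, 0 < ∑ i ∈ tailSet (p + 2) (j + 2), liftPar μ ε i + 2 * (partialSum k.1 j : ℝ) :=
    fun j => by
      have := half_lt_sum_tailSet hα j
      positivity
  rw [(isHarmonic_rightVec hα (partialSum_mono _) (partialSum_zero _) (partialSum_le k p)).2]
  exact mul_pos (prod_pos fun j _ => jacNorm_pos (hν j) (by linarith [hα (idx p (j + 2))]) _)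
    (jacNorm_pos (by linarith [hα (idx p 0)]) (hν p) _)

theorem exists_left_basis (hμ : ∀ i, 0 < μ i) :
    ∃ B : Module.Basis (QuantumNumbers p N) ℂ (harmonics μ (2 * N + ∑ i, (ε i : ℕ)) ε),
      ∀ l, (B l : MvPolynomial (Fin (p + 2)) ℂ) =
        lift ε (leftVec (liftPar μ ε) (gridNat l.1 N)) := by
  refine exists_basis_of_orthogonal hμ (fun l => ?_) (form_leftVec_pos hμ) fun l l' hne => ?_
  · have := isHarmonic_leftVec (half_lt_liftPar (ε := ε) hμ) (gridNat_mono l) (gridNat_zero _)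
    rwa [gridNat_last] at this
  · by_contra h
    exact hne (eq_of_kappa_first (ε := ε) hμ fun m hm => by
      by_contra hk
      exact h (form_eq_zero_of_casimirOp (casimirOp_leftVec_gridNat hμ l hm)
        (casimirOp_leftVec_gridNat hμ l' hm) hk))

theorem exists_right_basis (hμ : ∀ i, 0 < μ i) :
    ∃ B : Module.Basis (QuantumNumbers p N) ℂ (harmonics μ (2 * N + ∑ i, (ε i : ℕ)) ε),
      ∀ k, (B k : MvPolynomial (Fin (p + 2)) ℂ) =
        lift ε (rightVec (liftPar μ ε) (partialSum k.1) N) := by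
  refine exists_basis_of_orthogonal hμ (fun k => ?_) (form_rightVec_pos hμ) fun k k' hne => ?_
  · exact (isHarmonic_rightVec (half_lt_liftPar (ε := ε) hμ) (partialSum_mono _)
      (partialSum_zero _) (partialSum_le k p)).1
  · by_contra h
    exact hne (eq_of_kappa_second (ε := ε) hμ fun m hm => by
      by_contra hk
      exact h (form_eq_zero_of_casimirOp (casimirOp_rightVec_partialSum hμ k hm)
        (casimirOp_rightVec_partialSum hμ k' hm) hk))

/-- The square norm of a rescaled vector; `σ` is a sign. -/
theorem normSq_mul_sqrt (s : ℂ) (σ : ℝ) (hσ : σ * σ = 1) {r : ℝ} (hr : 0 ≤ r) :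
    ((‖s * ((σ * √r : ℝ) : ℂ)‖ ^ 2 : ℝ) : ℂ) = (starRingEnd ℂ) s * (s * (r : ℂ)) := by
  have h1 : ((σ * √r : ℝ)) ^ 2 = r := by
    rw [mul_pow, Real.sq_sqrt hr, pow_two, hσ, one_mul]
  rw [norm_mul, mul_pow, Complex.norm_real, Real.norm_eq_abs, sq_abs, h1, Complex.ofReal_mul,
    ← mul_assoc, mul_comm ((starRingEnd ℂ) s), Complex.mul_conj, Complex.normSq_eq_norm_sq]

end bases

end DunklRacah

end

open DunklRacah in
theorem theorem4p3 (p : ℕ) (μ : Fin (p + 2) → ℝ) (hμ : ∀ i, 0 < μ i)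
    (ε : Fin (p + 2) → Fin 2) (a N : ℕ) (ha : a = 2 * N + ∑ i, (ε i : ℕ))
    {ι ι' : Type*}
    (ψ : Module.Basis ι ℂ (harmonics μ a ε))
    (hψ : ∀ t ∈ Finset.Icc 2 (p + 1), ∀ i, ∃ c : ℂ,
      casimir μ (initialSet (p + 2) t) (ψ i) = c • (ψ i : MvPolynomial (Fin (p + 2)) ℂ))
    (φ : Module.Basis ι' ℂ (harmonics μ a ε))
    (hφ : ∀ t ∈ Finset.Icc 3 (p + 2), ∀ j, ∃ c : ℂ,
      casimir μ (tailSet (p + 2) t) (φ j) = c • (φ j : MvPolynomial (Fin (p + 2)) ℂ)) :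
    -- the labelling of the two bases by quantum numbers exists and is unique
    (∃! l : ι ≃ QuantumNumbers p N, IsFirstLabelling μ ε (fun i => (ψ i : MvPolynomial (Fin (p + 2)) ℂ)) l) ∧
    (∃! k : ι' ≃ QuantumNumbers p N, IsSecondLabelling μ ε (fun j => (φ j : MvPolynomial (Fin (p + 2)) ℂ)) k) ∧
    -- for these labellings, the connection coefficients are gauged Racah polynomials
    ∀ (l : ι ≃ QuantumNumbers p N) (k : ι' ≃ QuantumNumbers p N),
      IsFirstLabelling μ ε (fun i => (ψ i : MvPolynomial (Fin (p + 2)) ℂ)) l → IsSecondLabelling μ ε (fun j => (φ j : MvPolynomial (Fin (p + 2)) ℂ)) k →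
      ∃ (u : ι → ℂ) (v : ι' → ℂ),
        (∀ i, ((‖u i‖ ^ 2 : ℝ) : ℂ) = fischer μ (ψ i : MvPolynomial (Fin (p + 2)) ℂ) (ψ i)) ∧
        (∀ j, ((‖v j‖ ^ 2 : ℝ) : ℂ) = fischer μ (φ j : MvPolynomial (Fin (p + 2)) ℂ) (φ j)) ∧
        (∀ i, u i ≠ 0) ∧ (∀ j, v j ≠ 0) ∧
        ∀ i j,
          0 < omega (gridPoint (l i).1) (betaPar μ ε) N ∧
          0 < dualWeight (k j).1 (betaPar μ ε) N ∧
          fischer μ (φ j : MvPolynomial (Fin (p + 2)) ℂ) (ψ i) =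
            u i * v j *
              ((Real.sqrt (omega (gridPoint (l i).1) (betaPar μ ε) N *
                  dualWeight (k j).1 (betaPar μ ε) N) *
                multiRacah (k j).1 (gridPoint (l i).1) (betaPar μ ε) N : ℝ) : ℂ) := by
  subst ha
  obtain ⟨B, hB⟩ := exists_left_basis (N := N) (ε := ε) hμ
  obtain ⟨B', hB'⟩ := exists_right_basis (N := N) (ε := ε) hμ
  have hb : ∀ m ∈ Finset.Icc 2 (p + 1), ∀ l : QuantumNumbers p N,
      casimir μ (initialSet (p + 2) m) (B l) =
        ((kappa (partialSum l.1 (m - 1)) (betaPar μ ε (m - 1)) : ℝ) : ℂ) •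
          (B l : MvPolynomial (Fin (p + 2)) ℂ) := fun m hm l => by
    rw [hB, casimir_lift, casimirOp_leftVec_gridNat hμ l hm, lift_smul]
  have hb' : ∀ m ∈ Finset.Icc 2 (p + 1), ∀ k : QuantumNumbers p N,
      casimir μ (tailSet (p + 2) (m + 1)) (B' k) =
        ((kappa (partialSum k.1 (m - 1)) (betaPar μ ε m - betaPar μ ε 0 - 1) : ℝ) : ℂ) •
          (B' k : MvPolynomial (Fin (p + 2)) ℂ) := fun m hm k => by
    rw [hB', casimir_lift, casimirOp_rightVec_partialSum hμ k hm, lift_smul]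
  have hsep : ∀ l l' : QuantumNumbers p N, (∀ m ∈ Finset.Icc 2 (p + 1),
      ((kappa (partialSum l.1 (m - 1)) (betaPar μ ε (m - 1)) : ℝ) : ℂ) =
        ((kappa (partialSum l'.1 (m - 1)) (betaPar μ ε (m - 1)) : ℝ) : ℂ)) → l = l' :=
    fun l l' h => eq_of_kappa_first (ε := ε) hμ fun m hm => Complex.ofReal_injective (h m hm)
  have hsep' : ∀ k k' : QuantumNumbers p N, (∀ m ∈ Finset.Icc 2 (p + 1),
      ((kappa (partialSum k.1 (m - 1)) (betaPar μ ε m - betaPar μ ε 0 - 1) : ℝ) : ℂ) =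
        ((kappa (partialSum k'.1 (m - 1)) (betaPar μ ε m - betaPar μ ε 0 - 1) : ℝ) : ℂ)) →
          k = k' :=
    fun k k' h => eq_of_kappa_second (ε := ε) hμ fun m hm => Complex.ofReal_injective (h m hm)
  refine ⟨existsUnique_labelling B (T := fun m => casimir μ (initialSet (p + 2) m)) hb hsep ψ hψ,
    existsUnique_labelling B' (T := fun m => casimir μ (tailSet (p + 2) (m + 1))) hb' hsep' φ
      fun m hm => hφ (m + 1) ?_, fun l k hl hk => ?_⟩
  · rw [Finset.mem_Icc] at hm ⊢
    omega
  have hs : ∀ i, ∃ s : ℂ, ψ i = s • B (l i) := fun i =>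
    ⟨_, eq_smul_of_joint_eigenvector B (T := fun m => casimir μ (initialSet (p + 2) m)) hb hsep
      (v := ψ i) (i := l i) fun m hm => hl m hm i⟩
  have ht : ∀ j, ∃ t : ℂ, φ j = t • B' (k j) := fun j =>
    ⟨_, eq_smul_of_joint_eigenvector B' (T := fun m => casimir μ (tailSet (p + 2) (m + 1))) hb'
      hsep' (v := φ j) (i := k j) fun m hm => hk m hm j⟩
  choose s hs using hs
  choose t ht using ht
  have hs0 : ∀ i, s i ≠ 0 := fun i h => ψ.ne_zero i (by rw [hs, h, zero_smul])
  have ht0 : ∀ j, t j ≠ 0 := fun j h => φ.ne_zero j (by rw [ht, h, zero_smul])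
  have hψl : ∀ i, (ψ i : MvPolynomial (Fin (p + 2)) ℂ) =
      s i • lift ε (leftVec (liftPar μ ε) (gridNat (l i).1 N)) := fun i => by
    rw [← hB, hs]
    rfl
  have hφl : ∀ j, (φ j : MvPolynomial (Fin (p + 2)) ℂ) =
      t j • lift ε (rightVec (liftPar μ ε) (partialSum (k j).1) N) := fun j => by
    rw [← hB', ht]
    rfl
  have hκ := parityNorm_pos (ε := ε) hμ
  have hL : ∀ i, 0 < parityNorm μ ε * form (liftPar μ ε)
      (leftVec (liftPar μ ε) (gridNat (l i).1 N)) (leftVec (liftPar μ ε) (gridNat (l i).1 N)) :=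
    fun i => mul_pos hκ (form_leftVec_pos hμ (l i))
  have hR : ∀ j, 0 < parityNorm μ ε * form (liftPar μ ε)
      (rightVec (liftPar μ ε) (partialSum (k j).1) N)
      (rightVec (liftPar μ ε) (partialSum (k j).1) N) :=
    fun j => mul_pos hκ (form_rightVec_pos hμ (k j))
  have hsgn : ∀ m : ℕ, (-1 : ℝ) ^ m * (-1) ^ m = 1 := fun m => by rw [← mul_pow]; simp
  refine ⟨fun i => s i * ((1 * √(parityNorm μ ε * form (liftPar μ ε)
      (leftVec (liftPar μ ε) (gridNat (l i).1 N))
      (leftVec (liftPar μ ε) (gridNat (l i).1 N))) : ℝ) : ℂ),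
    fun j => (starRingEnd ℂ) (t j) * (((-1) ^ partialSum (k j).1 p *
      √(parityNorm μ ε * form (liftPar μ ε) (rightVec (liftPar μ ε) (partialSum (k j).1) N)
      (rightVec (liftPar μ ε) (partialSum (k j).1) N)) : ℝ) : ℂ),
    fun i => ?_, fun j => ?_, fun i => ?_, fun j => ?_, fun i j => ?_⟩
  · rw [normSq_mul_sqrt _ _ (one_mul 1) (hL i).le, hψl, fischer_smul_left, fischer_smul_right,
      fischer_lift]
  · rw [normSq_mul_sqrt _ _ (hsgn _) (hR j).le, hφl, fischer_smul_left, fischer_smul_right,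
      fischer_lift, Complex.conj_conj]
    ring
  · refine mul_ne_zero (hs0 i) ?_
    rw [one_mul]
    exact_mod_cast (Real.sqrt_pos.mpr (hL i)).ne'
  · refine mul_ne_zero ((map_ne_zero _).mpr (ht0 j)) ?_
    exact Complex.ofReal_ne_zero.mpr
      (mul_ne_zero (pow_ne_zero _ (by norm_num)) (Real.sqrt_pos.mpr (hR j)).ne')
  · obtain ⟨h1, h2, h3⟩ := form_rightVec_leftVec (ε := ε) hμ (k j) (l i)
    refine ⟨h1, h2, ?_⟩
    have h4 : ((√(parityNorm μ ε) : ℝ) : ℂ) * ((√(parityNorm μ ε) : ℝ) : ℂ) =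
        ((parityNorm μ ε : ℝ) : ℂ) := by exact_mod_cast Real.mul_self_sqrt hκ.le
    rw [hφl, hψl, fischer_smul_left, fischer_smul_right, fischer_lift, h3]
    beta_reduce
    rw [Real.sqrt_mul hκ.le, Real.sqrt_mul hκ.le]
    push_cast
    rw [← h4]
    ring
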